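/- Conventions. Locally convex spaces are Hausdorff; a complex locally convex space is also regarded as a real one. Let $E,F$ be locally convex spaces and let $U\subseteq E$ have dense interior. A map $f:U\to F$ is $C^1$ if it is continuous, the directional derivatives $df(x).v=\lim_{h\to0}\frac1h(f(x+hv)-f(x))$ ($h$ real) exist for $x\in\operatorname{int}(U)$, $v\in E$, and $(x,v)\mapsto df(x).v$ extends to a continuous map $df:U\times E\to F$. It is $C^{n+1}$ if it is $C^1$ and $df$ is $C^n$, and smooth if it is $C^n$ for all $n$; put $d^0f=f$ and $d^{n+1}f=d^n(df)$. If $E,F$ are complex, a smooth $f$ is holomorphic if $df(x)$ is $\mathbb C$-linear for all $x\in\operatorname{int}(U)$. A smooth manifold with corners modelled on $E$ is a Hausdorff space $M$ with a maximal atlas of homeomorphisms from open subsets of $M$ onto relatively open subsets of $E^+=\bigcap_{k=1}^n\lambda_k^{-1}([0,\infty))$, where $\lambda_1,\dots,\lambda_n$ are continuous real-linear functionals such that $E^+$ has non-empty (hence dense) interior, with smooth coordinate changes; it is a complex manifold with corners if $E$ is complex and the coordinate changes are holomorphic (the atlas then being maximal among such). For $E^+=E$ one gets manifolds without boundary. A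 Lie group (respectively complex Lie group) $K$ is a group with the structure of a smooth (respectively complex) manifold without boundary modelled on a locally convex (respectively complex locally convex) space such that the group operations are smooth (respectively holomorphic). The underlying locally convex space of its Lie algebra $\mathfrak k$ is identified with the modelling space of $K$. $C^\infty(M,K)$ (respectively $C^\infty_{\mathbb C}(M,K)$) is the set of continuous maps $M\to K$ that are smooth (respectively holomorphic) in all charts of $M$ and $K$; similarly for maps into a locally convex space. $C^\infty(M,\mathfrak k)$ carries the coarsest topology for which all the maps $f\mapsto d^n(f\circ\psi^{-1})\in C(\psi(U)\times E^{2^n-1},\mathfrak k)$ ($\psi:U\to E$ a chart of $M$, $n\ge0$) are continuous with respect to the compact-open topology, and $C^\infty_{\mathbb C}(M,\mathfrak k)$ the induced topology. Theorem. Let $M$ be a compact manifold with corners, let $K$ be a Lie group, and let $\varphi:W\to\varphi(W)\subseteq\mathfrak k$ be a chart of $K$ with $e\in W$ and $\varphi(e)=0$. (a) If $M$ and $K$ are smooth, then $C^\infty(M,\mathfrak k)$ is a locally convex space, $C^\infty(M,K)$ is a group under pointwise operations, and there is a unique smooth manifold structure (topology and maximal atlas) on $C^\infty(M,K)$, modelled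 on $C^\infty(M,\mathfrak k)$, which turns it into a Lie group and for which $$\varphi_*:\{\gamma\in C^\infty(M,K):\gamma(M)\subseteq W\}\to\{\xi\in C^\infty(M,\mathfrak k):\xi(M)\subseteq\varphi(W)\},\qquad \gamma\mapsto\varphi\circ\gamma,$$ is a bijection and a chart. (b) If $M$ is smooth and $K$ is complex, then $C^\infty(M,\mathfrak k)$ is a complex locally convex space, $C^\infty(M,K)$ is a group under pointwise operations, and there is a unique complex manifold structure on $C^\infty(M,K)$, modelled on $C^\infty(M,\mathfrak k)$, which turns it into a complex Lie group and for which $\varphi_*$ as in (a) is a bijection and a chart. (c) If $M$ and $K$ are complex, then $C^\infty_{\mathbb C}(M,\mathfrak k)$ is a complex locally convex space, $C^\infty_{\mathbb C}(M,K)$ is a group under pointwise operations, and there is a unique complex manifold structure on $C^\infty_{\mathbb C}(M,K)$, modelled on $C^\infty_{\mathbb C}(M,\mathfrak k)$, which turns it into a complex Lie group and for which the restriction of $\varphi_*$ to $\{\gamma\in C^\infty_{\mathbb C}(M,K):\gamma(M)\subseteq W\}\to\{\xi\in C^\infty_{\mathbb C}(M,\mathfrak k):\xi(M)\subseteq\varphi(W)\}$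 is a bijection and a chart. -/

import Mathlib

open Set Filter Topology

universe u v w x

namespace MappingGroup

section Calculus

/-- `df : E × E → F` is the differential of `f` on `U`: at interior points `df (x, v)` is the
directional derivative of `f` at `x` along `v` (with real increments), and `df` is continuous
on `U × E`. If `U` has dense interior and `F` is Hausdorff, `df` is unique on `U × E`. -/
structure HasDifferentialOn {E : Type u} {F : Type v}
    [AddCommGroup E] [Module ℝ E] [TopologicalSpace E]
    [AddCommGroup F] [Module ℝ F] [TopologicalSpace F]
    (f : E → F) (df : E × E → F) (U : Set E) : Prop where
  tendsto : ∀ x ∈ interior U, ∀ v : E,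
    Tendsto (fun h : ℝ => h⁻¹ • (f (x + h • v) - f x)) (𝓝[≠] 0) (𝓝 (df (x, v)))
  continuousOn : ContinuousOn df (U ×ˢ univ)

/-- `f` is of class `C^n` on the set `U` (with dense interior): for `n = 0` it is continuous; for
`n + 1` it is continuous, its differential on the interior of `U` exists and extends
continuously to `U × E`, and this extension is of class `C^n` on `U × E`. -/
def IsCn {F : Type v} [AddCommGroup F] [Module ℝ F] [TopologicalSpace F] :
    ℕ → ∀ {E : Type u} [AddCommGroup E] [Module ℝ E] [TopologicalSpace E],
      (E → F) → Set E → Prop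
  | 0, _, _, _, _, f, U => ContinuousOn f U
  | n + 1, E, _, _, _, f, U => ContinuousOn f U ∧
      ∃ df : E × E → F, HasDifferentialOn f df U ∧ IsCn n df (U ×ˢ univ)

/-- `f` is smooth on `U` and, at interior points, its differential is `𝕜`-linear.
For `𝕜 = ℝ` this is smoothness (real linearity of the differential of a `C^1` map between
locally convex spaces is automatic); for `𝕜 = ℂ` it is holomorphy. -/
def IsSmoothOn (𝕜 : Type*) [Semiring 𝕜] {E : Type u} {F : Type v}
    [AddCommGroup E] [Module ℝ E] [Module 𝕜 E] [TopologicalSpace E]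
    [AddCommGroup F] [Module ℝ F] [Module 𝕜 F] [TopologicalSpace F]
    (f : E → F) (U : Set E) : Prop :=
  (∀ n : ℕ, IsCn n f U) ∧
    ∃ df : E × E → F, HasDifferentialOn f df U ∧
      ∀ x ∈ interior U, IsLinearMap 𝕜 (fun v => df (x, v))

open Classical in
/-- The differential of `f` on `U` (zero if there is none). -/
noncomputable def differential {E : Type u} {F : Type v}
    [AddCommGroup E] [Module ℝ E] [TopologicalSpace E]
    [AddCommGroup F] [Module ℝ F] [TopologicalSpace F]
    (f : E → F) (U : Set E) : E × E → F :=
  if h : ∃ df : E × E → F, HasDifferentialOn f df U then h.choose else 0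

/-- For a family `g i : U → F` of maps, the coarsest topology on the index set `I` for which
`i ↦ d^n (g i)` is continuous into `C(U × E^(2^n - 1), F)` with the compact-open topology. Here
`d^0 g = g` and `d^(n+1) g = d^n (dg)`. -/
@[reducible] noncomputable def derivTopology {I : Type w} {F : Type v}
    [AddCommGroup F] [Module ℝ F] [TopologicalSpace F] :
    ℕ → ∀ {E : Type u} [AddCommGroup E] [Module ℝ E] [TopologicalSpace E],
      (I → E → F) → Set E → TopologicalSpace I
  | 0, _, _, _, _, g, U => TopologicalSpace.generateFrom
      {S | ∃ K ⊆ U, IsCompact K ∧ ∃ O : Set F, IsOpen O ∧ S = {i | MapsTo (g i) K O}}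
  | n + 1, _, _, _, _, g, U => derivTopology n (fun i => differential (g i) U) (U ×ˢ univ)

variable {E : Type u} {F : Type v}
  [AddCommGroup E] [Module ℝ E] [TopologicalSpace E]
  [AddCommGroup F] [Module ℝ F] [TopologicalSpace F]

theorem HasDifferentialOn.add [IsTopologicalAddGroup F] {f g : E → F} {df dg : E × E → F}
    {U : Set E} (hf : HasDifferentialOn f df U) (hg : HasDifferentialOn g dg U) :
    HasDifferentialOn (f + g) (df + dg) U where
  tendsto x hx v := by
    refine ((hf.tendsto x hx v).add (hg.tendsto x hx v)).congr fun h => ?_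
    rw [← smul_add]
    congr 1
    simp only [Pi.add_apply]
    abel
  continuousOn := hf.continuousOn.add hg.continuousOn

theorem HasDifferentialOn.const_smul {R : Type*} [Semiring R] [Module R F]
    [SMulCommClass ℝ R F] [ContinuousConstSMul R F] (c : R) {f : E → F} {df : E × E → F}
    {U : Set E} (hf : HasDifferentialOn f df U) :
    HasDifferentialOn (c • f) (c • df) U where
  tendsto x hx v := by
    refine ((hf.tendsto x hx v).const_smul c).congr fun h => ?_
    simp only [Pi.smul_apply]
    rw [← smul_sub, smul_comm h⁻¹ c]
  continuousOn := hf.continuousOn.const_smul c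

theorem HasDifferentialOn.zero (U : Set E) :
    HasDifferentialOn (0 : E → F) (0 : E × E → F) U where
  tendsto x hx v := by simpa using tendsto_const_nhds
  continuousOn := continuousOn_const

theorem IsCn.add [IsTopologicalAddGroup F] (n : ℕ) {E : Type u} [AddCommGroup E] [Module ℝ E]
    [TopologicalSpace E] {f g : E → F} {U : Set E} (hf : IsCn n f U) (hg : IsCn n g U) :
    IsCn n (f + g) U := by
  induction n generalizing E with
  | zero => exact ContinuousOn.add hf hg
  | succ n ih =>
    obtain ⟨hf0, df, hdf, hf1⟩ := hf
    obtain ⟨hg0, dg, hdg, hg1⟩ := hg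
    exact ⟨hf0.add hg0, df + dg, hdf.add hdg, ih hf1 hg1⟩

theorem IsCn.const_smul {R : Type*} [Semiring R] [Module R F]
    [SMulCommClass ℝ R F] [ContinuousConstSMul R F] (c : R) (n : ℕ) {E : Type u}
    [AddCommGroup E] [Module ℝ E] [TopologicalSpace E] {f : E → F} {U : Set E}
    (hf : IsCn n f U) : IsCn n (c • f) U := by
  induction n generalizing E with
  | zero => exact ContinuousOn.const_smul hf c
  | succ n ih =>
    obtain ⟨hf0, df, hdf, hf1⟩ := hf
    exact ⟨hf0.const_smul c, c • df, hdf.const_smul c, ih hf1⟩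

theorem IsCn.zero (n : ℕ) {E : Type u} [AddCommGroup E] [Module ℝ E] [TopologicalSpace E]
    (U : Set E) : IsCn n (0 : E → F) U := by
  induction n generalizing E with
  | zero => exact continuousOn_const
  | succ n ih => exact ⟨continuousOn_const, 0, HasDifferentialOn.zero U, ih _⟩

end Calculus

section Manifolds

/-- The closed cone `E^+` cut out by finitely many continuous real functionals. -/
def posCone {E : Type u} [AddCommGroup E] [Module ℝ E] [TopologicalSpace E] {n : ℕ}
    (lam : Fin n → (E →L[ℝ] ℝ)) : Set E :=
  {x | ∀ i, 0 ≤ lam i x}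

/-- A homeomorphism from an open subset of `X` onto a relatively open subset of `H ⊆ E`. -/
structure IsChart {X : Type w} {E : Type u} [TopologicalSpace E] (tX : TopologicalSpace X)
    (H : Set E) (φ : PartialEquiv X E) : Prop where
  isOpen_source : IsOpen[tX] φ.source
  target_eq : ∃ O : Set E, IsOpen O ∧ φ.target = O ∩ H
  continuousOn : ContinuousOn φ φ.source
  continuousOn_symm : ContinuousOn φ.symm φ.target

/-- Smoothness (`𝕜 = ℝ`) or holomorphy (`𝕜 = ℂ`) of the coordinate change from `φ` to `ψ`. -/
def SmoothChange (𝕜 : Type*) [Semiring 𝕜] {X : Type w} {E : Type u}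
    [AddCommGroup E] [Module ℝ E] [Module 𝕜 E] [TopologicalSpace E]
    (φ ψ : PartialEquiv X E) : Prop :=
  IsSmoothOn 𝕜 (fun x => ψ (φ.symm x)) {x | x ∈ φ.target ∧ φ.symm x ∈ ψ.source}

/-- A smooth (`𝕜 = ℝ`) or complex (`𝕜 = ℂ`) manifold structure on the set `X`, with charts onto
relatively open subsets of `H ⊆ E`: a Hausdorff topology and a maximal atlas.
With `H = posCone lam` it is a manifold with corners, with `H = univ` one without boundary. -/
structure ManifoldStructure (𝕜 : Type*) [Semiring 𝕜] (X : Type w) (E : Type u)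
    [AddCommGroup E] [Module ℝ E] [Module 𝕜 E] [TopologicalSpace E] (H : Set E) where
  top : TopologicalSpace X
  t2 : @T2Space X top
  atlas : Set (PartialEquiv X E)
  isChart : ∀ φ ∈ atlas, IsChart top H φ
  cover : ∀ x : X, ∃ φ ∈ atlas, x ∈ φ.source
  compatible : ∀ φ ∈ atlas, ∀ ψ ∈ atlas, SmoothChange 𝕜 φ ψ
  maximal : ∀ ρ : PartialEquiv X E, IsChart top H ρ →
    (∀ φ ∈ atlas, SmoothChange 𝕜 φ ρ ∧ SmoothChange 𝕜 ρ φ) → ρ ∈ atlas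

/-- `f` is a smooth (`𝕜 = ℝ`) or holomorphic (`𝕜 = ℂ`) map with respect to the atlases `A` and
`B`, where `B` is an atlas of a manifold without boundary (so that interior points of the
source are automatically mapped to interior points). -/
structure IsSmoothMap (𝕜 : Type*) [Semiring 𝕜] {X : Type w} {Y : Type x} {E : Type u}
    {F : Type v} [AddCommGroup E] [Module ℝ E] [Module 𝕜 E] [TopologicalSpace E]
    [AddCommGroup F] [Module ℝ F] [Module 𝕜 F] [TopologicalSpace F]
    (tX : TopologicalSpace X) (A : Set (PartialEquiv X E))
    (tY : TopologicalSpace Y) (B : Set (PartialEquiv Y F)) (f : X → Y) : Prop where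
  continuous : Continuous[tX, tY] f
  smooth : ∀ φ ∈ A, ∀ ψ ∈ B, IsSmoothOn 𝕜 (fun x => ψ (f (φ.symm x)))
    {x | x ∈ φ.target ∧ f (φ.symm x) ∈ ψ.source}

/-- A Lie group structure (smooth for `𝕜 = ℝ`, complex for `𝕜 = ℂ`) on the group `G`, modelled
on `F`. The manifold structure of `G × G` is given by the products of charts. -/
structure LieGroupStructure (𝕜 : Type*) [Semiring 𝕜] (G : Type w) [Group G] (F : Type u)
    [AddCommGroup F] [Module ℝ F] [Module 𝕜 F] [TopologicalSpace F]
    extends ManifoldStructure 𝕜 G F (univ : Set F) where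
  smooth_mul : IsSmoothMap 𝕜 (@instTopologicalSpaceProd G G top top)
    (Set.image2 (fun φ ψ => φ.prod ψ) atlas atlas) top atlas (fun p : G × G => p.1 * p.2)
  smooth_inv : IsSmoothMap 𝕜 top atlas top atlas (fun g : G => g⁻¹)

end Manifolds

section FunctionSpaces

variable (𝕜 : Type*) [Semiring 𝕜] {M : Type w} {E : Type u}
  [AddCommGroup E] [Module ℝ E] [Module 𝕜 E] [TopologicalSpace E]
  (A : Set (PartialEquiv M E)) (F : Type v)
  [AddCommGroup F] [Module ℝ F] [Module 𝕜 F] [TopologicalSpace F]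

/-- The space `C^∞(M, F)` (for `𝕜 = ℝ`), respectively `C^∞_ℂ(M, F)` (for `𝕜 = ℂ`), of smooth,
respectively holomorphic, maps from a manifold with atlas `A` to a locally convex space `F`. -/
def SmoothFun : Type (max w v) :=
  {f : M → F // ∀ φ ∈ A, IsSmoothOn 𝕜 (fun x => f (φ.symm x)) φ.target}

/-- The topology of compact convergence of all differentials: the coarsest one for which,
for all charts `φ : U → E` of `M` and all `n`, the map
`f ↦ d^n (f ∘ φ⁻¹) ∈ C(φ(U) × E^(2^n - 1), F)` is continuous with respect to the compact-open
topology. As the sets `φ(U) × E^(2^n - 1)` are the charts of the iterated tangent bundle `T^n M`,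
this is the topology induced by `f ↦ (d^n f)_n ∈ ∏ₙ C(T^n M, F)`. -/
noncomputable instance : TopologicalSpace (SmoothFun 𝕜 A F) :=
  ⨅ φ ∈ A, ⨅ n : ℕ, derivTopology n
    (fun (f : SmoothFun 𝕜 A F) (x : E) => f.1 (φ.symm x)) φ.target

variable {F} in
theorem IsSmoothOn.add [IsTopologicalAddGroup F] {f g : E → F} {U : Set E}
    (hf : IsSmoothOn 𝕜 f U) (hg : IsSmoothOn 𝕜 g U) : IsSmoothOn 𝕜 (f + g) U := by
  obtain ⟨hf0, df, hdf, hf1⟩ := hf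
  obtain ⟨hg0, dg, hdg, hg1⟩ := hg
  refine ⟨fun n => (hf0 n).add n (hg0 n), df + dg, hdf.add hdg, fun x hx => ?_⟩
  constructor
  · intro a b
    simp only [Pi.add_apply, (hf1 x hx).map_add, (hg1 x hx).map_add]
    abel
  · intro c a
    simp only [Pi.add_apply, (hf1 x hx).map_smul, (hg1 x hx).map_smul, smul_add]

variable {F} in
theorem IsSmoothOn.const_smul {R : Type*} [Semiring R] [Module R F]
    [SMulCommClass ℝ R F] [SMulCommClass 𝕜 R F] [ContinuousConstSMul R F] (c : R)
    {f : E → F} {U : Set E} (hf : IsSmoothOn 𝕜 f U) : IsSmoothOn 𝕜 (c • f) U := by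
  obtain ⟨hf0, df, hdf, hf1⟩ := hf
  refine ⟨fun n => (hf0 n).const_smul c n, c • df, hdf.const_smul c, fun x hx => ?_⟩
  constructor
  · intro a b
    simp only [Pi.smul_apply, (hf1 x hx).map_add, smul_add]
  · intro r a
    simp only [Pi.smul_apply, (hf1 x hx).map_smul]
    rw [smul_comm r c]

theorem IsSmoothOn.zero (U : Set E) : IsSmoothOn 𝕜 (0 : E → F) U :=
  ⟨fun n => IsCn.zero n U, 0, HasDifferentialOn.zero U, fun _ _ => (0 : E →ₗ[𝕜] F).isLinear⟩

variable [IsTopologicalAddGroup F]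

theorem IsSmoothOn.neg {f : E → F} {U : Set E} (hf : IsSmoothOn 𝕜 f U) :
    IsSmoothOn 𝕜 (-f) U := by
  have h := IsSmoothOn.const_smul 𝕜 (-1 : ℤ) hf
  simpa using h

/-- The smooth (holomorphic) functions as an additive subgroup of all functions. -/
def smoothFunAddSubgroup : AddSubgroup (M → F) where
  carrier := {f | ∀ φ ∈ A, IsSmoothOn 𝕜 (fun x => f (φ.symm x)) φ.target}
  add_mem' hf hg φ hφ := (hf φ hφ).add 𝕜 (hg φ hφ)
  zero_mem' φ _ := IsSmoothOn.zero 𝕜 F φ.target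
  neg_mem' hf φ hφ := (hf φ hφ).neg 𝕜

/-- Pointwise addition. -/
noncomputable instance : AddCommGroup (SmoothFun 𝕜 A F) :=
  inferInstanceAs (AddCommGroup (smoothFunAddSubgroup 𝕜 A F))

/-- Pointwise scalar multiplication, by real or by complex scalars. -/
noncomputable instance {R : Type*} [Semiring R] [Module R F]
    [SMulCommClass ℝ R F] [SMulCommClass 𝕜 R F] [ContinuousConstSMul R F] :
    Module R (SmoothFun 𝕜 A F) where
  smul c f := ⟨c • f.1, fun φ hφ => (f.2 φ hφ).const_smul 𝕜 c⟩
  one_smul f := Subtype.ext (one_smul R f.1)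
  mul_smul a b f := Subtype.ext (mul_smul a b f.1)
  smul_zero a := Subtype.ext (smul_zero (A := M → F) a)
  smul_add a f g := Subtype.ext (smul_add a f.1 g.1)
  add_smul a b f := Subtype.ext (add_smul a b f.1)
  zero_smul f := Subtype.ext (zero_smul R f.1)

end FunctionSpaces

/-- `F` is a Hausdorff locally convex topological vector space over `𝕜 ∈ {ℝ, ℂ}`. -/
structure IsLocallyConvexTVS (𝕜 : Type*) [Semiring 𝕜] [TopologicalSpace 𝕜] (F : Type v)
    [AddCommGroup F] [Module ℝ F] [Module 𝕜 F] [TopologicalSpace F] : Prop where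
  isTopologicalAddGroup : IsTopologicalAddGroup F
  continuousSMul : ContinuousSMul 𝕜 F
  locallyConvexSpace : LocallyConvexSpace ℝ F
  t2Space : T2Space F

/-- `Φ` is the push-forward `γ ↦ φ ∘ γ` of the chart `φ : W → φ(W)`, defined on the set of all
elements of `G` (a group of maps `M → K`) with values in `W`, with image the set of all elements
of the function space with values in `φ(W)`. -/
structure IsPushForward (𝕜 : Type*) [Semiring 𝕜] {M : Type w} {E : Type u}
    [AddCommGroup E] [Module ℝ E] [Module 𝕜 E] [TopologicalSpace E]
    {A : Set (PartialEquiv M E)} {F : Type v}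
    [AddCommGroup F] [Module ℝ F] [Module 𝕜 F] [TopologicalSpace F]
    {K : Type x} [Group K] (φ : PartialEquiv K F) {G : Subgroup (M → K)}
    (Φ : PartialEquiv G (SmoothFun 𝕜 A F)) : Prop where
  source_eq : Φ.source = {γ : G | ∀ m, γ.1 m ∈ φ.source}
  target_eq : Φ.target = {ξ : SmoothFun 𝕜 A F | ∀ m, ξ.1 m ∈ φ.target}
  apply_eq : ∀ γ ∈ Φ.source, ∀ m, (Φ γ).1 m = φ (γ.1 m)

end MappingGroup

/-!
A family of maps `f m : F → H`, jointly smooth in `m ∈ M` and in the argument, acts on functions by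
the push-forward `(f_* ξ) m = f m (ξ m)`. Its difference quotients converge, uniformly on compact
sets and together with all their derivatives, which is convergence in the topology of the function
space; hence the differential of `f_*` is the push-forward along the fibrewise differential of `f`,
and `f_*` is smooth by induction on the order.

The coordinate changes between the left translates of `φ_*` are push-forwards of this kind, for
instance along `f m = φ ∘ (x ↦ a(m)⁻¹ b(m) x) ∘ φ⁻¹`, and so are multiplication and inversion in
these coordinates. So the translates generate a Lie group structure. It is the only one: the left
translations are diffeomorphisms for every Lie group structure, so that with `φ_*` all its left
translates are charts, and they cover the group.
-/

universe y

namespace MappingGroup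

/-! ### Curves in locally convex spaces -/

section Curves

variable {F : Type v} [AddCommGroup F] [Module ℝ F] [TopologicalSpace F]

/-- The curve `α` has velocity `a` at the time `s`. Mathlib's `HasDerivAt` has no usable theory
for curves in spaces without a norm. -/
def HasSlope (α : ℝ → F) (a : F) (s : ℝ) : Prop :=
  Tendsto (fun h : ℝ => h⁻¹ • (α (s + h) - α s)) (𝓝[≠] 0) (𝓝 a)

theorem HasSlope.comp_continuousLinearMap {α : ℝ → F} {a : F} {s : ℝ} (h : HasSlope α a s)
    (f : F →L[ℝ] ℝ) : HasDerivAt (fun t => f (α t)) (f a) s := by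
  rw [hasDerivAt_iff_tendsto_slope_zero]
  exact ((f.continuous.tendsto a).comp h).congr fun t => by simp

theorem HasSlope.sub [IsTopologicalAddGroup F] {α β : ℝ → F} {a b : F} {s : ℝ}
    (hα : HasSlope α a s) (hβ : HasSlope β b s) : HasSlope (fun t => α t - β t) (a - b) s :=
  (Tendsto.sub hα hβ).congr fun h => by rw [← smul_sub, sub_sub_sub_comm]

theorem HasSlope.const_smul [ContinuousConstSMul ℝ F] {α : ℝ → F} {a : F} {s : ℝ}
    (hα : HasSlope α a s) (c : ℝ) : HasSlope (fun t => c • α t) (c • a) s :=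
  (Tendsto.const_smul hα c).congr fun h => by rw [← smul_sub, smul_comm]

theorem exists_forall_mem_ball_of_eventually_prod {ι : Type*} {l : Filter ι} {s₀ : ℝ}
    {p : ι × ℝ → Prop} (h : ∀ᶠ z in l ×ˢ 𝓝 s₀, p z) :
    ∃ δ > 0, ∀ᶠ i in l, ∀ s ∈ Metric.ball s₀ δ, p (i, s) := by
  obtain ⟨pa, ha, pb, hb, hab⟩ := eventually_prod_iff.1 h
  obtain ⟨δ, hδ, hball⟩ := Metric.eventually_nhds_iff_ball.1 hb
  exact ⟨δ, hδ, ha.mono fun i hi s hs => hab hi (hball s hs)⟩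

theorem uIcc_subset_ball {s₀ δ h : ℝ} (hh : |h| < δ) : uIcc s₀ (s₀ + h) ⊆ Metric.ball s₀ δ := by
  have h0 : s₀ ∈ Metric.ball s₀ δ := Metric.mem_ball_self ((abs_nonneg h).trans_lt hh)
  have h1 : s₀ + h ∈ Metric.ball s₀ δ := by simpa [Metric.mem_ball, Real.dist_eq] using hh
  rw [← segment_eq_uIcc]
  exact (convex_ball s₀ δ).segment_subset h0 h1

theorem eventually_abs_lt {ι : Type*} {l : Filter ι} {h : ι → ℝ} (hh : Tendsto h l (𝓝 0)) {δ : ℝ}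
    (hδ : 0 < δ) : ∀ᶠ i in l, |h i| < δ := by
  simpa using hh.abs.eventually_lt_const (by simpa using hδ)

theorem exists_mem_uIcc_eq_slope {f f' : ℝ → ℝ} {a h : ℝ} (hh : h ≠ 0)
    (hf : ∀ s ∈ uIcc a (a + h), HasDerivAt f (f' s) s) :
    ∃ c ∈ uIcc a (a + h), f' c = h⁻¹ * (f (a + h) - f a) := by
  have hmem : ∀ t ∈ Icc (0 : ℝ) 1, a + t * h ∈ uIcc a (a + h) := fun t ht => by
    rw [← segment_eq_uIcc]
    exact (convex_segment a (a + h)).add_smul_mem (left_mem_segment ..) (right_mem_segment ..) ht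
  have hd : ∀ t ∈ Icc (0 : ℝ) 1, HasDerivAt (fun t => f (a + t * h)) (f' (a + t * h) * h) t :=
    fun t ht => (hf _ (hmem t ht)).comp t ((hasDerivAt_mul_const h).const_add a)
  obtain ⟨t, ht, heq⟩ := exists_hasDerivAt_eq_slope (fun t => f (a + t * h))
    (fun t => f' (a + t * h) * h) zero_lt_one
    (fun t ht => (hd t ht).continuousAt.continuousWithinAt)
    fun t ht => hd t (Ioo_subset_Icc_self ht)
  refine ⟨_, hmem t (Ioo_subset_Icc_self ht), ?_⟩
  rw [eq_inv_mul_iff_mul_eq₀ hh, mul_comm, heq]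
  simp

variable [IsTopologicalAddGroup F] [ContinuousSMul ℝ F] [LocallyConvexSpace ℝ F]

theorem exists_isClosed_convex_nhds {y : F} {s : Set F} (hs : s ∈ 𝓝 y) :
    ∃ C ∈ 𝓝 y, IsClosed C ∧ Convex ℝ C ∧ C ⊆ s := by
  obtain ⟨t, ht, htc, hts⟩ := exists_mem_nhds_isClosed_subset hs
  obtain ⟨c, ⟨hc, hcc⟩, hct⟩ := (LocallyConvexSpace.convex_basis (𝕜 := ℝ) y).mem_iff.1 ht
  exact ⟨closure c, mem_of_superset hc subset_closure, isClosed_closure, hcc.closure,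
    (closure_minimal hct htc).trans hts⟩

theorem tendsto_of_forall_isClosed_convex {ι : Type*} {l : Filter ι} {f : ι → F} {y : F}
    (h : ∀ C ∈ 𝓝 y, IsClosed C → Convex ℝ C → ∀ᶠ i in l, f i ∈ C) : Tendsto f l (𝓝 y) := by
  intro s hs
  obtain ⟨C, hC, hclosed, hconvex, hCs⟩ := exists_isClosed_convex_nhds hs
  exact (h C hC hclosed hconvex).mono fun i hi => hCs hi

/-- By Hahn–Banach, the mean value theorem reduces to the one for real-valued functions. -/
theorem slope_mem_of_forall_mem {α α' : ℝ → F} {a h : ℝ} (hh : h ≠ 0) {C : Set F}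
    (hC : Convex ℝ C) (hC' : IsClosed C) (hα : ∀ s ∈ uIcc a (a + h), HasSlope α (α' s) s)
    (hm : ∀ s ∈ uIcc a (a + h), α' s ∈ C) : h⁻¹ • (α (a + h) - α a) ∈ C := by
  by_contra hn
  obtain ⟨f, u, hfC, hfu⟩ := geometric_hahn_banach_closed_point hC hC' hn
  obtain ⟨c, hc, hslope⟩ := exists_mem_uIcc_eq_slope (f' := fun s => f (α' s)) hh
    fun s hs => (hα s hs).comp_continuousLinearMap f
  have hlt := hfC _ (hm c hc)
  rw [hslope] at hlt
  rw [map_smul, map_sub, smul_eq_mul] at hfu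
  exact lt_asymm hlt hfu

theorem hasSlope_of_tendsto {ι : Type*} {l : Filter ι} [l.NeBot] {a b : ι → ℝ → F} {a₀ : ℝ → F}
    {b₀ : F} {s₀ : ℝ} (hd : ∀ᶠ p in l ×ˢ 𝓝 s₀, HasSlope (a p.1) (b p.1 p.2) p.2)
    (hb : Tendsto (fun p : ι × ℝ => b p.1 p.2) (l ×ˢ 𝓝 s₀) (𝓝 b₀))
    (ha : ∀ᶠ s in 𝓝 s₀, Tendsto (fun i => a i s) l (𝓝 (a₀ s))) : HasSlope a₀ b₀ s₀ := by
  refine tendsto_of_forall_isClosed_convex fun C hC hclosed hconvex => ?_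
  obtain ⟨δ, hδ, hball⟩ :=
    exists_forall_mem_ball_of_eventually_prod (hd.and (hb.eventually_mem hC))
  obtain ⟨ε, hε, ha⟩ := Metric.eventually_nhds_iff_ball.1 ha
  filter_upwards [nhdsWithin_le_nhds (eventually_abs_lt tendsto_id (lt_min hδ hε)),
    self_mem_nhdsWithin] with h hh hne
  have hlim : Tendsto (fun i => h⁻¹ • (a i (s₀ + h) - a i s₀)) l
      (𝓝 (h⁻¹ • (a₀ (s₀ + h) - a₀ s₀))) := by
    have hsub := uIcc_subset_ball (s₀ := s₀) (hh.trans_le (min_le_right δ ε))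
    exact ((ha _ (hsub right_mem_uIcc)).sub (ha _ (hsub left_mem_uIcc))).const_smul _
  refine hclosed.mem_of_tendsto hlim (hball.mono fun i hi => ?_)
  have hsub := uIcc_subset_ball (s₀ := s₀) (hh.trans_le (min_le_left δ ε))
  exact slope_mem_of_forall_mem hne hconvex hclosed (fun s hs => (hi s (hsub hs)).1)
    fun s hs => (hi s (hsub hs)).2

end Curves

section Accessible

variable {E : Type u} [AddCommGroup E] [Module ℝ E] [TopologicalSpace E]

/-- Every point of `U` is the initial point of a short segment in the interior of `U`. For such
sets, which include the open sets and the convex sets with non-empty interior, differentials on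
`U` are determined by limits along segments. -/
def Accessible (U : Set E) : Prop :=
  ∀ x ∈ U, ∃ u : E, ∀ᶠ t : ℝ in 𝓝[>] 0, x + t • u ∈ interior U

theorem accessible_of_isOpen {U : Set E} (hU : IsOpen U) : Accessible U := fun x hx =>
  ⟨0, Eventually.of_forall fun t => by simpa [hU.interior_eq] using hx⟩

theorem Accessible.prod_univ {E' : Type w} [AddCommGroup E'] [Module ℝ E'] [TopologicalSpace E']
    {U : Set E} (hU : Accessible U) : Accessible (U ×ˢ (univ : Set E')) := by
  rintro ⟨x, y⟩ ⟨hx, -⟩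
  obtain ⟨u, hu⟩ := hU x hx
  refine ⟨(u, 0), hu.mono fun t ht => ?_⟩
  rw [interior_prod_eq, interior_univ]
  exact ⟨ht, trivial⟩

variable [IsTopologicalAddGroup E] [ContinuousSMul ℝ E]

theorem accessible_of_convex {U : Set E} (hU : Convex ℝ U) (hne : (interior U).Nonempty) :
    Accessible U := by
  obtain ⟨p, hp⟩ := hne
  refine fun x hx => ⟨p - x, ?_⟩
  filter_upwards [Ioc_mem_nhdsGT (zero_lt_one (α := ℝ))] with t ht
  exact hU.add_smul_sub_mem_interior hx hp ht

theorem tendsto_add_smul (x v : E) : Tendsto (fun t : ℝ => x + t • v) (𝓝 0) (𝓝 x) := by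
  have : Continuous fun t : ℝ => x + t • v := by fun_prop
  simpa using this.tendsto 0

theorem eventually_add_smul_mem {U : Set E} {x : E} (hx : x ∈ interior U) (v : E) :
    ∀ᶠ t : ℝ in 𝓝 0, x + t • v ∈ interior U :=
  (tendsto_add_smul x v).eventually_mem (isOpen_interior.mem_nhds hx)

theorem Accessible.inter_isOpen {U O : Set E} (hU : Accessible U) (hO : IsOpen O) :
    Accessible (U ∩ O) := by
  rintro x ⟨hx, hxO⟩
  obtain ⟨u, hu⟩ := hU x hx
  refine ⟨u, ?_⟩
  filter_upwards [hu, nhdsWithin_le_nhds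
    ((tendsto_add_smul x u).eventually_mem (hO.mem_nhds hxO))] with t h1 h2
  rw [interior_inter, hO.interior_eq]
  exact ⟨h1, h2⟩

theorem Accessible.nhdsWithin_neBot {U : Set E} (hU : Accessible U) {x : E} (hx : x ∈ U) :
    (𝓝[interior U] x).NeBot := by
  obtain ⟨u, hu⟩ := hU x hx
  have h : Tendsto (fun t : ℝ => x + t • u) (𝓝[>] 0) (𝓝[interior U] x) :=
    tendsto_nhdsWithin_iff.2 ⟨(tendsto_add_smul x u).mono_left nhdsWithin_le_nhds, hu⟩
  exact h.neBot

end Accessible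

/-! ### Differentials -/

section Differential

variable {E : Type u} {F : Type v}
  [AddCommGroup E] [Module ℝ E] [TopologicalSpace E]
  [AddCommGroup F] [Module ℝ F] [TopologicalSpace F]
  {f g : E → F} {df dg : E × E → F} {U : Set E}

theorem HasDifferentialOn.hasSlope (hf : HasDifferentialOn f df U) {x v : E} {t : ℝ}
    (hx : x + t • v ∈ interior U) :
    HasSlope (fun t : ℝ => f (x + t • v)) (df (x + t • v, v)) t := by
  refine (hf.tendsto _ hx v).congr fun h => ?_
  simp only [add_smul, add_assoc]

theorem HasDifferentialOn.inter (hf : HasDifferentialOn f df U) (O : Set E) :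
    HasDifferentialOn f df (U ∩ O) where
  tendsto x hx v := hf.tendsto x (interior_mono inter_subset_left hx) v
  continuousOn := hf.continuousOn.mono (prod_mono inter_subset_left subset_rfl)

theorem HasDifferentialOn.hasDifferentialOn_differential (hf : HasDifferentialOn f df U) :
    HasDifferentialOn f (differential f U) U := by
  have h : ∃ df : E × E → F, HasDifferentialOn f df U := ⟨df, hf⟩
  rw [differential, dif_pos h]
  exact h.choose_spec

theorem HasDifferentialOn.continuousAt (hf : HasDifferentialOn f df U) {x : E}
    (hx : x ∈ interior U) (v : E) : ContinuousAt df (x, v) := by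
  refine (hf.continuousOn (x, v) ⟨interior_subset hx, trivial⟩).continuousAt ?_
  exact prod_mem_nhds (mem_interior_iff_mem_nhds.1 hx) univ_mem

section TVS

variable [IsTopologicalAddGroup E] [ContinuousSMul ℝ E]

theorem HasDifferentialOn.congr (hf : HasDifferentialOn f df U) (h : EqOn f g U) :
    HasDifferentialOn g df U where
  tendsto x hx v := by
    refine (hf.tendsto x hx v).congr' ?_
    filter_upwards [nhdsWithin_le_nhds (eventually_add_smul_mem hx v)] with t ht
    rw [h (interior_subset hx), h (interior_subset ht)]
  continuousOn := hf.continuousOn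

theorem differential_congr (h : EqOn f g U) : differential f U = differential g U := by
  have hiff : (HasDifferentialOn f · U) = (HasDifferentialOn g · U) :=
    funext fun df => propext ⟨fun hf => hf.congr h, fun hg => hg.congr h.symm⟩
  unfold differential
  congr!

theorem HasDifferentialOn.eqOn [T2Space F] (hf : HasDifferentialOn f df U)
    (hg : HasDifferentialOn f dg U) (hU : Accessible U) : EqOn df dg (U ×ˢ univ) := by
  have hint : EqOn df dg (interior (U ×ˢ univ)) := by
    rw [interior_prod_eq, interior_univ]
    rintro ⟨x, v⟩ ⟨hx, -⟩
    exact tendsto_nhds_unique (hf.tendsto x hx v) (hg.tendsto x hx v)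
  intro z hz
  have := hU.prod_univ.nhdsWithin_neBot hz
  refine tendsto_nhds_unique (((hf.continuousOn z hz).mono_left
    (nhdsWithin_mono z interior_subset)).congr' ?_)
    ((hg.continuousOn z hz).mono_left (nhdsWithin_mono z interior_subset))
  filter_upwards [self_mem_nhdsWithin] with y hy using hint hy

theorem HasDifferentialOn.differential_eqOn [T2Space F] (hf : HasDifferentialOn f df U)
    (hU : Accessible U) : EqOn (differential f U) df (U ×ˢ univ) :=
  hf.hasDifferentialOn_differential.eqOn hf hU

theorem HasDifferentialOn.eqOn_inter [T2Space F] {O O' : Set E}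
    (hf : HasDifferentialOn f df (U ∩ O)) (hf' : HasDifferentialOn f dg (U ∩ O'))
    (hU : Accessible U) (hO : IsOpen O) (hO' : IsOpen O') :
    EqOn df dg ((U ∩ O ∩ O') ×ˢ univ) := by
  have hf' := hf'.inter O
  rw [inter_right_comm] at hf'
  exact (hf.inter O').eqOn hf' ((hU.inter_isOpen hO).inter_isOpen hO')

variable [IsTopologicalAddGroup F] [ContinuousSMul ℝ F] [LocallyConvexSpace ℝ F]

/-- At boundary points `x`, the differential still computes slopes in those directions `v` along
which the segment at `x` is a limit of segments in the interior. -/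
theorem HasDifferentialOn.hasSlope_of_eventually_mem_interior
    (hf : HasDifferentialOn f df U) (hfc : ContinuousOn f U) {x u v : E}
    (hint : ∀ᶠ p : ℝ × ℝ in 𝓝[>] 0 ×ˢ 𝓝 0, x + p.1 • u + p.2 • v ∈ interior U)
    (hv : ∀ᶠ s : ℝ in 𝓝 0, x + s • v ∈ U) :
    HasSlope (fun s : ℝ => f (x + s • v)) (df (x, v)) 0 := by
  have hx : x ∈ U := by simpa using hv.self_of_nhds
  refine hasSlope_of_tendsto (l := 𝓝[>] (0 : ℝ)) (a := fun t s => f (x + t • u + s • v))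
    (b := fun t s => df (x + t • u + s • v, v)) (hint.mono fun p hp => hf.hasSlope hp) ?_ ?_
  · have hc : Continuous fun p : ℝ × ℝ => (x + p.1 • u + p.2 • v, v) := by fun_prop
    have hlim := hc.tendsto (0, 0)
    rw [nhds_prod_eq] at hlim
    simp only [zero_smul, add_zero] at hlim
    exact (hf.continuousOn (x, v) ⟨hx, trivial⟩).tendsto.comp (tendsto_nhdsWithin_iff.2
      ⟨hlim.mono_left (Filter.prod_mono nhdsWithin_le_nhds le_rfl),
        hint.mono fun p hp => ⟨interior_subset hp, trivial⟩⟩)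
  · obtain ⟨δ, hδ, hball⟩ := exists_forall_mem_ball_of_eventually_prod hint
    filter_upwards [hv, Metric.ball_mem_nhds (0 : ℝ) hδ] with s hs hsδ
    have hc : Continuous fun t : ℝ => x + t • u + s • v := by fun_prop
    have hlim := (hc.tendsto 0).mono_left (nhdsWithin_le_nhds (s := Ioi 0))
    simp only [zero_smul, add_zero] at hlim
    exact (hfc _ hs).tendsto.comp (tendsto_nhdsWithin_iff.2
      ⟨hlim, hball.mono fun t ht => interior_subset (ht s hsδ)⟩)

theorem HasDifferentialOn.tendsto_slope (hf : HasDifferentialOn f df U) {ι : Type*}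
    {l : Filter ι} {y w : ι → E} {h : ι → ℝ} {x v : E} (hx : x ∈ interior U)
    (hy : Tendsto y l (𝓝 x)) (hw : Tendsto w l (𝓝 v)) (hh : Tendsto h l (𝓝[≠] 0)) :
    Tendsto (fun i => (h i)⁻¹ • (f (y i + h i • w i) - f (y i))) l (𝓝 (df (x, v))) := by
  refine tendsto_of_forall_isClosed_convex fun C hC hclosed hconvex => ?_
  have hline : Tendsto (fun p : (E × E) × ℝ => (p.1.1 + p.2 • p.1.2, p.1.2))
      (𝓝 (x, v) ×ˢ 𝓝 0) (𝓝 (x, v)) := by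
    have : Continuous fun p : (E × E) × ℝ => (p.1.1 + p.2 • p.1.2, p.1.2) := by fun_prop
    rw [← nhds_prod_eq]
    simpa using this.tendsto ((x, v), 0)
  have hU : ∀ᶠ p : E × E in 𝓝 (x, v), p.1 ∈ interior U ∧ df p ∈ C :=
    (continuous_fst.continuousAt.eventually (isOpen_interior.mem_nhds hx)).and
      ((hf.continuousAt hx v).eventually hC)
  obtain ⟨δ, hδ, hball⟩ := exists_forall_mem_ball_of_eventually_prod (hline.eventually hU)
  obtain ⟨hh0, hne⟩ := tendsto_nhdsWithin_iff.1 hh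
  filter_upwards [(hy.prodMk_nhds hw).eventually hball, eventually_abs_lt hh0 hδ, hne]
    with i hi hsmall hi0
  have hsub := uIcc_subset_ball (s₀ := 0) hsmall
  have := slope_mem_of_forall_mem (α := fun t : ℝ => f (y i + t • w i))
    (α' := fun t => df (y i + t • w i, w i)) (a := 0) (h := h i) hi0 hconvex hclosed
    (fun s hs => hf.hasSlope (hi s (hsub hs)).1) fun s hs => (hi s (hsub hs)).2
  simpa using this

theorem HasDifferentialOn.map_add [T2Space F] (hf : HasDifferentialOn f df U) {x : E}
    (hx : x ∈ interior U) (v w : E) : df (x, v + w) = df (x, v) + df (x, w) := by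
  refine tendsto_nhds_unique (hf.tendsto x hx (v + w)) ?_
  refine ((hf.tendsto x hx v).add (hf.tendsto_slope hx
    ((tendsto_add_smul x v).mono_left nhdsWithin_le_nhds) (tendsto_const_nhds (x := w))
      tendsto_id)).congr fun h => ?_
  simp only [id]
  rw [← smul_add, smul_add h v w, ← add_assoc]
  congr 1
  abel

theorem HasDifferentialOn.map_zero [T2Space F] (hf : HasDifferentialOn f df U) {x : E}
    (hx : x ∈ interior U) : df (x, 0) = 0 := by
  simpa using hf.map_add hx 0 0

end TVS

section Composition

variable {H : Type w} [AddCommGroup H] [Module ℝ H] [TopologicalSpace H]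

theorem HasDifferentialOn.const (c : F) (U : Set E) :
    HasDifferentialOn (fun _ => c) (fun _ => (0 : F)) U where
  tendsto _ _ _ := by simpa using tendsto_const_nhds
  continuousOn := continuousOn_const

theorem HasDifferentialOn.continuousLinearMap (l : E →L[ℝ] F) (U : Set E) :
    HasDifferentialOn l (fun p => l p.2) U where
  tendsto x _ v := by
    refine tendsto_const_nhds.congr' ?_
    filter_upwards [self_mem_nhdsWithin] with h (hh : h ≠ 0)
    simp [smul_smul, hh]
  continuousOn := (l.continuous.comp continuous_snd).continuousOn

theorem HasDifferentialOn.prodMk {k : E → H} {dk : E × E → H} (hf : HasDifferentialOn f df U)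
    (hk : HasDifferentialOn k dk U) :
    HasDifferentialOn (fun x => (f x, k x)) (fun p => (df p, dk p)) U where
  tendsto x hx v := (hf.tendsto x hx v).prodMk_nhds (hk.tendsto x hx v)
  continuousOn := hf.continuousOn.prodMk hk.continuousOn

theorem HasDifferentialOn.comp_continuousLinearMap (hf : HasDifferentialOn f df U)
    (l : H →L[ℝ] E) {U' : Set H} (hm : MapsTo l U' U)
    (hm' : MapsTo l (interior U') (interior U)) :
    HasDifferentialOn (f ∘ l) (df ∘ l.prodMap l) U' where
  tendsto x hx v := (hf.tendsto (l x) (hm' hx) (l v)).congr fun h => by simp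
  continuousOn := hf.continuousOn.comp (l.prodMap l).continuous.continuousOn
    fun p hp => ⟨hm hp.1, trivial⟩

theorem HasDifferentialOn.comp [IsTopologicalAddGroup E] [ContinuousSMul ℝ E]
    [IsTopologicalAddGroup F] [ContinuousSMul ℝ F] [LocallyConvexSpace ℝ F]
    {k : H → E} {dk : H × H → E} {Ω : Set H} (hf : HasDifferentialOn f df U)
    (hk : HasDifferentialOn k dk Ω) (hkc : ContinuousOn k Ω) (hm : MapsTo k Ω U)
    (hm' : MapsTo k (interior Ω) (interior U)) :
    HasDifferentialOn (f ∘ k) (fun p => df (k p.1, dk p)) Ω where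
  tendsto x hx v := by
    refine (hf.tendsto_slope (hm' hx) (tendsto_const_nhds (x := k x)) (hk.tendsto x hx v)
      tendsto_id).congr' ?_
    filter_upwards [self_mem_nhdsWithin] with h (hh : h ≠ 0)
    simp [smul_smul, hh]
  continuousOn := hf.continuousOn.comp (ContinuousOn.prodMk
    (hkc.comp continuousOn_fst fun p hp => hp.1) hk.continuousOn) fun p hp => ⟨hm hp.1, trivial⟩

end Composition

end Differential

section IsCn

variable {F : Type v} [AddCommGroup F] [Module ℝ F] [TopologicalSpace F]
  {E : Type u} [AddCommGroup E] [Module ℝ E] [TopologicalSpace E]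
  {n : ℕ} {f g : E → F} {U : Set E}

theorem IsCn.continuousOn (hf : IsCn n f U) : ContinuousOn f U := by
  cases n with
  | zero => exact hf
  | succ n => exact hf.1

theorem IsCn.of_succ (hf : IsCn (n + 1) f U) : IsCn n f U := by
  induction n generalizing E with
  | zero => exact hf.1
  | succ n ih =>
    obtain ⟨hfc, df, hdf, hdfn⟩ := hf
    exact ⟨hfc, df, hdf, ih hdfn⟩

theorem IsCn.of_le {m : ℕ} (h : m ≤ n) (hf : IsCn n f U) : IsCn m f U := by
  induction n, h using Nat.le_induction with
  | base => exact hf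
  | succ n _ ih => exact ih hf.of_succ

theorem IsCn.hasDifferentialOn (hf : IsCn (n + 1) f U) :
    HasDifferentialOn f (differential f U) U :=
  hf.2.choose_spec.1.hasDifferentialOn_differential

theorem IsCn.inter_isOpen {O : Set E} (hf : IsCn n f U) (hO : IsOpen O) : IsCn n f (U ∩ O) := by
  induction n generalizing E with
  | zero => exact ContinuousOn.mono hf inter_subset_left
  | succ n ih =>
    obtain ⟨hfc, df, hdf, hdfn⟩ := hf
    refine ⟨hfc.mono inter_subset_left, df, hdf.inter O, ?_⟩
    have := ih hdfn (hO.prod isOpen_univ)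
    rwa [prod_inter_prod, inter_self] at this

theorem IsCn.const (c : F) (U : Set E) : IsCn n (fun _ => c) U := by
  cases n with
  | zero => exact continuousOn_const
  | succ n => exact ⟨continuousOn_const, _, HasDifferentialOn.const c U, IsCn.zero n _⟩

theorem IsCn.continuousLinearMap (l : E →L[ℝ] F) (U : Set E) : IsCn n l U := by
  induction n generalizing E with
  | zero => exact l.continuous.continuousOn
  | succ n ih =>
    exact ⟨l.continuous.continuousOn, _, HasDifferentialOn.continuousLinearMap l U,
      ih (l.comp (ContinuousLinearMap.snd ℝ E E)) _⟩

section Composition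

variable {H : Type w} [AddCommGroup H] [Module ℝ H] [TopologicalSpace H]

theorem IsCn.comp_continuousLinearMap (hf : IsCn n f U) (l : H →L[ℝ] E) {U' : Set H}
    (hm : MapsTo l U' U) (hm' : MapsTo l (interior U') (interior U)) : IsCn n (f ∘ l) U' := by
  induction n generalizing E H with
  | zero => exact ContinuousOn.comp hf l.continuous.continuousOn hm
  | succ n ih =>
    obtain ⟨hfc, df, hdf, hdfn⟩ := hf
    refine ⟨hfc.comp l.continuous.continuousOn hm, _, hdf.comp_continuousLinearMap l hm hm',
      ih hdfn (l.prodMap l) (fun p hp => ⟨hm hp.1, trivial⟩) ?_⟩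
    simp only [interior_prod_eq, interior_univ]
    exact fun p hp => ⟨hm' hp.1, trivial⟩

theorem IsCn.comp_fst (hf : IsCn n f U) : IsCn n (fun p : E × H => f p.1) (U ×ˢ univ) := by
  refine hf.comp_continuousLinearMap (ContinuousLinearMap.fst ℝ E H) (fun p hp => hp.1) ?_
  rw [interior_prod_eq]
  exact fun p hp => hp.1

theorem IsCn.prodMk {k : E → H} (hf : IsCn n f U) (hk : IsCn n k U) :
    IsCn n (fun x => (f x, k x)) U := by
  induction n generalizing E with
  | zero => exact ContinuousOn.prodMk hf hk
  | succ n ih =>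
    obtain ⟨hfc, df, hdf, hdfn⟩ := hf
    obtain ⟨hkc, dk, hdk, hdkn⟩ := hk
    exact ⟨hfc.prodMk hkc, _, hdf.prodMk hdk, ih hdfn hdkn⟩

theorem IsCn.comp [IsTopologicalAddGroup E] [ContinuousSMul ℝ E] [IsTopologicalAddGroup F]
    [ContinuousSMul ℝ F] [LocallyConvexSpace ℝ F] {k : H → E} {Ω : Set H} (hf : IsCn n f U)
    (hk : IsCn n k Ω) (hm : MapsTo k Ω U) (hm' : MapsTo k (interior Ω) (interior U)) :
    IsCn n (f ∘ k) Ω := by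
  induction n generalizing E H with
  | zero => exact ContinuousOn.comp hf hk hm
  | succ n ih =>
    have hk' := hk.of_succ
    obtain ⟨hfc, df, hdf, hdfn⟩ := hf
    obtain ⟨hkc, dk, hdk, hdkn⟩ := hk
    refine ⟨hfc.comp hkc hm, _, hdf.comp hdk hkc hm hm', ?_⟩
    refine ih (k := fun p : H × H => (k p.1, dk p)) hdfn (hk'.comp_fst.prodMk hdkn)
      (fun p hp => ⟨hm hp.1, trivial⟩) ?_
    simp only [interior_prod_eq, interior_univ]
    exact fun p hp => ⟨hm' hp.1, trivial⟩

end Composition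

variable [IsTopologicalAddGroup E] [ContinuousSMul ℝ E]

theorem IsCn.congr (hf : IsCn n f U) (h : EqOn f g U) : IsCn n g U := by
  cases n with
  | zero => exact ContinuousOn.congr hf h.symm
  | succ n =>
    obtain ⟨hfc, df, hdf, hdfn⟩ := hf
    exact ⟨hfc.congr h.symm, df, hdf.congr h, hdfn⟩

variable [T2Space F]

protected theorem IsCn.differential (hf : IsCn (n + 1) f U) (hU : Accessible U) :
    IsCn n (differential f U) (U ×ˢ univ) := by
  obtain ⟨-, df, hdf, hdfn⟩ := hf
  exact hdfn.congr (hdf.differential_eqOn hU).symm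

/-- By uniqueness, the differentials of `f` on the pieces glue to one on `U`. -/
theorem IsCn.of_local (hU : Accessible U)
    (h : ∀ x ∈ U, ∃ O, IsOpen O ∧ x ∈ O ∧ IsCn n f (U ∩ O)) : IsCn n f U := by
  induction n generalizing E with
  | zero => exact continuousOn_of_locally_continuousOn h
  | succ n ih =>
    have hfc : ContinuousOn f U := continuousOn_of_locally_continuousOn fun x hx =>
      (h x hx).imp fun O hO => ⟨hO.1, hO.2.1, hO.2.2.continuousOn⟩
    choose! O hO hxO hf using h
    set df : E × E → F := fun p => differential f (U ∩ O p.1) p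
    have hglue : ∀ x ∈ U, EqOn df (differential f (U ∩ O x)) ((U ∩ O x) ×ˢ univ) := by
      rintro x hx ⟨y, v⟩ ⟨⟨hy, hyx⟩, -⟩
      exact (hf y hy).hasDifferentialOn.eqOn_inter (hf x hx).hasDifferentialOn hU (hO y hy)
        (hO x hx) ⟨⟨⟨hy, hxO y hy⟩, hyx⟩, trivial⟩
    have hdf : IsCn n df (U ×ˢ univ) := by
      refine ih hU.prod_univ ?_
      rintro ⟨x, v⟩ ⟨hx, -⟩
      refine ⟨O x ×ˢ univ, (hO x hx).prod isOpen_univ, ⟨hxO x hx, trivial⟩, ?_⟩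
      rw [prod_inter_prod, inter_self]
      exact ((hf x hx).differential (hU.inter_isOpen (hO x hx))).congr (hglue x hx).symm
    refine ⟨hfc, df, ⟨fun x hx v => ?_, hdf.continuousOn⟩, hdf⟩
    have hxU := interior_subset hx
    refine (hf x hxU).hasDifferentialOn.tendsto x ?_ v
    rw [interior_inter, (hO x hxU).interior_eq]
    exact ⟨hx, hxO x hxU⟩

end IsCn

/-! ### Convergence on compact sets and parameter dependence -/

section CompactConvergence

/-- Continuous convergence on compact subsets of `U` (for continuous maps, this is convergence in
the compact-open topology). -/
def TendstoOnCompacts {ι : Type*} {E : Type*} {F : Type*} [TopologicalSpace E] [TopologicalSpace F]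
    (g : ι → E → F) (l : Filter ι) (g₀ : E → F) (U : Set E) : Prop :=
  ∀ K ⊆ U, IsCompact K → ∀ x ∈ K,
    Tendsto (fun p : ι × E => g p.1 p.2) (l ×ˢ 𝓝[K] x) (𝓝 (g₀ x))

variable {ι : Type*} {E E' F H : Type*} [TopologicalSpace E] [TopologicalSpace E']
  [TopologicalSpace F] [TopologicalSpace H] {l : Filter ι} {g g' : ι → E → F} {g₀ g₀' : E → F}
  {U : Set E}

theorem TendstoOnCompacts.congr (h : TendstoOnCompacts g l g₀ U)
    (hg : ∀ᶠ i in l, EqOn (g i) (g' i) U) (hg₀ : EqOn g₀ g₀' U) :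
    TendstoOnCompacts g' l g₀' U := by
  intro K hK hKc x hx
  rw [← hg₀ (hK hx)]
  refine (h K hK hKc x hx).congr' ?_
  filter_upwards [hg.prod_mk (self_mem_nhdsWithin (a := x) (s := K))] with p hp
  exact hp.1 (hK hp.2)

theorem TendstoOnCompacts.comp_right (h : TendstoOnCompacts g l g₀ U) {γ : E' → E} {U' : Set E'}
    (hγ : ContinuousOn γ U') (hm : MapsTo γ U' U) :
    TendstoOnCompacts (fun i => g i ∘ γ) l (g₀ ∘ γ) U' := by
  intro K hK hKc x hx
  have hlim := h (γ '' K) ((hm.mono_left hK).image_subset)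
    (hKc.image_of_continuousOn (hγ.mono hK)) (γ x) (mem_image_of_mem γ hx)
  refine hlim.comp (tendsto_id.prodMap ?_)
  exact (hγ.mono hK x hx).tendsto_nhdsWithin (mapsTo_image γ K)

theorem TendstoOnCompacts.comp_left (h : TendstoOnCompacts g l g₀ U) {k : F → H} {Ω : Set F}
    (hk : ContinuousOn k Ω) (hg : ∀ᶠ i in l, MapsTo (g i) U Ω) (hg₀ : MapsTo g₀ U Ω) :
    TendstoOnCompacts (fun i => k ∘ g i) l (k ∘ g₀) U := by
  intro K hK hKc x hx
  refine (hk (g₀ x) (hg₀ (hK hx))).tendsto.comp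
    (tendsto_nhdsWithin_iff.2 ⟨h K hK hKc x hx, ?_⟩)
  filter_upwards [hg.prod_mk (self_mem_nhdsWithin (a := x) (s := K))] with p hp
  exact hp.1 (hK hp.2)

theorem TendstoOnCompacts.prodMk (h : TendstoOnCompacts g l g₀ U) {k : ι → E → H} {k₀ : E → H}
    (hk : TendstoOnCompacts k l k₀ U) :
    TendstoOnCompacts (fun i x => (g i x, k i x)) l (fun x => (g₀ x, k₀ x)) U :=
  fun _ hK hKc x hx => (h _ hK hKc x hx).prodMk_nhds (hk _ hK hKc x hx)

theorem tendstoOnCompacts_const (h : ContinuousOn g₀ U) :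
    TendstoOnCompacts (fun _ : ι => g₀) l g₀ U := fun _ hK _ x hx =>
  ((h x (hK hx)).mono_left (nhdsWithin_mono x hK)).comp tendsto_snd

theorem TendstoOnCompacts.tendsto_apply (h : TendstoOnCompacts g l g₀ U) {x : E} (hx : x ∈ U) :
    Tendsto (fun i => g i x) l (𝓝 (g₀ x)) :=
  (h {x} (singleton_subset_iff.2 hx) isCompact_singleton x rfl).comp
    (tendsto_id.prodMk (tendsto_const_nhdsWithin rfl))

theorem TendstoOnCompacts.tendsto_nhds [LocallyCompactSpace E] (h : TendstoOnCompacts g l g₀ U)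
    {x : E} (hx : U ∈ 𝓝 x) :
    Tendsto (fun p : ι × E => g p.1 p.2) (l ×ˢ 𝓝 x) (𝓝 (g₀ x)) := by
  obtain ⟨K, hK, hKU, hKc⟩ := local_compact_nhds hx
  have := h K hKU hKc x (mem_of_mem_nhds hK)
  rwa [nhdsWithin_eq_nhds.2 hK] at this

theorem TendstoOnCompacts.tendsto_nhdsGE {g : ι → ℝ → F} {g₀ : ℝ → F} {U : Set ℝ}
    (h : TendstoOnCompacts g l g₀ U) {t : ℝ} (ht : U ∈ 𝓝[≥] t) :
    Tendsto (fun p : ι × ℝ => g p.1 p.2) (l ×ˢ 𝓝[≥] t) (𝓝 (g₀ t)) := by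
  obtain ⟨s, hts, hsU⟩ := mem_nhdsGE_iff_exists_Icc_subset.1 ht
  rw [← nhdsWithin_Icc_eq_nhdsGE hts]
  exact h _ hsU isCompact_Icc t (left_mem_Icc.2 (le_of_lt hts))

variable [AddCommGroup F] [Module ℝ F] [IsTopologicalAddGroup F] [ContinuousSMul ℝ F]
  [LocallyConvexSpace ℝ F]

theorem tendstoOnCompacts_slope {c c' : ℝ → E → F} {J : Set ℝ} {s₀ : ℝ} (hJ : J ∈ 𝓝 s₀)
    (hslope : ∀ s ∈ J, ∀ x ∈ U, HasSlope (fun s => c s x) (c' s x) s)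
    (hlim : TendstoOnCompacts c' (𝓝 s₀) (c' s₀) U) :
    TendstoOnCompacts (fun (h : ℝ) x => h⁻¹ • (c (s₀ + h) x - c s₀ x)) (𝓝[≠] 0) (c' s₀) U := by
  refine fun K hK hKc x hx => tendsto_of_forall_isClosed_convex fun C hC hclosed hconvex => ?_
  have hev : ∀ᶠ p in 𝓝 s₀ ×ˢ 𝓝[K] x, p.1 ∈ J ∧ p.2 ∈ K ∧ c' p.1 p.2 ∈ C :=
    (tendsto_fst.eventually hJ).and ((tendsto_snd.eventually self_mem_nhdsWithin).and
      ((hlim K hK hKc x hx).eventually hC))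
  obtain ⟨δ, hδ, hball⟩ := exists_forall_mem_ball_of_eventually_prod
    ((tendsto_snd.prodMk tendsto_fst).eventually hev)
  have hsmall : ∀ᶠ t : ℝ in 𝓝[≠] 0, |t| < δ ∧ t ≠ 0 :=
    Eventually.and (nhdsWithin_le_nhds (eventually_abs_lt tendsto_id hδ)) self_mem_nhdsWithin
  filter_upwards [hsmall.prod_mk hball] with ⟨t, y⟩ ⟨⟨ht, ht0⟩, hy⟩
  have hsub := uIcc_subset_ball (s₀ := s₀) ht
  exact slope_mem_of_forall_mem (α := fun s => c s y) (α' := fun s => c' s y) ht0 hconvex hclosed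
    (fun s hs => hslope s (hy s (hsub hs)).1 y (hK (hy s (hsub hs)).2.1))
    fun s hs => (hy s (hsub hs)).2.2

end CompactConvergence

section Interchange

variable {E : Type u} {F : Type v}
  [AddCommGroup E] [Module ℝ E] [TopologicalSpace E]
  [IsTopologicalAddGroup E] [ContinuousSMul ℝ E]
  [AddCommGroup F] [Module ℝ F] [TopologicalSpace F]
  [IsTopologicalAddGroup F] [ContinuousSMul ℝ F] [LocallyConvexSpace ℝ F] {U : Set E}

theorem TendstoOnCompacts.tendsto_slope {ι : Type*} {l : Filter ι} {f : ι → E → F}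
    {df : ι → E × E → F} {df₀ : E × E → F} (h : TendstoOnCompacts df l df₀ (U ×ˢ univ))
    (hf : ∀ᶠ i in l, HasDifferentialOn (f i) (df i) U) {x : E} (hx : x ∈ interior U) (v : E) :
    Tendsto (fun p : ℝ × ι => p.1⁻¹ • (f p.2 (x + p.1 • v) - f p.2 x)) (𝓝[≠] 0 ×ˢ l)
      (𝓝 (df₀ (x, v))) := by
  refine tendsto_of_forall_isClosed_convex fun C hC hclosed hconvex => ?_
  have hmem := eventually_add_smul_mem hx v
  have hline : Tendsto (fun p : ι × ℝ => df p.1 (x + p.2 • v, v)) (l ×ˢ 𝓝 0)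
      (𝓝 (df₀ (x, v))) := by
    have := (h.comp_right (γ := fun t : ℝ => (x + t • v, v)) (by fun_prop) (mapsTo_preimage _ _)
      ).tendsto_nhds (hmem.mono fun t ht => ⟨interior_subset ht, trivial⟩)
    simpa using this
  obtain ⟨δ, hδ, hball⟩ := exists_forall_mem_ball_of_eventually_prod
    ((tendsto_snd.eventually hmem).and (hline.eventually hC))
  have hsmall : ∀ᶠ t : ℝ in 𝓝[≠] 0, |t| < δ ∧ t ≠ 0 :=
    Eventually.and (nhdsWithin_le_nhds (eventually_abs_lt tendsto_id hδ)) self_mem_nhdsWithin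
  filter_upwards [hsmall.prod_mk (hf.and hball)] with ⟨t, i⟩ ⟨⟨ht, ht0⟩, hfi, hi⟩
  have hsub := uIcc_subset_ball (s₀ := 0) ht
  have := slope_mem_of_forall_mem (α := fun t : ℝ => f i (x + t • v))
    (α' := fun t => df i (x + t • v, v)) (a := 0) (h := t) ht0 hconvex hclosed
    (fun r hr => hfi.hasSlope (hi r (hsub hr)).1) fun r hr => (hi r (hsub hr)).2
  simpa using this

variable {c c' : ℝ → E → F} {dc dc' : ℝ → E × E → F} {J : Set ℝ} {s₀ : ℝ}

theorem hasSlope_differential_interior (hJ : J ∈ 𝓝 s₀)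
    (hslope : ∀ s ∈ J, ∀ x ∈ U, HasSlope (fun s => c s x) (c' s x) s)
    (hdc : ∀ s ∈ J, HasDifferentialOn (c s) (dc s) U)
    (hdc' : ∀ s ∈ J, HasDifferentialOn (c' s) (dc' s) U)
    (hlim : TendstoOnCompacts dc' (𝓝 s₀) (dc' s₀) (U ×ˢ univ)) {x : E} (hx : x ∈ interior U)
    (v : E) : HasSlope (fun s => dc s (x, v)) (dc' s₀ (x, v)) s₀ := by
  have hmem : ∀ᶠ t : ℝ in 𝓝[≠] 0, x + t • v ∈ interior U :=
    nhdsWithin_le_nhds (eventually_add_smul_mem hx v)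
  refine hasSlope_of_tendsto (l := 𝓝[≠] (0 : ℝ))
    (a := fun t s => t⁻¹ • (c s (x + t • v) - c s x))
    (b := fun t s => t⁻¹ • (c' s (x + t • v) - c' s x)) ?_
    (hlim.tendsto_slope (mem_of_superset hJ hdc') hx v) ?_
  · filter_upwards [hmem.prod_mk hJ] with p hp
    exact ((hslope _ hp.2 _ (interior_subset hp.1)).sub
      (hslope _ hp.2 _ (interior_subset hx))).const_smul _
  · exact mem_of_superset hJ fun s hs => (hdc s hs).tendsto x hx v

theorem hasSlope_differential (hU : Accessible U) (hJ : IsOpen J)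
    (hslope : ∀ s ∈ J, ∀ x ∈ U, HasSlope (fun s => c s x) (c' s x) s)
    (hdc : ∀ s ∈ J, HasDifferentialOn (c s) (dc s) U)
    (hdc' : ∀ s ∈ J, HasDifferentialOn (c' s) (dc' s) U)
    (hlim : ∀ s ∈ J, TendstoOnCompacts dc' (𝓝 s) (dc' s) (U ×ˢ univ)) (hs : s₀ ∈ J)
    {z : E × E} (hz : z ∈ U ×ˢ (univ : Set E)) :
    HasSlope (fun s => dc s z) (dc' s₀ z) s₀ := by
  obtain ⟨x, v⟩ := z
  obtain ⟨u, hu⟩ := hU x hz.1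
  have hray : Continuous fun t : ℝ => (x + t • u, v) := by fun_prop
  have hmem : ∀ᶠ t : ℝ in 𝓝[≥] 0, (x + t • u, v) ∈ U ×ˢ univ := by
    rw [← Ioi_insert, nhdsWithin_insert]
    exact eventually_sup.2 ⟨by simpa using hz.1, hu.mono fun t ht => ⟨interior_subset ht, trivial⟩⟩
  refine hasSlope_of_tendsto (l := 𝓝[>] (0 : ℝ)) (a := fun t s => dc s (x + t • u, v))
    (b := fun t s => dc' s (x + t • u, v)) ?_ ?_ ?_
  · filter_upwards [hu.prod_mk (hJ.mem_nhds hs)] with p hp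
    exact hasSlope_differential_interior (hJ.mem_nhds hp.2) hslope hdc hdc' (hlim _ hp.2) hp.1 v
  · have := ((hlim s₀ hs).comp_right hray.continuousOn (mapsTo_preimage _ _)).tendsto_nhdsGE hmem
    simp only [Function.comp_apply, zero_smul, add_zero] at this
    exact (this.comp (tendsto_snd.prodMk tendsto_fst)).mono_left
      (prod_mono (nhdsWithin_mono _ Ioi_subset_Ici_self) le_rfl)
  · filter_upwards [hJ.mem_nhds hs] with s hsJ
    have hlimz : Tendsto (fun t : ℝ => (x + t • u, v)) (𝓝[>] 0) (𝓝[U ×ˢ univ] (x, v)) :=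
      tendsto_nhdsWithin_iff.2 ⟨by simpa using (hray.tendsto 0).mono_left nhdsWithin_le_nhds,
        hmem.filter_mono (nhdsWithin_mono _ Ioi_subset_Ici_self)⟩
    exact ((hdc s hsJ).continuousOn (x, v) hz).tendsto.comp hlimz

end Interchange

section Linearity

theorem isLinearMap_of_tendsto {𝕜 E F : Type*} [Semiring 𝕜] [AddCommMonoid E] [Module 𝕜 E]
    [AddCommMonoid F] [Module 𝕜 F] [TopologicalSpace F] [T2Space F] [ContinuousAdd F]
    [ContinuousConstSMul 𝕜 F] {ι : Type*} {l : Filter ι} [l.NeBot] {L : ι → E → F} {L₀ : E → F}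
    (hL : ∀ᶠ i in l, IsLinearMap 𝕜 (L i)) (h : ∀ x, Tendsto (fun i => L i x) l (𝓝 (L₀ x))) :
    IsLinearMap 𝕜 L₀ := by
  obtain ⟨L', rfl⟩ := (LinearMap.isClosed_range_coe E F (RingHom.id 𝕜)).mem_of_tendsto
    (tendsto_pi_nhds.2 h) (hL.mono fun i hi => ⟨hi.mk' _, rfl⟩)
  exact L'.isLinear

theorem isLinearMap_comp {𝕜 A B C : Type*} [Semiring 𝕜] [AddCommMonoid A] [AddCommMonoid B]
    [AddCommMonoid C] [Module 𝕜 A] [Module 𝕜 B] [Module 𝕜 C] {k : B → C} {h : A → B}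
    (hk : IsLinearMap 𝕜 k) (hh : IsLinearMap 𝕜 h) : IsLinearMap 𝕜 (fun a => k (h a)) :=
  ((hk.mk' k).comp (hh.mk' h)).isLinear

variable {E : Type u} {F : Type v}
  [AddCommGroup E] [Module ℝ E] [TopologicalSpace E]
  [IsTopologicalAddGroup E] [ContinuousSMul ℝ E]
  [AddCommGroup F] [Module ℝ F] [TopologicalSpace F]
  [IsTopologicalAddGroup F] [ContinuousSMul ℝ F] [LocallyConvexSpace ℝ F] [T2Space F]
  {f : E → F} {df : E × E → F} {ddf : (E × E) × (E × E) → F} {U : Set E} {x : E}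

theorem HasDifferentialOn.map_smul (hf : HasDifferentialOn f df U) (hx : x ∈ interior U) (c : ℝ)
    (v : E) : df (x, c • v) = c • df (x, v) := by
  rcases eq_or_ne c 0 with rfl | hc
  · simp [hf.map_zero hx]
  have hmul : Tendsto (fun h : ℝ => h * c) (𝓝[≠] 0) (𝓝[≠] 0) := by
    refine tendsto_nhdsWithin_iff.2 ⟨?_, ?_⟩
    · simpa using ((continuous_mul_const c).tendsto 0).mono_left nhdsWithin_le_nhds
    · filter_upwards [self_mem_nhdsWithin] with h hh
      exact mul_ne_zero hh hc
  refine tendsto_nhds_unique (hf.tendsto x hx (c • v)) (((hf.tendsto_slope hx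
    (tendsto_const_nhds (x := x)) (tendsto_const_nhds (x := v)) hmul).const_smul c).congr
      fun h => ?_)
  rw [smul_smul, smul_smul, mul_inv, mul_comm h⁻¹, mul_inv_cancel_left₀ hc]

/-- Exchange `∂/∂s` with the limit `t → 0` in the difference quotients
`t⁻¹ • (f (x + t • w + s • v) - f (x + s • v))`. -/
theorem HasDifferentialOn.symmetric (hf : HasDifferentialOn f df U)
    (hdf : HasDifferentialOn df ddf (U ×ˢ univ)) (hx : x ∈ interior U) (v w : E) :
    ddf ((x, v), (w, 0)) = ddf ((x, w), (v, 0)) := by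
  have hint : ∀ a : E, (x, a) ∈ interior (U ×ˢ (univ : Set E)) := fun a => by
    rw [interior_prod_eq, interior_univ]
    exact ⟨hx, trivial⟩
  have hv := eventually_add_smul_mem hx v
  have hline : Tendsto (fun p : ℝ × ℝ => x + p.1 • w + p.2 • v) (𝓝[≠] 0 ×ˢ 𝓝 0) (𝓝 x) := by
    have hc : Continuous fun p : ℝ × ℝ => x + p.1 • w + p.2 • v := by fun_prop
    refine Tendsto.mono_left ?_ (Filter.prod_mono_left _ nhdsWithin_le_nhds)
    rw [← nhds_prod_eq]
    simpa using hc.tendsto (0, 0)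
  have hslope : HasSlope (fun s : ℝ => df (x + s • v, w)) (ddf ((x, v), (w, 0))) 0 := by
    refine hasSlope_of_tendsto (l := 𝓝[≠] (0 : ℝ))
      (a := fun t s => t⁻¹ • (f (x + t • w + s • v) - f (x + s • v)))
      (b := fun t s => t⁻¹ • (df (x + t • w + s • v, v) - df (x + s • v, v))) ?_ ?_ ?_
    · filter_upwards [hline.eventually_mem (isOpen_interior.mem_nhds hx),
        tendsto_snd.eventually hv] with p hp hp'
      exact ((hf.hasSlope hp).sub (hf.hasSlope hp')).const_smul _
    · refine (hdf.tendsto_slope (hint v) (w := fun _ => (w, 0))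
        (((tendsto_add_smul x v).comp tendsto_snd).prodMk_nhds (tendsto_const_nhds (x := v)))
        tendsto_const_nhds tendsto_fst).congr fun p => ?_
      simp [add_right_comm x]
    · filter_upwards [hv] with s hs
      exact (hf.tendsto _ hs w).congr fun t => by rw [add_right_comm]
  have hslope' : HasSlope (fun s : ℝ => df (x + s • v, w)) (ddf ((x, w), (v, 0))) 0 := by
    simpa using hdf.hasSlope (x := (x, w)) (v := (v, 0)) (t := 0) (by simpa using hint w)
  exact tendsto_nhds_unique hslope hslope'

theorem HasDifferentialOn.apply_zero_prod (hf : HasDifferentialOn f df U)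
    (hdf : HasDifferentialOn df ddf (U ×ˢ univ)) (hx : x ∈ interior U) (v w : E) :
    ddf ((x, v), (0, w)) = df (x, w) := by
  have hint : (x, v) ∈ interior (U ×ˢ (univ : Set E)) := by
    rw [interior_prod_eq, interior_univ]
    exact ⟨hx, trivial⟩
  refine tendsto_nhds_unique (hdf.tendsto (x, v) hint (0, w)) (tendsto_const_nhds.congr' ?_)
  filter_upwards [self_mem_nhdsWithin] with h (hh : h ≠ 0)
  simp [hf.map_add hx, hf.map_smul hx, smul_smul, hh]

variable {𝕜 : Type*} [Semiring 𝕜] [Module 𝕜 E] [Module 𝕜 F] [ContinuousConstSMul 𝕜 F]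

theorem HasDifferentialOn.isLinearMap_differential [SMulCommClass ℝ 𝕜 F]
    (hf : HasDifferentialOn f df U) (hdf : HasDifferentialOn df ddf (U ×ˢ univ))
    (hlin : ∀ x ∈ interior U, IsLinearMap 𝕜 fun v => df (x, v)) {p : E × E}
    (hp : p ∈ interior (U ×ˢ univ)) : IsLinearMap 𝕜 fun q => ddf (p, q) := by
  obtain ⟨x, v⟩ := p
  have := SMulCommClass.symm ℝ 𝕜 F
  have hx : x ∈ interior U := by
    rw [interior_prod_eq] at hp
    exact hp.1
  have hint : ∀ w : E, (x, w) ∈ interior (U ×ˢ (univ : Set E)) := fun w => by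
    rw [interior_prod_eq, interior_univ]
    exact ⟨hx, trivial⟩
  have hfst : IsLinearMap 𝕜 fun w => ddf ((x, v), (w, 0)) := by
    refine isLinearMap_of_tendsto (l := 𝓝[≠] (0 : ℝ))
      (L := fun h w => h⁻¹ • (df (x + h • v, w) - df (x, w))) ?_ fun w => ?_
    · filter_upwards [nhdsWithin_le_nhds (eventually_add_smul_mem hx v)] with h hh
      exact (h⁻¹ • ((hlin _ hh).mk' _ - (hlin x hx).mk' _)).isLinear
    · rw [hf.symmetric hdf hx v w]
      simpa using hdf.tendsto (x, w) (hint w) (v, 0)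
  have hsplit : (fun q : E × E => ddf ((x, v), q)) =
      fun q => ddf ((x, v), (q.1, 0)) + df (x, q.2) := by
    funext q
    rw [← hf.apply_zero_prod hdf hx v q.2, ← hdf.map_add hp]
    simp
  rw [hsplit]
  exact ((hfst.mk' _).comp (LinearMap.fst 𝕜 E E) +
    ((hlin x hx).mk' _).comp (LinearMap.snd 𝕜 E E)).isLinear

end Linearity

/-! ### Smooth and holomorphic maps -/

section IsSmoothOn

variable {𝕜 : Type*} [Semiring 𝕜] {E : Type u} {F : Type v} {H : Type w}
  [AddCommGroup E] [Module ℝ E] [Module 𝕜 E] [TopologicalSpace E]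
  [AddCommGroup F] [Module ℝ F] [Module 𝕜 F] [TopologicalSpace F]
  [AddCommGroup H] [Module ℝ H] [Module 𝕜 H] [TopologicalSpace H]
  {f g : E → F} {U O : Set E}

theorem IsSmoothOn.isCn (hf : IsSmoothOn 𝕜 f U) (n : ℕ) : IsCn n f U := hf.1 n

theorem IsSmoothOn.continuousOn (hf : IsSmoothOn 𝕜 f U) : ContinuousOn f U := hf.1 0

theorem IsSmoothOn.hasDifferentialOn (hf : IsSmoothOn 𝕜 f U) :
    HasDifferentialOn f (differential f U) U := (hf.isCn 1).hasDifferentialOn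

theorem IsSmoothOn.isLinearMap [T2Space F] (hf : IsSmoothOn 𝕜 f U) {x : E}
    (hx : x ∈ interior U) : IsLinearMap 𝕜 (fun v => differential f U (x, v)) := by
  obtain ⟨df, hdf, hlin⟩ := hf.2
  convert hlin x hx using 2 with v
  exact tendsto_nhds_unique (hf.hasDifferentialOn.tendsto x hx v) (hdf.tendsto x hx v)

theorem IsSmoothOn.inter_isOpen (hf : IsSmoothOn 𝕜 f U) (hO : IsOpen O) :
    IsSmoothOn 𝕜 f (U ∩ O) :=
  ⟨fun n => (hf.1 n).inter_isOpen hO, hf.2.imp fun _ hd =>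
    ⟨hd.1.inter O, fun x hx => hd.2 x (interior_mono inter_subset_left hx)⟩⟩

theorem IsSmoothOn.const (c : F) (U : Set E) : IsSmoothOn 𝕜 (fun _ => c) U :=
  ⟨fun _ => IsCn.const c U, _, HasDifferentialOn.const c U,
    fun _ _ => (0 : E →ₗ[𝕜] F).isLinear⟩

theorem IsSmoothOn.continuousLinearMap (l : E →L[ℝ] F) (hl : IsLinearMap 𝕜 l) (U : Set E) :
    IsSmoothOn 𝕜 l U :=
  ⟨fun _ => IsCn.continuousLinearMap l U, _, HasDifferentialOn.continuousLinearMap l U,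
    fun _ _ => hl⟩

theorem IsSmoothOn.comp_continuousLinearMap (hf : IsSmoothOn 𝕜 f U) (l : H →L[ℝ] E)
    (hl : IsLinearMap 𝕜 l) {U' : Set H} (hm : MapsTo l U' U)
    (hm' : MapsTo l (interior U') (interior U)) : IsSmoothOn 𝕜 (f ∘ l) U' := by
  refine ⟨fun n => (hf.1 n).comp_continuousLinearMap l hm hm', ?_⟩
  obtain ⟨df, hdf, hlin⟩ := hf.2
  exact ⟨_, hdf.comp_continuousLinearMap l hm hm',
    fun x hx => (isLinearMap_comp (hlin _ (hm' hx)) hl :)⟩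

theorem IsSmoothOn.prodMk {k : E → H} (hf : IsSmoothOn 𝕜 f U) (hk : IsSmoothOn 𝕜 k U) :
    IsSmoothOn 𝕜 (fun x => (f x, k x)) U := by
  refine ⟨fun n => (hf.1 n).prodMk (hk.1 n), ?_⟩
  obtain ⟨df, hdf, hflin⟩ := hf.2
  obtain ⟨dk, hdk, hklin⟩ := hk.2
  exact ⟨_, hdf.prodMk hdk, fun x hx => (((hflin x hx).mk' _).prod ((hklin x hx).mk' _)).isLinear⟩

theorem IsSmoothOn.restrictScalars {𝕝 : Type*} [Semiring 𝕝] {𝕜 : Type*} [CommSemiring 𝕜]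
    [Algebra 𝕜 𝕝] [Module 𝕜 E] [Module 𝕜 F] [Module 𝕝 E] [Module 𝕝 F] [IsScalarTower 𝕜 𝕝 E]
    [IsScalarTower 𝕜 𝕝 F] (hf : IsSmoothOn 𝕝 f U) : IsSmoothOn 𝕜 f U :=
  ⟨hf.1, hf.2.imp fun _ h =>
    ⟨h.1, fun x hx => (((h.2 x hx).mk' _).restrictScalars 𝕜).isLinear⟩⟩

variable [IsTopologicalAddGroup E] [ContinuousSMul ℝ E]

theorem IsSmoothOn.congr (hf : IsSmoothOn 𝕜 f U) (h : EqOn f g U) : IsSmoothOn 𝕜 g U :=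
  ⟨fun n => (hf.1 n).congr h, hf.2.imp fun _ hd => ⟨hd.1.congr h, hd.2⟩⟩

theorem IsSmoothOn.of_local [T2Space F] (hU : Accessible U)
    (h : ∀ x ∈ U, ∃ O, IsOpen O ∧ x ∈ O ∧ IsSmoothOn 𝕜 f (U ∩ O)) : IsSmoothOn 𝕜 f U := by
  have hCn : ∀ n, IsCn n f U := fun n => IsCn.of_local hU fun x hx =>
    (h x hx).imp fun O hO => ⟨hO.1, hO.2.1, hO.2.2.isCn n⟩
  refine ⟨hCn, _, (hCn 1).hasDifferentialOn, fun x hx => ?_⟩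
  obtain ⟨O, hO, hxO, hf⟩ := h x (interior_subset hx)
  have hx' : x ∈ interior (U ∩ O) := by
    rw [interior_inter, hO.interior_eq]
    exact ⟨hx, hxO⟩
  convert hf.isLinearMap hx' using 2 with v
  exact tendsto_nhds_unique ((hCn 1).hasDifferentialOn.tendsto x hx v)
    (hf.hasDifferentialOn.tendsto x hx' v)

variable [IsTopologicalAddGroup F] [ContinuousSMul ℝ F] [LocallyConvexSpace ℝ F]

theorem IsSmoothOn.comp {k : H → E} {Ω : Set H} (hf : IsSmoothOn 𝕜 f U) (hk : IsSmoothOn 𝕜 k Ω)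
    (hm : MapsTo k Ω U) (hm' : MapsTo k (interior Ω) (interior U)) : IsSmoothOn 𝕜 (f ∘ k) Ω := by
  refine ⟨fun n => (hf.1 n).comp (hk.1 n) hm hm', ?_⟩
  obtain ⟨df, hdf, hflin⟩ := hf.2
  obtain ⟨dk, hdk, hklin⟩ := hk.2
  exact ⟨_, hdf.comp hdk (hk.1 0) hm hm',
    fun x hx => (isLinearMap_comp (hflin _ (hm' hx)) (hklin x hx) :)⟩

protected theorem IsSmoothOn.differential [T2Space F] [ContinuousConstSMul 𝕜 F]
    [SMulCommClass ℝ 𝕜 F] (hf : IsSmoothOn 𝕜 f U) (hU : Accessible U) :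
    IsSmoothOn 𝕜 (differential f U) (U ×ˢ univ) := by
  have hCn : ∀ n, IsCn n (differential f U) (U ×ˢ univ) :=
    fun n => (hf.isCn (n + 1)).differential hU
  exact ⟨hCn, _, (hCn 1).hasDifferentialOn, fun p hp =>
    hf.hasDifferentialOn.isLinearMap_differential (hCn 1).hasDifferentialOn
      (fun x hx => hf.isLinearMap hx) hp⟩

end IsSmoothOn

/-! ### Convergence of maps together with their differentials -/

section TendstoCn

/-- Convergence of `d^n (g i)` to `d^n g₀`, uniformly on compact subsets of `U × E^(2^n - 1)`. -/
def TendstoCn {ι : Type*} {F : Type v} [AddCommGroup F] [Module ℝ F] [TopologicalSpace F] :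
    ℕ → ∀ {E : Type u} [AddCommGroup E] [Module ℝ E] [TopologicalSpace E],
      (ι → E → F) → Filter ι → (E → F) → Set E → Prop
  | 0, _, _, _, _, g, l, g₀, U => TendstoOnCompacts g l g₀ U
  | n + 1, _, _, _, _, g, l, g₀, U =>
      TendstoCn n (fun i => differential (g i) U) l (differential g₀ U) (U ×ˢ univ)

/-- The tangent map `(x, v) ↦ (f x, df (x, v))` of `f` on `U`, with which the chain rule reads
`d (k ∘ f) = dk ∘ tangentMap f U`. -/
noncomputable def tangentMap {E : Type u} {F : Type v}
    [AddCommGroup E] [Module ℝ E] [TopologicalSpace E]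
    [AddCommGroup F] [Module ℝ F] [TopologicalSpace F]
    (f : E → F) (U : Set E) (p : E × E) : F × F :=
  (f p.1, differential f U p)

variable {ι : Type*} {l : Filter ι} {n : ℕ}
  {E : Type u} [AddCommGroup E] [Module ℝ E] [TopologicalSpace E]
  [IsTopologicalAddGroup E] [ContinuousSMul ℝ E]
  {F : Type v} [AddCommGroup F] [Module ℝ F] [TopologicalSpace F]
  {H : Type w} [AddCommGroup H] [Module ℝ H] [TopologicalSpace H]
  {g g' : ι → E → F} {g₀ g₀' : E → F} {U : Set E}

theorem TendstoCn.congr (h : TendstoCn n g l g₀ U) (hg : ∀ᶠ i in l, EqOn (g i) (g' i) U)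
    (hg₀ : EqOn g₀ g₀' U) : TendstoCn n g' l g₀' U := by
  induction n generalizing E with
  | zero => exact TendstoOnCompacts.congr h hg hg₀
  | succ n ih =>
    exact ih h (hg.mono fun i hi => by rw [differential_congr hi]; exact fun _ _ => rfl)
      (by rw [differential_congr hg₀]; exact fun _ _ => rfl)

variable [T2Space F]

theorem tendstoCn_const (hU : Accessible U) (h : IsCn n g₀ U) :
    TendstoCn n (fun _ : ι => g₀) l g₀ U := by
  induction n generalizing E with
  | zero => exact tendstoOnCompacts_const h
  | succ n ih => exact ih hU.prod_univ (h.differential hU)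

theorem TendstoCn.prodMk [T2Space H] {k : ι → E → H} {k₀ : E → H} (hU : Accessible U)
    (hg : TendstoCn n g l g₀ U) (hk : TendstoCn n k l k₀ U) (hgn : ∀ᶠ i in l, IsCn n (g i) U)
    (hkn : ∀ᶠ i in l, IsCn n (k i) U) (hg₀ : IsCn n g₀ U) (hk₀ : IsCn n k₀ U) :
    TendstoCn n (fun i x => (g i x, k i x)) l (fun x => (g₀ x, k₀ x)) U := by
  induction n generalizing E with
  | zero => exact TendstoOnCompacts.prodMk hg hk
  | succ n ih =>
    refine (ih hU.prod_univ hg hk (hgn.mono fun i hi => hi.differential hU)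
      (hkn.mono fun i hi => hi.differential hU) (hg₀.differential hU)
      (hk₀.differential hU)).congr ?_ ?_
    · filter_upwards [hgn, hkn] with i hgi hki
      exact ((hgi.hasDifferentialOn.prodMk hki.hasDifferentialOn).differential_eqOn hU).symm
    · exact ((hg₀.hasDifferentialOn.prodMk hk₀.hasDifferentialOn).differential_eqOn hU).symm

theorem TendstoCn.comp_continuousLinearMap [IsTopologicalAddGroup H] [ContinuousSMul ℝ H]
    {U' : Set H} (hU' : Accessible U') (hU : Accessible U) (hg : TendstoCn n g l g₀ U)
    (hgn : ∀ᶠ i in l, IsCn n (g i) U) (hg₀ : IsCn n g₀ U) (L : H →L[ℝ] E) (hm : MapsTo L U' U)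
    (hm' : MapsTo L (interior U') (interior U)) :
    TendstoCn n (fun i => g i ∘ L) l (g₀ ∘ L) U' := by
  induction n generalizing E H with
  | zero => exact TendstoOnCompacts.comp_right hg L.continuous.continuousOn hm
  | succ n ih =>
    refine (ih hU'.prod_univ hU.prod_univ hg (hgn.mono fun i hi => hi.differential hU)
      (hg₀.differential hU) (L.prodMap L) (fun p hp => ⟨hm hp.1, trivial⟩) ?_).congr ?_ ?_
    · simp only [interior_prod_eq, interior_univ]
      exact fun p hp => ⟨hm' hp.1, trivial⟩
    · filter_upwards [hgn] with i hi
      exact ((hi.hasDifferentialOn.comp_continuousLinearMap L hm hm').differential_eqOn hU').symm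
    · exact ((hg₀.hasDifferentialOn.comp_continuousLinearMap L hm hm').differential_eqOn hU').symm

theorem TendstoCn.comp_fst [IsTopologicalAddGroup H] [ContinuousSMul ℝ H] (hU : Accessible U)
    (hg : TendstoCn n g l g₀ U) (hgn : ∀ᶠ i in l, IsCn n (g i) U) (hg₀ : IsCn n g₀ U) :
    TendstoCn n (fun i (p : E × H) => g i p.1) l (fun p => g₀ p.1) (U ×ˢ univ) := by
  refine TendstoCn.comp_continuousLinearMap hU.prod_univ hU hg hgn hg₀
    (ContinuousLinearMap.fst ℝ E H) (fun p hp => hp.1) ?_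
  rw [interior_prod_eq]
  exact fun p hp => hp.1

protected theorem IsCn.tangentMap (hg₀ : IsCn (n + 1) g₀ U) (hU : Accessible U) :
    IsCn n (tangentMap g₀ U) (U ×ˢ univ) :=
  hg₀.of_succ.comp_fst.prodMk (hg₀.differential hU)

protected theorem TendstoCn.tangentMap (hU : Accessible U) (hg : TendstoCn n g l g₀ U)
    (hdg : TendstoCn (n + 1) g l g₀ U) (hgn : ∀ᶠ i in l, IsCn (n + 1) (g i) U)
    (hg₀ : IsCn (n + 1) g₀ U) :
    TendstoCn n (fun i => tangentMap (g i) U) l (tangentMap g₀ U) (U ×ˢ univ) :=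
  TendstoCn.prodMk hU.prod_univ
    (hg.comp_fst hU (hgn.mono fun _ hi => hi.of_succ) hg₀.of_succ) hdg
    (hgn.mono fun _ hi => hi.of_succ.comp_fst) (hgn.mono fun _ hi => hi.differential hU)
    hg₀.of_succ.comp_fst (hg₀.differential hU)

variable [IsTopologicalAddGroup F] [ContinuousSMul ℝ F] [LocallyConvexSpace ℝ F]

theorem IsCn.differential_comp_eqOn [IsTopologicalAddGroup H] [ContinuousSMul ℝ H]
    {h : E → H} {Ω : Set H} {k : H → F} (hU : Accessible U) (hk : IsCn (n + 1) k Ω)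
    (hh : IsCn (n + 1) h U) (hm : MapsTo h U Ω) (hm' : MapsTo h (interior U) (interior Ω)) :
    EqOn (differential (k ∘ h) U) (differential k Ω ∘ tangentMap h U) (U ×ˢ univ) :=
  (hk.hasDifferentialOn.comp hh.hasDifferentialOn hh.continuousOn hm hm').differential_eqOn hU

theorem TendstoCn.comp_left [T2Space H] [IsTopologicalAddGroup H] [ContinuousSMul ℝ H]
    {h : ι → E → H} {h₀ : E → H} {Ω : Set H} {k : H → F} (hU : Accessible U)
    (hΩ : Accessible Ω) (hh : ∀ m ≤ n, TendstoCn m h l h₀ U) (hk : IsCn n k Ω)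
    (hhn : ∀ᶠ i in l, IsCn n (h i) U ∧ MapsTo (h i) U Ω ∧
      MapsTo (h i) (interior U) (interior Ω))
    (hh₀ : IsCn n h₀ U) (hm : MapsTo h₀ U Ω) (hm' : MapsTo h₀ (interior U) (interior Ω)) :
    TendstoCn n (fun i => k ∘ h i) l (k ∘ h₀) U := by
  induction n generalizing E H with
  | zero => exact TendstoOnCompacts.comp_left (hh 0 le_rfl) hk (hhn.mono fun i hi => hi.2.1) hm
  | succ n ih =>
    refine (ih (h := fun i => tangentMap (h i) U) hU.prod_univ hΩ.prod_univ (fun m hmn => ?_)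
      (hk.differential hΩ) ?_ (hh₀.tangentMap hU) (fun p hp => ⟨hm hp.1, trivial⟩) ?_).congr
      ?_ (hk.differential_comp_eqOn hU hh₀ hm hm').symm
    · have hmn' := Nat.succ_le_succ hmn
      exact (hh m (m.le_succ.trans hmn')).tangentMap hU (hh (m + 1) hmn')
        (hhn.mono fun i hi => hi.1.of_le hmn') (hh₀.of_le hmn')
    · filter_upwards [hhn] with i hi
      refine ⟨hi.1.tangentMap hU, fun p hp => ⟨hi.2.1 hp.1, trivial⟩, ?_⟩
      simp only [interior_prod_eq, interior_univ]
      exact fun p hp => ⟨hi.2.2 hp.1, trivial⟩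
    · simp only [interior_prod_eq, interior_univ]
      exact fun p hp => ⟨hm' hp.1, trivial⟩
    · filter_upwards [hhn] with i hi
      exact (hk.differential_comp_eqOn hU hi.1 hi.2.1 hi.2.2).symm

variable {c c' : ℝ → E → F} {J : Set ℝ} {s₀ : ℝ}

theorem tendstoCn_slope (hU : Accessible U) (hJ : IsOpen J)
    (hslope : ∀ s ∈ J, ∀ x ∈ U, HasSlope (fun s => c s x) (c' s x) s)
    (hc : ∀ s ∈ J, IsCn n (c s) U) (hc' : ∀ s ∈ J, IsCn n (c' s) U)
    (hlim : ∀ m ≤ n, ∀ s ∈ J, TendstoCn m c' (𝓝 s) (c' s) U) (hs : s₀ ∈ J) :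
    TendstoCn n (fun (h : ℝ) x => h⁻¹ • (c (s₀ + h) x - c s₀ x)) (𝓝[≠] 0) (c' s₀) U := by
  induction n generalizing E with
  | zero => exact tendstoOnCompacts_slope (hJ.mem_nhds hs) hslope (hlim 0 le_rfl s₀ hs)
  | succ n ih =>
    have hdiff := ih (c := fun s => differential (c s) U) (c' := fun s => differential (c' s) U)
      hU.prod_univ
      (fun s hs z hz => hasSlope_differential hU hJ hslope (fun s hs => (hc s hs).hasDifferentialOn)
        (fun s hs => (hc' s hs).hasDifferentialOn) (fun s hs => hlim 1 (by omega) s hs) hs hz)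
      (fun s hs => (hc s hs).differential hU) (fun s hs => (hc' s hs).differential hU)
      (fun m hm => hlim (m + 1) (Nat.succ_le_succ hm))
    refine hdiff.congr ?_ fun _ _ => rfl
    have hadd : Tendsto (fun h : ℝ => s₀ + h) (𝓝[≠] 0) (𝓝 s₀) := by
      simpa using ((continuous_const_add s₀).tendsto 0).mono_left nhdsWithin_le_nhds
    filter_upwards [hadd.eventually (hJ.mem_nhds hs)] with h hh
    have hquot := ((hc _ hh).hasDifferentialOn.add
      ((hc _ hs).hasDifferentialOn.const_smul (-1 : ℝ))).const_smul h⁻¹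
    refine fun z hz => Eq.trans ?_ ((hquot.congr ?_).differential_eqOn hU hz).symm
    · simp [sub_eq_add_neg]
    · intro x _
      simp [sub_eq_add_neg]

end TendstoCn

/-! ### Spaces of smooth functions -/

section DerivTopology

theorem tendstoOnCompacts_iff {ι E F : Type*} [TopologicalSpace E] [T2Space E]
    [TopologicalSpace F] {g : ι → E → F} {l : Filter ι} {g₀ : E → F} {U : Set E}
    (hg₀ : ContinuousOn g₀ U) :
    TendstoOnCompacts g l g₀ U ↔ ∀ K ⊆ U, IsCompact K → ∀ O, IsOpen O → MapsTo g₀ K O →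
      ∀ᶠ i in l, MapsTo (g i) K O := by
  constructor
  · intro h K hK hKc O hO hm
    refine hKc.induction_on (p := fun S => ∀ᶠ i in l, MapsTo (g i) S O)
      (Eventually.of_forall fun i => mapsTo_empty _ _)
      (fun S T hST hT => hT.mono fun i hi => hi.mono_left hST)
      (fun S T hS hT => (hS.and hT).mono fun i hi => hi.1.union hi.2) fun x hx => ?_
    obtain ⟨pa, ha, pb, hb, hab⟩ := eventually_prod_iff.1
      ((h K hK hKc x hx).eventually (hO.mem_nhds (hm hx)))
    exact ⟨{y | pb y}, hb, ha.mono fun i hi y hy => hab hi hy⟩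
  · intro h K hK hKc x hx
    refine tendsto_def.2 fun O hO => ?_
    obtain ⟨O', hO'O, hO', hxO'⟩ := mem_nhds_iff.1 hO
    have : CompactSpace K := isCompact_iff_compactSpace.1 hKc
    have hpre : K.domRestrict g₀ ⁻¹' O' ∈ 𝓝 (⟨x, hx⟩ : K) :=
      (continuousOn_iff_continuous_domRestrict.1 (hg₀.mono hK)).continuousAt.preimage_mem_nhds
        (hO'.mem_nhds hxO')
    obtain ⟨C, hC, hCO, hCc⟩ := local_compact_nhds hpre
    have hCx : ∀ᶠ y in 𝓝[K] x, y ∈ Subtype.val '' C := by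
      rw [nhdsWithin_eq_map_subtype_coe hx]
      exact image_mem_map hC
    have hev := h (Subtype.val '' C) (image_subset_iff.2 fun y _ => hK y.2)
      (hCc.image continuous_subtype_val) O' hO' (mapsTo_image_iff.2 hCO)
    filter_upwards [hev.prod_mk hCx] with p hp
    exact hO'O (hp.1 hp.2)

variable {F : Type v} [AddCommGroup F] [Module ℝ F] [TopologicalSpace F] {I : Type w} {n : ℕ}

theorem derivTopology_zero_eq_induced {E : Type u} [AddCommGroup E] [Module ℝ E]
    [TopologicalSpace E] {g : I → E → F} {U : Set E} (hg : ∀ i, ContinuousOn (g i) U) :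
    derivTopology 0 g U = TopologicalSpace.induced
      (fun i => (⟨U.domRestrict (g i), (hg i).domRestrict⟩ : C(U, F))) inferInstance := by
  rw [ContinuousMap.compactOpen_eq, induced_generateFrom_eq, derivTopology]
  congr 1
  ext S
  constructor
  · rintro ⟨K, hK, hKc, O, hO, rfl⟩
    refine ⟨_, ⟨Subtype.val ⁻¹' K, ?_, O, hO, rfl⟩, ?_⟩
    · rw [mem_ofPred, Subtype.isCompact_iff, Subtype.image_preimage_coe, inter_eq_right.2 hK]
      exact hKc
    · ext i
      exact ⟨fun h x hx => h (x := ⟨x, hK hx⟩) hx, fun h x hx => h hx⟩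
  · rintro ⟨_, ⟨K, hK, O, hO, rfl⟩, rfl⟩
    refine ⟨Subtype.val '' K, image_subset_iff.2 fun y _ => y.2,
      IsCompact.image hK continuous_subtype_val, O, hO, ?_⟩
    ext i
    constructor
    · rintro h _ ⟨x, hx, rfl⟩
      exact h hx
    · exact fun h x hx => h (mem_image_of_mem _ hx)

variable {E : Type u} [AddCommGroup E] [Module ℝ E] [TopologicalSpace E]
  [IsTopologicalAddGroup E] [ContinuousSMul ℝ E] [T2Space F] {g : I → E → F} {U : Set E}

theorem tendsto_derivTopology_iff [T2Space E] (hU : Accessible U) {κ : Type*} {φ : κ → I}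
    {l : Filter κ} {i₀ : I} (hg : ∀ i, IsCn n (g i) U) :
    Tendsto φ l (@nhds I (derivTopology n g U) i₀) ↔
      TendstoCn n (fun k => g (φ k)) l (g i₀) U := by
  induction n generalizing E with
  | zero =>
    rw [derivTopology, TopologicalSpace.tendsto_nhds_generateFrom_iff, TendstoCn,
      tendstoOnCompacts_iff (hg i₀)]
    constructor
    · exact fun h K hK hKc O hO hm => h _ ⟨K, hK, hKc, O, hO, rfl⟩ hm
    · rintro h _ ⟨K, hK, hKc, O, hO, rfl⟩ hm
      exact h K hK hKc O hO hm
  | succ n ih => exact ih hU.prod_univ fun i => (hg i).differential hU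

theorem exists_derivTopology_eq_induced [IsTopologicalAddGroup F] {R : Type*} [Semiring R]
    [Module R F] [ContinuousConstSMul R F] [SMulCommClass ℝ R F] [AddCommGroup I] [Module R I]
    (hU : Accessible U) (hg : ∀ i, IsCn n (g i) U)
    (hadd : ∀ i j, EqOn (g (i + j)) (g i + g j) U)
    (hsmul : ∀ (c : R) i, EqOn (g (c • i)) (c • g i) U) :
    ∃ (Z : Type u) (_ : TopologicalSpace Z) (L : I →ₗ[R] C(Z, F)),
      derivTopology n g U = TopologicalSpace.induced L inferInstance := by
  induction n generalizing E with
  | zero =>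
    exact ⟨U, inferInstance,
      { toFun := fun i => ⟨U.domRestrict (g i), (hg i).domRestrict⟩
        map_add' := fun i j => ContinuousMap.ext fun x => hadd i j x.2
        map_smul' := fun c i => ContinuousMap.ext fun x => hsmul c i x.2 },
      derivTopology_zero_eq_induced hg⟩
  | succ n ih =>
    refine ih hU.prod_univ (fun i => (hg i).differential hU) (fun i j => ?_) fun c i => ?_
    · rw [differential_congr (hadd i j)]
      exact ((hg i).hasDifferentialOn.add (hg j).hasDifferentialOn).differential_eqOn hU
    · rw [differential_congr (hsmul c i)]
      exact ((hg i).hasDifferentialOn.const_smul c).differential_eqOn hU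

end DerivTopology

section SmoothFun

/-- The charts in `A` cover `M` and have accessible images. This is all that is needed of the
atlas of a manifold with corners to study the smooth functions on it. -/
class IsAtlas {M : Type w} {E : Type u} [TopologicalSpace M] [AddCommGroup E] [Module ℝ E]
    [TopologicalSpace E] (A : Set (PartialEquiv M E)) : Prop where
  accessible : ∀ φ ∈ A, Accessible φ.target
  isOpen_source : ∀ φ ∈ A, IsOpen φ.source
  continuousOn : ∀ φ ∈ A, ContinuousOn φ φ.source
  continuousOn_symm : ∀ φ ∈ A, ContinuousOn φ.symm φ.target
  cover : ∀ m : M, ∃ φ ∈ A, m ∈ φ.source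

variable {𝕜 : Type*} [Semiring 𝕜] {M : Type w} {E : Type u} {F : Type v}
  [AddCommGroup E] [Module ℝ E] [Module 𝕜 E] [TopologicalSpace E]
  [AddCommGroup F] [Module ℝ F] [Module 𝕜 F] [TopologicalSpace F]
  {A : Set (PartialEquiv M E)}

namespace SmoothFun

@[ext] theorem ext {f g : SmoothFun 𝕜 A F} (h : ∀ m, f.1 m = g.1 m) : f = g :=
  Subtype.ext (funext h)

variable [IsTopologicalAddGroup F]

@[simp] theorem add_val (f g : SmoothFun 𝕜 A F) (m : M) : (f + g).1 m = f.1 m + g.1 m :=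
  rfl

@[simp] theorem sub_val (f g : SmoothFun 𝕜 A F) (m : M) : (f - g).1 m = f.1 m - g.1 m :=
  rfl

@[simp] theorem smul_val {R : Type*} [Semiring R] [Module R F] [SMulCommClass ℝ R F]
    [SMulCommClass 𝕜 R F] [ContinuousConstSMul R F] (c : R) (f : SmoothFun 𝕜 A F) (m : M) :
    (c • f).1 m = c • f.1 m :=
  rfl

variable [TopologicalSpace M] [IsAtlas A] [IsTopologicalAddGroup E] [ContinuousSMul ℝ E]
  [T2Space F]

theorem exists_derivTopology_eq_induced {R : Type*} [Semiring R] [Module R F]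
    [SMulCommClass ℝ R F] [SMulCommClass 𝕜 R F] [ContinuousConstSMul R F]
    {φ : PartialEquiv M E} (hφ : φ ∈ A) (n : ℕ) :
    ∃ (Z : Type u) (_ : TopologicalSpace Z) (L : SmoothFun 𝕜 A F →ₗ[R] C(Z, F)),
      derivTopology n (fun (f : SmoothFun 𝕜 A F) (x : E) => f.1 (φ.symm x)) φ.target =
        TopologicalSpace.induced L inferInstance :=
  MappingGroup.exists_derivTopology_eq_induced (IsAtlas.accessible φ hφ)
    (fun f => (f.2 φ hφ).isCn n) (fun _ _ _ _ => rfl) fun _ _ _ _ => rfl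

instance continuousSMul {R : Type*} [Semiring R] [TopologicalSpace R] [Module R F]
    [SMulCommClass ℝ R F] [SMulCommClass 𝕜 R F] [ContinuousSMul R F] :
    ContinuousSMul R (SmoothFun 𝕜 A F) := by
  refine continuousSMul_iInf fun φ => continuousSMul_iInf fun hφ => continuousSMul_iInf fun n => ?_
  obtain ⟨Z, _, L, hL⟩ := exists_derivTopology_eq_induced (R := R) (F := F) (𝕜 := 𝕜) hφ n
  rw [hL]
  exact continuousSMul_induced L

instance isTopologicalAddGroup : IsTopologicalAddGroup (SmoothFun 𝕜 A F) := by
  refine topologicalAddGroup_iInf fun φ => topologicalAddGroup_iInf fun hφ =>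
    topologicalAddGroup_iInf fun n => ?_
  obtain ⟨Z, _, L, hL⟩ := exists_derivTopology_eq_induced (R := ℕ) (F := F) (𝕜 := 𝕜) hφ n
  rw [hL]
  exact topologicalAddGroup_induced L

instance locallyConvexSpace [ContinuousSMul ℝ F] [LocallyConvexSpace ℝ F] [SMulCommClass 𝕜 ℝ F] :
    LocallyConvexSpace ℝ (SmoothFun 𝕜 A F) := by
  refine LocallyConvexSpace.iInf fun φ => LocallyConvexSpace.iInf fun hφ =>
    LocallyConvexSpace.iInf fun n => ?_
  obtain ⟨Z, _, L, hL⟩ := exists_derivTopology_eq_induced (R := ℝ) (F := F) (𝕜 := 𝕜) hφ n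
  rw [hL]
  exact LocallyConvexSpace.induced L

end SmoothFun

namespace SmoothFun

variable [TopologicalSpace M] [IsAtlas A] [IsTopologicalAddGroup E] [ContinuousSMul ℝ E]
  [T2Space E] [T2Space F]

theorem tendsto_iff {κ : Type*} {l : Filter κ} {f : κ → SmoothFun 𝕜 A F}
    {f₀ : SmoothFun 𝕜 A F} : Tendsto f l (𝓝 f₀) ↔ ∀ φ ∈ A, ∀ n : ℕ,
      TendstoCn n (fun k x => (f k).1 (φ.symm x)) l (fun x => f₀.1 (φ.symm x)) φ.target := by
  simp only [nhds_iInf, tendsto_iInf]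
  refine forall₂_congr fun φ hφ => forall_congr' fun n => ?_
  exact tendsto_derivTopology_iff (IsAtlas.accessible φ hφ) fun f => (f.2 φ hφ).isCn n

theorem continuous_eval [LocallyCompactSpace M] :
    Continuous fun p : SmoothFun 𝕜 A F × M => p.1.1 p.2 := by
  refine continuous_iff_continuousAt.2 ?_
  rintro ⟨f, m⟩
  obtain ⟨φ, hφ, hm⟩ := IsAtlas.cover (A := A) m
  have hs := (IsAtlas.isOpen_source φ hφ).mem_nhds hm
  have hφc := IsAtlas.continuousOn φ hφ
  obtain ⟨C, hC, hCs, hCc⟩ := local_compact_nhds hs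
  have hlim : Tendsto (fun p : SmoothFun 𝕜 A F × E => p.1.1 (φ.symm p.2))
      (𝓝 f ×ˢ 𝓝[φ '' C] (φ m)) (𝓝 (f.1 (φ.symm (φ m)))) :=
    tendsto_iff.1 (tendsto_id (x := 𝓝 f)) φ hφ 0 (φ '' C)
      (image_subset_iff.2 fun x hx => φ.map_source (hCs hx))
      (hCc.image_of_continuousOn (hφc.mono hCs)) (φ m) (mem_image_of_mem _ (mem_of_mem_nhds hC))
  have hφm : Tendsto φ (𝓝 m) (𝓝[φ '' C] (φ m)) :=
    tendsto_nhdsWithin_iff.2 ⟨hφc.continuousAt hs,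
      mem_of_superset hC fun x hx => mem_image_of_mem _ hx⟩
  rw [ContinuousAt, nhds_prod_eq]
  rw [φ.left_inv hm] at hlim
  refine (hlim.comp (tendsto_id.prodMap hφm)).congr' ?_
  filter_upwards [prod_mem_prod (univ_mem (f := 𝓝 f)) hs] with p hp
  simp [φ.left_inv hp.2]

instance t2Space : T2Space (SmoothFun 𝕜 A F) := by
  refine T2Space.of_injective_continuous (f := fun f : SmoothFun 𝕜 A F => f.1)
    Subtype.val_injective (continuous_pi fun m => continuous_iff_continuousAt.2 fun f => ?_)
  obtain ⟨φ, hφ, hm⟩ := IsAtlas.cover (A := A) m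
  have hlim : TendstoOnCompacts _ _ _ _ := tendsto_iff.1 (tendsto_id (x := 𝓝 f)) φ hφ 0
  simpa [ContinuousAt, φ.left_inv hm] using hlim.tendsto_apply (φ.map_source hm)

theorem isOpen_setOf_forall_mem [CompactSpace M] [LocallyCompactSpace M] {Ω : Set (M × F)}
    (hΩ : IsOpen Ω) : IsOpen {f : SmoothFun 𝕜 A F | ∀ m, (m, f.1 m) ∈ Ω} := by
  refine isOpen_iff_mem_nhds.2 fun f hf => ?_
  have hc : Continuous fun p : SmoothFun 𝕜 A F × M => (p.2, p.1.1 p.2) :=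
    continuous_snd.prodMk continuous_eval
  have := isCompact_univ.eventually_forall_of_forall_eventually (x₀ := f)
    (P := fun (f : SmoothFun 𝕜 A F) (m : M) => (m, f.1 m) ∈ Ω)
    fun m _ => hc.continuousAt.eventually (hΩ.mem_nhds (hf m))
  filter_upwards [this] with g hg m using hg m trivial

end SmoothFun

end SmoothFun

section Pairing

variable {𝕜 : Type*} [Semiring 𝕜] {M : Type w} {E : Type u} {F : Type v} {H : Type x}
  [AddCommGroup E] [Module ℝ E] [Module 𝕜 E] [TopologicalSpace E]
  [AddCommGroup F] [Module ℝ F] [Module 𝕜 F] [TopologicalSpace F]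
  [AddCommGroup H] [Module ℝ H] [Module 𝕜 H] [TopologicalSpace H]
  {A : Set (PartialEquiv M E)}

/-- The smooth map `M → F × H` with components `f` and `g`. -/
def SmoothFun.pair (f : SmoothFun 𝕜 A F) (g : SmoothFun 𝕜 A H) : SmoothFun 𝕜 A (F × H) :=
  ⟨fun m => (f.1 m, g.1 m), fun φ hφ => (f.2 φ hφ).prodMk (g.2 φ hφ)⟩

@[simp] theorem SmoothFun.pair_val (f : SmoothFun 𝕜 A F) (g : SmoothFun 𝕜 A H) (m : M) :
    (SmoothFun.pair f g).1 m = (f.1 m, g.1 m) := rfl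

theorem SmoothFun.isSmoothOn_id_prodMk (f : SmoothFun 𝕜 A F) {φ : PartialEquiv M E} (hφ : φ ∈ A) :
    IsSmoothOn 𝕜 (fun x => (x, f.1 (φ.symm x))) φ.target :=
  (IsSmoothOn.continuousLinearMap (ContinuousLinearMap.id ℝ E)
    (LinearMap.id : E →ₗ[𝕜] E).isLinear _).prodMk (f.2 φ hφ)

variable [TopologicalSpace M] [IsAtlas A] [IsTopologicalAddGroup E] [ContinuousSMul ℝ E]
  [T2Space E]
  [IsTopologicalAddGroup F] [ContinuousSMul ℝ F] [T2Space F] [SMulCommClass 𝕜 ℝ F]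
  [IsTopologicalAddGroup H] [ContinuousSMul ℝ H] [T2Space H] [SMulCommClass 𝕜 ℝ H]
  {X Y : Type*} [AddCommGroup X] [Module ℝ X] [TopologicalSpace X]
  [AddCommGroup Y] [Module ℝ Y] [TopologicalSpace Y]

/-- The continuous linear map `(x, y) ↦ (j x, k y)` into the maps `M → F × H`. -/
noncomputable def SmoothFun.pairCLM (j : X →L[ℝ] SmoothFun 𝕜 A F) (k : Y →L[ℝ] SmoothFun 𝕜 A H) :
    X × Y →L[ℝ] SmoothFun 𝕜 A (F × H) where
  toFun p := SmoothFun.pair (j p.1) (k p.2)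
  map_add' p q := SmoothFun.ext fun m => by simp
  map_smul' c p := SmoothFun.ext fun m => by simp
  cont := by
    refine continuous_iff_continuousAt.2 fun p => SmoothFun.tendsto_iff.2 fun φ hφ n => ?_
    have hj := SmoothFun.tendsto_iff.1 ((j.continuous.comp continuous_fst).tendsto p) φ hφ n
    have hk := SmoothFun.tendsto_iff.1 ((k.continuous.comp continuous_snd).tendsto p) φ hφ n
    exact hj.prodMk (IsAtlas.accessible φ hφ) hk
      (Eventually.of_forall fun q => ((j q.1).2 φ hφ).isCn n)
      (Eventually.of_forall fun q => ((k q.2).2 φ hφ).isCn n)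
      (((j p.1).2 φ hφ).isCn n) (((k p.2).2 φ hφ).isCn n)

@[simp] theorem SmoothFun.pairCLM_apply (j : X →L[ℝ] SmoothFun 𝕜 A F)
    (k : Y →L[ℝ] SmoothFun 𝕜 A H) (p : X × Y) :
    SmoothFun.pairCLM j k p = SmoothFun.pair (j p.1) (k p.2) := rfl

end Pairing

section ChartDomain

theorem exists_isOpen_inter_eq {X Y : Type*} [TopologicalSpace X] [TopologicalSpace Y] {f : X → Y}
    {U : Set X} {V : Set Y} (hf : ContinuousOn f U) (hV : IsOpen V) :
    ∃ O, IsOpen O ∧ {x | x ∈ U ∧ f x ∈ V} = U ∩ O := by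
  obtain ⟨O, hO, h⟩ := continuousOn_iff'.1 hf V hV
  exact ⟨O, hO, by rw [inter_comm U, ← h, inter_comm]; rfl⟩

variable {M : Type w} {E : Type u} {F : Type v} [TopologicalSpace M] [TopologicalSpace E]
  [TopologicalSpace F] {φ : PartialEquiv M E} {Ω : Set (M × F)}

/-- The part of `E × F` which corresponds to `Ω ⊆ M × F` in the chart `φ` of `M`. -/
def chartDomain {M E F : Type*} (φ : PartialEquiv M E) (Ω : Set (M × F)) : Set (E × F) :=
  {p | p.1 ∈ φ.target ∧ (φ.symm p.1, p.2) ∈ Ω}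

theorem exists_chartDomain_eq (hφ : ContinuousOn φ.symm φ.target) (hΩ : IsOpen Ω) :
    ∃ O : Set (E × F), IsOpen O ∧ chartDomain φ Ω = φ.target ×ˢ univ ∩ O := by
  have hc : ContinuousOn (fun p : E × F => (φ.symm p.1, p.2)) (φ.target ×ˢ univ) :=
    (hφ.comp continuousOn_fst fun p hp => hp.1).prodMk continuousOn_snd
  obtain ⟨O, hO, hOeq⟩ := exists_isOpen_inter_eq hc hΩ
  refine ⟨O, hO, ?_⟩
  rw [← hOeq]
  ext p
  exact ⟨fun h => ⟨⟨h.1, trivial⟩, h.2⟩, fun h => ⟨h.1.1, h.2⟩⟩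

theorem mem_interior_chartDomain (hφ : ContinuousOn φ.symm φ.target) (hΩ : IsOpen Ω) {p : E × F} :
    p ∈ interior (chartDomain φ Ω) ↔ p.1 ∈ interior φ.target ∧ (φ.symm p.1, p.2) ∈ Ω := by
  obtain ⟨O, hO, h⟩ := exists_chartDomain_eq hφ hΩ
  have hint : interior (chartDomain φ Ω) = interior φ.target ×ˢ univ ∩ O := by
    rw [h, interior_inter, hO.interior_eq, interior_prod_eq, interior_univ]
  refine ⟨fun hp => ⟨(hint ▸ hp).1.1, (interior_subset hp).2⟩, fun hp => ?_⟩
  have hmem : p ∈ chartDomain φ Ω := ⟨interior_subset hp.1, hp.2⟩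
  exact hint ▸ ⟨⟨hp.1, trivial⟩, (h ▸ hmem).2⟩

theorem accessible_chartDomain [AddCommGroup E] [Module ℝ E] [IsTopologicalAddGroup E]
    [ContinuousSMul ℝ E] [AddCommGroup F] [Module ℝ F] [IsTopologicalAddGroup F]
    [ContinuousSMul ℝ F] {A : Set (PartialEquiv M E)} [IsAtlas A] (hφ : φ ∈ A) (hΩ : IsOpen Ω) :
    Accessible (chartDomain φ Ω) := by
  obtain ⟨O, hO, h⟩ := exists_chartDomain_eq (IsAtlas.continuousOn_symm φ hφ) hΩ
  rw [h]
  exact (IsAtlas.accessible φ hφ).prod_univ.inter_isOpen hO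

end ChartDomain

/-! ### Push-forwards along smooth families of maps -/

section SmoothFamily

/-- A family of maps `f m : F → H`, defined for `(m, y)` in the open set `Ω ⊆ M × F`, which is
jointly smooth over `𝕜` and smooth over `𝕝` for fixed `m`. -/
structure SmoothFamily (𝕜 𝕝 : Type*) [Semiring 𝕜] [Semiring 𝕝] {M : Type w} [TopologicalSpace M]
    {E : Type u} [AddCommGroup E] [Module ℝ E] [Module 𝕜 E] [TopologicalSpace E]
    (A : Set (PartialEquiv M E)) {F : Type v} {H : Type x}
    [AddCommGroup F] [Module ℝ F] [Module 𝕜 F] [Module 𝕝 F] [TopologicalSpace F]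
    [AddCommGroup H] [Module ℝ H] [Module 𝕜 H] [Module 𝕝 H] [TopologicalSpace H]
    (f : M → F → H) (Ω : Set (M × F)) : Prop where
  isOpen : IsOpen Ω
  joint : ∀ φ ∈ A, IsSmoothOn 𝕜 (fun p : E × F => f (φ.symm p.1) p.2) (chartDomain φ Ω)
  slice : ∀ m, IsSmoothOn 𝕝 (f m) {y | (m, y) ∈ Ω}

variable {𝕜 𝕝 : Type*} [Semiring 𝕜] [Semiring 𝕝] {M : Type w} [TopologicalSpace M]
  {E : Type u} [AddCommGroup E] [Module ℝ E] [Module 𝕜 E] [TopologicalSpace E]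
  {A : Set (PartialEquiv M E)} {F : Type v} {H : Type x}
  [AddCommGroup F] [Module ℝ F] [Module 𝕜 F] [Module 𝕝 F] [TopologicalSpace F]
  [AddCommGroup H] [Module ℝ H] [Module 𝕜 H] [Module 𝕝 H] [TopologicalSpace H]
  {f : M → F → H} {Ω : Set (M × F)} {φ : PartialEquiv M E}

theorem SmoothFamily.isOpen_slice (hf : SmoothFamily 𝕜 𝕝 A f Ω) (m : M) :
    IsOpen {y | (m, y) ∈ Ω} := hf.isOpen.preimage (Continuous.prodMk_right m)

variable [IsTopologicalAddGroup E] [ContinuousSMul ℝ E] [IsTopologicalAddGroup F]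
  [ContinuousSMul ℝ F]

variable [IsAtlas A]

namespace SmoothFamily

theorem eventually_mem_interior_chartDomain (hf : SmoothFamily 𝕜 𝕝 A f Ω) (hφ : φ ∈ A) {x u : E}
    {y : F} (hx : x ∈ φ.target) (hxy : (φ.symm x, y) ∈ Ω)
    (hu : ∀ᶠ t : ℝ in 𝓝[>] 0, x + t • u ∈ interior φ.target) (v : F) :
    ∀ᶠ p : ℝ × ℝ in 𝓝[>] 0 ×ˢ 𝓝 0,
      (x, y) + p.1 • (u, 0) + p.2 • (0, v) ∈ interior (chartDomain φ Ω) := by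
  have hsymm := IsAtlas.continuousOn_symm φ hφ
  have hlimx : Tendsto (fun t : ℝ => φ.symm (x + t • u)) (𝓝[>] 0) (𝓝 (φ.symm x)) :=
    (hsymm x hx).tendsto.comp (tendsto_nhdsWithin_iff.2
      ⟨(tendsto_add_smul x u).mono_left nhdsWithin_le_nhds, hu.mono fun t ht => interior_subset ht⟩)
  have hlim := hlimx.prodMap (tendsto_add_smul y v)
  rw [← nhds_prod_eq] at hlim
  filter_upwards [hlim.eventually (hf.isOpen.mem_nhds hxy), hu.prod_inl (𝓝 0)] with p hpΩ hp
  rw [mem_interior_chartDomain hsymm hf.isOpen]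
  simpa using And.intro hp (show (φ.symm (x + p.1 • u), y + p.2 • v) ∈ Ω from hpΩ)

variable [IsTopologicalAddGroup H] [ContinuousSMul ℝ H] [LocallyConvexSpace ℝ H]

theorem isSmoothOn_comp (hf : SmoothFamily 𝕜 𝕝 A f Ω) (ξ : SmoothFun 𝕜 A F)
    (hξ : ∀ m, (m, ξ.1 m) ∈ Ω) (φ : PartialEquiv M E) (hφ : φ ∈ A) :
    IsSmoothOn 𝕜 (fun x => f (φ.symm x) (ξ.1 (φ.symm x))) φ.target :=
  (hf.joint φ hφ).comp (ξ.isSmoothOn_id_prodMk hφ) (fun _ hx => ⟨hx, hξ _⟩)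
    fun _ hx => (mem_interior_chartDomain (IsAtlas.continuousOn_symm φ hφ) hf.isOpen).2 ⟨hx, hξ _⟩

open Classical in
/-- The push-forward `ξ ↦ (m ↦ f m (ξ m))`, with value `0` if the graph of `ξ` is not contained
in `Ω`. -/
noncomputable def push (hf : SmoothFamily 𝕜 𝕝 A f Ω) (ξ : SmoothFun 𝕜 A F) : SmoothFun 𝕜 A H :=
  if h : ∀ m, (m, ξ.1 m) ∈ Ω then ⟨fun m => f m (ξ.1 m), hf.isSmoothOn_comp ξ h⟩ else 0

theorem push_val (hf : SmoothFamily 𝕜 𝕝 A f Ω) {ξ : SmoothFun 𝕜 A F}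
    (hξ : ∀ m, (m, ξ.1 m) ∈ Ω) (m : M) : (hf.push ξ).1 m = f m (ξ.1 m) := by
  have h : hf.push ξ = ⟨fun m => f m (ξ.1 m), hf.isSmoothOn_comp ξ hξ⟩ := dif_pos hξ
  rw [h]

theorem hasSlope_snd (hf : SmoothFamily 𝕜 𝕝 A f Ω) (hφ : φ ∈ A) {x : E} {y : F}
    (hx : x ∈ φ.target) (hxy : (φ.symm x, y) ∈ Ω) (v : F) :
    HasSlope (fun s : ℝ => f (φ.symm x) (y + s • v))
      (differential (fun p : E × F => f (φ.symm p.1) p.2) (chartDomain φ Ω) ((x, y), (0, v)))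
      0 := by
  obtain ⟨u, hu⟩ := IsAtlas.accessible φ hφ x hx
  have hy : y ∈ interior {y | (φ.symm x, y) ∈ Ω} := by
    rwa [(hf.isOpen_slice _).interior_eq]
  have hv : ∀ᶠ s : ℝ in 𝓝 0, (x, y) + s • (0, v) ∈ chartDomain φ Ω := by
    filter_upwards [eventually_add_smul_mem hy v] with s hs
    simpa [chartDomain] using And.intro hx (interior_subset hs)
  simpa [HasSlope] using (hf.joint φ hφ).hasDifferentialOn.hasSlope_of_eventually_mem_interior
    (hf.joint φ hφ).continuousOn (hf.eventually_mem_interior_chartDomain hφ hx hxy hu v) hv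

variable [T2Space H]

theorem differential_chartDomain_eq (hf : SmoothFamily 𝕜 𝕝 A f Ω) (hφ : φ ∈ A) {x : E} {y : F}
    (hx : x ∈ φ.target) (hxy : (φ.symm x, y) ∈ Ω) (v : F) :
    differential (fun p : E × F => f (φ.symm p.1) p.2) (chartDomain φ Ω) ((x, y), (0, v)) =
      differential (f (φ.symm x)) {y | (φ.symm x, y) ∈ Ω} (y, v) := by
  have hy : y ∈ interior {y | (φ.symm x, y) ∈ Ω} := by
    rwa [(hf.isOpen_slice _).interior_eq]
  refine tendsto_nhds_unique ?_ ((hf.slice (φ.symm x)).hasDifferentialOn.tendsto y hy v)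
  simpa [HasSlope] using hf.hasSlope_snd hφ hx hxy v

variable [ContinuousConstSMul 𝕜 H] [SMulCommClass ℝ 𝕜 H]

theorem isSmoothOn_differential_chartDomain (hf : SmoothFamily 𝕜 𝕝 A f Ω) (hφ : φ ∈ A) :
    IsSmoothOn 𝕜 (fun p : E × (F × F) => differential (fun p : E × F => f (φ.symm p.1) p.2)
      (chartDomain φ Ω) ((p.1, p.2.1), (0, p.2.2)))
      (chartDomain φ {p : M × (F × F) | (p.1, p.2.1) ∈ Ω}) := by
  let L : E × (F × F) →L[ℝ] (E × F) × (E × F) :=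
    { toFun := fun p => ((p.1, p.2.1), (0, p.2.2))
      map_add' := fun p q => by simp
      map_smul' := fun c p => by simp
      cont := by fun_prop }
  have hL : IsLinearMap 𝕜 L := ⟨fun _ _ => by simp [L], fun _ _ => by simp [L]⟩
  have hsymm := IsAtlas.continuousOn_symm φ hφ
  have hΩ : IsOpen {p : M × (F × F) | (p.1, p.2.1) ∈ Ω} := hf.isOpen.preimage (by fun_prop)
  have hd := (hf.joint φ hφ).differential (accessible_chartDomain hφ hf.isOpen)
  refine hd.comp_continuousLinearMap L hL (fun p hp => ⟨hp, trivial⟩) fun p hp => ?_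
  rw [mem_interior_chartDomain hsymm hΩ] at hp
  rw [interior_prod_eq, interior_univ]
  exact ⟨(mem_interior_chartDomain hsymm hf.isOpen).2 hp, trivial⟩

variable [ContinuousConstSMul 𝕝 H] [SMulCommClass ℝ 𝕝 H]

protected theorem differential (hf : SmoothFamily 𝕜 𝕝 A f Ω) :
    SmoothFamily 𝕜 𝕝 A (fun m => differential (f m) {y | (m, y) ∈ Ω})
      {p : M × (F × F) | (p.1, p.2.1) ∈ Ω} where
  isOpen := hf.isOpen.preimage (by fun_prop)
  joint φ hφ := (hf.isSmoothOn_differential_chartDomain hφ).congr fun p hp =>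
    hf.differential_chartDomain_eq hφ hp.1 hp.2 p.2.2
  slice m := by
    convert (hf.slice m).differential (accessible_of_isOpen (hf.isOpen_slice m)) using 1
    ext p
    simp

end SmoothFamily

end SmoothFamily

section Push

variable {𝕜 𝕝 : Type*} [Semiring 𝕜] [Semiring 𝕝] {M : Type w} [TopologicalSpace M]
  {E : Type u} [AddCommGroup E] [Module ℝ E] [Module 𝕜 E] [TopologicalSpace E]
  [IsTopologicalAddGroup E] [ContinuousSMul ℝ E] [T2Space E]
  {A : Set (PartialEquiv M E)} [IsAtlas A] {F : Type v} {H : Type x}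
  [AddCommGroup F] [Module ℝ F] [Module 𝕜 F] [Module 𝕝 F] [TopologicalSpace F]
  [IsTopologicalAddGroup F] [ContinuousSMul ℝ F] [T2Space F] [SMulCommClass 𝕜 ℝ F]
  [AddCommGroup H] [Module ℝ H] [Module 𝕜 H] [Module 𝕝 H] [TopologicalSpace H]
  [IsTopologicalAddGroup H] [ContinuousSMul ℝ H] [LocallyConvexSpace ℝ H] [T2Space H]
  {X : Type y} [AddCommGroup X] [Module ℝ X] [TopologicalSpace X]
  {f : M → F → H} {Ω : Set (M × F)} (hf : SmoothFamily 𝕜 𝕝 A f Ω)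
  (j : X →L[ℝ] SmoothFun 𝕜 A F)

namespace SmoothFamily

theorem continuousOn_push :
    ContinuousOn (fun x => hf.push (j x)) {x : X | ∀ m, (m, (j x).1 m) ∈ Ω} := by
  intro x₀ hx₀
  refine SmoothFun.tendsto_iff.2 fun φ hφ n => ?_
  have hsymm := IsAtlas.continuousOn_symm φ hφ
  have hU := IsAtlas.accessible φ hφ
  let graph : X → E → E × F := fun x y => (y, (j x).1 (φ.symm y))
  have hgraph : ∀ x : X, (∀ m, (m, (j x).1 m) ∈ Ω) → IsCn n (graph x) φ.target ∧
      MapsTo (graph x) φ.target (chartDomain φ Ω) ∧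
      MapsTo (graph x) (interior φ.target) (interior (chartDomain φ Ω)) := fun x hx =>
    ⟨((j x).isSmoothOn_id_prodMk hφ).isCn n, fun y hy => ⟨hy, hx _⟩,
      fun y hy => (mem_interior_chartDomain hsymm hf.isOpen).2 ⟨hy, hx _⟩⟩
  have hid : ∀ m, IsCn m (fun y : E => y) φ.target :=
    fun m => IsCn.continuousLinearMap (ContinuousLinearMap.id ℝ E) φ.target
  have hlim : ∀ m ≤ n, TendstoCn m graph (𝓝[{x : X | ∀ m, (m, (j x).1 m) ∈ Ω}] x₀) (graph x₀)
      φ.target := fun m _ =>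
    (tendstoCn_const hU (hid m)).prodMk hU
      (SmoothFun.tendsto_iff.1 ((j.continuous.tendsto x₀).mono_left nhdsWithin_le_nhds) φ hφ m)
      (Eventually.of_forall fun _ => hid m)
      (Eventually.of_forall fun x => ((j x).2 φ hφ).isCn m) (hid m) (((j x₀).2 φ hφ).isCn m)
  have hgood : ∀ᶠ x in 𝓝[{x : X | ∀ m, (m, (j x).1 m) ∈ Ω}] x₀, ∀ m, (m, (j x).1 m) ∈ Ω :=
    self_mem_nhdsWithin
  obtain ⟨hg₀, hm, hm'⟩ := hgraph x₀ hx₀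
  refine (TendstoCn.comp_left hU (accessible_chartDomain hφ hf.isOpen) hlim
    ((hf.joint φ hφ).isCn n) (hgood.mono hgraph) hg₀ hm hm').congr ?_ ?_
  · exact hgood.mono fun x hx y _ => (hf.push_val hx _).symm
  · exact fun y _ => (hf.push_val hx₀ _).symm

variable [ContinuousConstSMul 𝕜 H] [SMulCommClass ℝ 𝕜 H] [ContinuousConstSMul 𝕝 H]
  [SMulCommClass ℝ 𝕝 H]

theorem differential_push_pairCLM_val {x : X} (hx : ∀ m, (m, (j x).1 m) ∈ Ω) (v : X) (m : M) :
    (hf.differential.push (SmoothFun.pairCLM j j (x, v))).1 m =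
      differential (f m) {y | (m, y) ∈ Ω} ((j x).1 m, (j v).1 m) :=
  hf.differential.push_val (ξ := SmoothFun.pairCLM j j (x, v)) hx m

theorem continuousOn_differential_push : ContinuousOn
    (fun p : X × X => hf.differential.push (SmoothFun.pairCLM j j p))
    ({x : X | ∀ m, (m, (j x).1 m) ∈ Ω} ×ˢ univ) :=
  (hf.differential.continuousOn_push (SmoothFun.pairCLM j j)).mono fun _ hp => hp.1

variable [CompactSpace M] [LocallyCompactSpace M] [IsTopologicalAddGroup X] [ContinuousSMul ℝ X]

theorem hasSlope_push {x v : X} {s : ℝ} (hs : ∀ m, (m, (j (x + s • v)).1 m) ∈ Ω) (m : M) :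
    HasSlope (fun s : ℝ => (hf.push (j (x + s • v))).1 m)
      ((hf.differential.push (SmoothFun.pairCLM j j (x + s • v, v))).1 m) s := by
  have hy : (j x).1 m + s • (j v).1 m ∈ interior {y | (m, y) ∈ Ω} := by
    simpa [(hf.isOpen_slice m).interior_eq] using hs m
  rw [hf.differential_push_pairCLM_val j hs, map_add, map_smul, SmoothFun.add_val,
    SmoothFun.smul_val]
  refine ((hf.slice m).hasDifferentialOn.hasSlope hy).congr' ?_
  have hc : Continuous fun h : ℝ => x + (s + h) • v := by fun_prop
  have hO := (SmoothFun.isOpen_setOf_forall_mem hf.isOpen).preimage j.continuous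
  have hev : ∀ᶠ h : ℝ in 𝓝 0, ∀ m, (m, (j (x + (s + h) • v)).1 m) ∈ Ω :=
    hc.continuousAt.eventually (hO.mem_nhds (by simpa using hs))
  filter_upwards [nhdsWithin_le_nhds hev] with h hh
  rw [hf.push_val hh, hf.push_val hs]
  simp

variable [SMulCommClass 𝕜 ℝ H]

theorem hasDifferentialOn_push :
    HasDifferentialOn (fun x => hf.push (j x))
      (fun p : X × X => hf.differential.push (SmoothFun.pairCLM j j p))
      {x : X | ∀ m, (m, (j x).1 m) ∈ Ω} where
  continuousOn := hf.continuousOn_differential_push j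
  tendsto x hx v := by
    have hO := (SmoothFun.isOpen_setOf_forall_mem hf.isOpen).preimage j.continuous
    have hc : Continuous fun s : ℝ => x + s • v := by fun_prop
    refine SmoothFun.tendsto_iff.2 fun φ hφ n => ?_
    have hlim := tendstoCn_slope (n := n) (U := φ.target) (s₀ := 0)
      (c := fun s y => (hf.push (j (x + s • v))).1 (φ.symm y))
      (c' := fun s y => (hf.differential.push (SmoothFun.pairCLM j j (x + s • v, v))).1 (φ.symm y))
      (IsAtlas.accessible φ hφ) (hO.preimage hc) (fun s hs y _ => hf.hasSlope_push j hs (φ.symm y))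
      (fun s _ => ((hf.push (j (x + s • v))).2 φ hφ).isCn n)
      (fun s _ => ((hf.differential.push (SmoothFun.pairCLM j j (x + s • v, v))).2 φ hφ).isCn n)
      (fun m _ s hs => ?_) (by simpa using interior_subset hx)
    · exact hlim.congr (Eventually.of_forall fun h y _ => by simp) fun y _ => by simp
    · have hcv : Continuous fun s : ℝ => (x + s • v, v) := by fun_prop
      have hpush := (hf.continuousOn_differential_push j).continuousAt
        ((hO.prod isOpen_univ).mem_nhds (x := (x + s • v, v)) ⟨hs, trivial⟩)
      exact SmoothFun.tendsto_iff.1 (hpush.tendsto.comp (hcv.tendsto s)) φ hφ m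

include hf in
theorem isCn_push (n : ℕ) :
    IsCn n (fun x => hf.push (j x)) {x : X | ∀ m, (m, (j x).1 m) ∈ Ω} := by
  induction n generalizing F X with
  | zero => exact hf.continuousOn_push j
  | succ n ih =>
    refine ⟨hf.continuousOn_push j, _, hf.hasDifferentialOn_push j, ?_⟩
    convert ih hf.differential (SmoothFun.pairCLM j j) using 1
    ext p
    simp

theorem isSmoothOn_push [Module 𝕝 X] [SMulCommClass 𝕜 𝕝 F] [SMulCommClass ℝ 𝕝 F]
    [ContinuousConstSMul 𝕝 F] [SMulCommClass 𝕜 𝕝 H] (hj : IsLinearMap 𝕝 j) :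
    IsSmoothOn 𝕝 (fun x => hf.push (j x)) {x : X | ∀ m, (m, (j x).1 m) ∈ Ω} := by
  refine ⟨hf.isCn_push j, _, hf.hasDifferentialOn_push j, fun x hx => ?_⟩
  have hmem := interior_subset hx
  have hlin : ∀ m, IsLinearMap 𝕝 fun w => differential (f m) {y | (m, y) ∈ Ω} ((j x).1 m, w) :=
    fun m => (hf.slice m).isLinearMap ((hf.isOpen_slice m).interior_eq.symm ▸ hmem m)
  constructor
  · intro v w
    ext m
    simp only [SmoothFun.add_val, hf.differential_push_pairCLM_val j hmem, map_add,
      (hlin m).map_add]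
  · intro c v
    ext m
    simp only [SmoothFun.smul_val, hf.differential_push_pairCLM_val j hmem, hj.map_smul,
      (hlin m).map_smul]

end SmoothFamily

end Push

/-! ### Smooth maps into manifolds -/

section OpenAtlas

variable {Y : Type w} {F : Type v} [TopologicalSpace F]

/-- `B` is a set of charts of `Y` onto open sets, and covers `Y`. -/
class IsOpenAtlas [TopologicalSpace Y] (B : Set (PartialEquiv Y F)) : Prop where
  isOpen_source : ∀ φ ∈ B, IsOpen φ.source
  isOpen_target : ∀ φ ∈ B, IsOpen φ.target
  continuousOn : ∀ φ ∈ B, ContinuousOn φ φ.source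
  continuousOn_symm : ∀ φ ∈ B, ContinuousOn φ.symm φ.target
  cover : ∀ m : Y, ∃ φ ∈ B, m ∈ φ.source

theorem IsChart.isOpen_target {tY : TopologicalSpace Y} {φ : PartialEquiv Y F}
    (h : IsChart tY univ φ) : IsOpen φ.target := by
  obtain ⟨O, hO, h⟩ := h.target_eq
  rwa [h, inter_univ]

theorem ManifoldStructure.isOpenAtlas_of_subset {𝕝 : Type*} [Semiring 𝕝] [AddCommGroup F]
    [Module ℝ F] [Module 𝕝 F] (S : ManifoldStructure 𝕝 Y F univ) {B : Set (PartialEquiv Y F)}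
    (hB : B ⊆ S.atlas) (hcover : ∀ y : Y, ∃ φ ∈ B, y ∈ φ.source) :
    letI := S.top
    IsOpenAtlas B :=
  letI := S.top
  { isOpen_source := fun φ hφ => (S.isChart φ (hB hφ)).isOpen_source
    isOpen_target := fun φ hφ => (S.isChart φ (hB hφ)).isOpen_target
    continuousOn := fun φ hφ => (S.isChart φ (hB hφ)).continuousOn
    continuousOn_symm := fun φ hφ => (S.isChart φ (hB hφ)).continuousOn_symm
    cover := hcover }

theorem ManifoldStructure.isOpenAtlas {𝕝 : Type*} [Semiring 𝕝] [AddCommGroup F] [Module ℝ F]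
    [Module 𝕝 F] (S : ManifoldStructure 𝕝 Y F univ) :
    letI := S.top
    IsOpenAtlas S.atlas :=
  S.isOpenAtlas_of_subset Subset.rfl S.cover

theorem IsOpenAtlas.isChart [tY : TopologicalSpace Y] {B : Set (PartialEquiv Y F)} [IsOpenAtlas B]
    {e : PartialEquiv Y F} (he : e ∈ B) : IsChart tY univ e where
  isOpen_source := IsOpenAtlas.isOpen_source e he
  target_eq := ⟨e.target, IsOpenAtlas.isOpen_target e he, (inter_univ _).symm⟩
  continuousOn := IsOpenAtlas.continuousOn e he
  continuousOn_symm := IsOpenAtlas.continuousOn_symm e he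

instance IsOpenAtlas.isAtlas [TopologicalSpace Y] [AddCommGroup F] [Module ℝ F]
    (B : Set (PartialEquiv Y F)) [IsOpenAtlas B] : IsAtlas B where
  accessible φ hφ := accessible_of_isOpen (IsOpenAtlas.isOpen_target φ hφ)
  isOpen_source := IsOpenAtlas.isOpen_source
  continuousOn := IsOpenAtlas.continuousOn
  continuousOn_symm := IsOpenAtlas.continuousOn_symm
  cover := IsOpenAtlas.cover

instance [TopologicalSpace Y] {Y' : Type x} {F' : Type y} [TopologicalSpace Y']
    [TopologicalSpace F'] (B : Set (PartialEquiv Y F)) (B' : Set (PartialEquiv Y' F'))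
    [IsOpenAtlas B] [IsOpenAtlas B'] :
    IsOpenAtlas (Set.image2 (fun φ ψ => φ.prod ψ) B B') where
  isOpen_source := by
    rintro _ ⟨φ, hφ, ψ, hψ, rfl⟩
    exact (IsOpenAtlas.isOpen_source φ hφ).prod (IsOpenAtlas.isOpen_source ψ hψ)
  isOpen_target := by
    rintro _ ⟨φ, hφ, ψ, hψ, rfl⟩
    exact (IsOpenAtlas.isOpen_target φ hφ).prod (IsOpenAtlas.isOpen_target ψ hψ)
  continuousOn := by
    rintro _ ⟨φ, hφ, ψ, hψ, rfl⟩
    exact (IsOpenAtlas.continuousOn φ hφ).prodMap (IsOpenAtlas.continuousOn ψ hψ)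
  continuousOn_symm := by
    rintro _ ⟨φ, hφ, ψ, hψ, rfl⟩
    exact (IsOpenAtlas.continuousOn_symm φ hφ).prodMap (IsOpenAtlas.continuousOn_symm ψ hψ)
  cover := by
    rintro ⟨a, b⟩
    obtain ⟨φ, hφ, ha⟩ := IsOpenAtlas.cover (B := B) a
    obtain ⟨ψ, hψ, hb⟩ := IsOpenAtlas.cover (B := B') b
    exact ⟨_, mem_image2_of_mem hφ hψ, ha, hb⟩

end OpenAtlas

section SmoothInto

/-- `g : U → Y` is smooth (locally in `U`) with respect to the charts in `B`. -/
def SmoothInto (𝕜 : Type*) [Semiring 𝕜] {E : Type u} {Y : Type w} {F : Type v}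
    [AddCommGroup E] [Module ℝ E] [Module 𝕜 E] [TopologicalSpace E]
    [AddCommGroup F] [Module ℝ F] [Module 𝕜 F] [TopologicalSpace F]
    (B : Set (PartialEquiv Y F)) (g : E → Y) (U : Set E) : Prop :=
  ∀ x ∈ U, ∃ O, IsOpen O ∧ x ∈ O ∧ ∃ ψ ∈ B, MapsTo g (U ∩ O) ψ.source ∧
    IsSmoothOn 𝕜 (fun x => ψ (g x)) (U ∩ O)

variable {𝕜 : Type*} [Semiring 𝕜] {E : Type u} {E' : Type v} {Y : Type w} {F : Type x}
  [AddCommGroup E] [Module ℝ E] [Module 𝕜 E] [TopologicalSpace E]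
  [AddCommGroup E'] [Module ℝ E'] [Module 𝕜 E'] [TopologicalSpace E']
  [AddCommGroup F] [Module ℝ F] [Module 𝕜 F] [TopologicalSpace F]
  {B : Set (PartialEquiv Y F)} {g : E → Y} {U O : Set E}

namespace SmoothInto

theorem inter_isOpen (hg : SmoothInto 𝕜 B g U) (hO : IsOpen O) :
    SmoothInto 𝕜 B g (U ∩ O) := by
  rintro x ⟨hx, -⟩
  obtain ⟨O', hO', hxO', ψ, hψ, hm, hs⟩ := hg x hx
  refine ⟨O', hO', hxO', ψ, hψ, ?_, ?_⟩
  · rw [inter_right_comm]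
    exact hm.mono_left inter_subset_left
  · rw [inter_right_comm]
    exact hs.inter_isOpen hO

theorem of_isSmoothOn {ψ : PartialEquiv Y F} (hψ : ψ ∈ B) (hm : MapsTo g U ψ.source)
    (hs : IsSmoothOn 𝕜 (fun x => ψ (g x)) U) : SmoothInto 𝕜 B g U := fun x _ =>
  ⟨univ, isOpen_univ, trivial, ψ, hψ, by rwa [inter_univ], by rwa [inter_univ]⟩

theorem comp_continuousLinearMap (hg : SmoothInto 𝕜 B g U) (L : E' →L[ℝ] E) (hL : IsLinearMap 𝕜 L)
    {U' : Set E'} (hm : MapsTo L U' U) (hm' : MapsTo L (interior U') (interior U)) :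
    SmoothInto 𝕜 B (fun x => g (L x)) U' := by
  intro x hx
  obtain ⟨O, hO, hxO, ψ, hψ, hgm, hs⟩ := hg (L x) (hm hx)
  refine ⟨L ⁻¹' O, hO.preimage L.continuous, hxO, ψ, hψ, fun y hy => hgm ⟨hm hy.1, hy.2⟩, ?_⟩
  refine hs.comp_continuousLinearMap L hL (fun y hy => ⟨hm hy.1, hy.2⟩) fun y hy => ?_
  rw [interior_inter] at hy ⊢
  rw [hO.interior_eq]
  exact ⟨hm' hy.1, (interior_subset hy.2 : y ∈ L ⁻¹' O)⟩

theorem comp_continuousLinearMap_of_isOpen (hg : SmoothInto 𝕜 B g U) (hU : IsOpen U)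
    (L : E' →L[ℝ] E) (hL : IsLinearMap 𝕜 L) {U' : Set E'} (hm : MapsTo L U' U) :
    SmoothInto 𝕜 B (fun x => g (L x)) U' :=
  hg.comp_continuousLinearMap L hL hm (by rw [hU.interior_eq]; exact hm.mono_left interior_subset)

theorem prodMk {Y' : Type*} {F' : Type*} [AddCommGroup F'] [Module ℝ F'] [Module 𝕜 F']
    [TopologicalSpace F'] {B' : Set (PartialEquiv Y' F')} {k : E → Y'} (hg : SmoothInto 𝕜 B g U)
    (hk : SmoothInto 𝕜 B' k U) :
    SmoothInto 𝕜 (Set.image2 (fun φ ψ => φ.prod ψ) B B') (fun x => (g x, k x)) U := by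
  intro x hx
  obtain ⟨O, hO, hxO, ψ, hψ, hgm, hs⟩ := hg x hx
  obtain ⟨O', hO', hxO', χ, hχ, hkm, hs'⟩ := hk x hx
  refine ⟨O ∩ O', hO.inter hO', ⟨hxO, hxO'⟩, _, mem_image2_of_mem hψ hχ,
    fun y hy => ⟨hgm ⟨hy.1, hy.2.1⟩, hkm ⟨hy.1, hy.2.2⟩⟩, ?_⟩
  have hgs := hs.inter_isOpen hO'
  have hks := hs'.inter_isOpen hO
  rw [inter_assoc] at hgs
  rw [inter_assoc, inter_comm O'] at hks
  exact hgs.prodMk hks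

theorem comp_isSmoothOn [IsTopologicalAddGroup E] [ContinuousSMul ℝ E]
    [IsTopologicalAddGroup F] [ContinuousSMul ℝ F] [LocallyConvexSpace ℝ F]
    (hg : SmoothInto 𝕜 B g U) {h : E' → E} {U' : Set E'}
    (hh : IsSmoothOn 𝕜 h U') (hm : MapsTo h U' U)
    (hm' : MapsTo h (interior U') (interior U)) : SmoothInto 𝕜 B (fun x => g (h x)) U' := by
  intro x hx
  obtain ⟨O, hO, hxO, ψ, hψ, hgm, hs⟩ := hg (h x) (hm hx)
  obtain ⟨O', hO', hOO'⟩ := exists_isOpen_inter_eq hh.continuousOn hO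
  have hmem : ∀ y ∈ U' ∩ O', h y ∈ O := fun y hy => (hOO'.superset hy).2
  refine ⟨O', hO', (hOO'.subset ⟨hx, hxO⟩).2, ψ, hψ, fun y hy => hgm ⟨hm hy.1, hmem y hy⟩, ?_⟩
  refine hs.comp (hh.inter_isOpen hO') (fun y hy => ⟨hm hy.1, hmem y hy⟩) fun y hy => ?_
  have hy' := hmem y (interior_subset hy)
  rw [interior_inter] at hy
  rw [interior_inter, hO.interior_eq]
  exact ⟨hm' hy.1, hy'⟩

variable [TopologicalSpace Y] [IsOpenAtlas B]

protected theorem continuousOn (hg : SmoothInto 𝕜 B g U) : ContinuousOn g U := by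
  intro x hx
  obtain ⟨O, hO, hxO, ψ, hψ, hm, hs⟩ := hg x hx
  have hc : ContinuousOn g (U ∩ O) :=
    ((IsOpenAtlas.continuousOn_symm ψ hψ).comp hs.continuousOn
      fun y hy => ψ.map_source (hm hy)).congr fun y hy => (ψ.left_inv (hm hy)).symm
  exact (continuousWithinAt_inter (hO.mem_nhds hxO)).1 (hc x ⟨hx, hxO⟩)

protected theorem const (c : Y) (U : Set E) : SmoothInto 𝕜 B (fun _ => c) U := by
  obtain ⟨ψ, hψ, hc⟩ := IsOpenAtlas.cover (B := B) c
  exact SmoothInto.of_isSmoothOn hψ (fun _ _ => hc) (IsSmoothOn.const _ _)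

end SmoothInto

variable [IsTopologicalAddGroup F] [ContinuousSMul ℝ F]

theorem smoothInto_symm {ψ : PartialEquiv Y F} (hψ : ψ ∈ B) : SmoothInto 𝕜 B ψ.symm ψ.target :=
  SmoothInto.of_isSmoothOn hψ (fun _ hx => ψ.map_target hx)
    ((IsSmoothOn.continuousLinearMap (ContinuousLinearMap.id ℝ F)
      (LinearMap.id : F →ₗ[𝕜] F).isLinear _).congr fun _ hx => (ψ.right_inv hx).symm)

variable {H : Type*} [AddCommGroup H] [Module ℝ H] [Module 𝕜 H] [TopologicalSpace H]
  [IsTopologicalAddGroup H] [ContinuousSMul ℝ H] [LocallyConvexSpace ℝ H]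

theorem IsSmoothOn.comp_isOpen {k : F → H} {Ω : Set F} {g : E → F}
    (hk : IsSmoothOn 𝕜 k Ω) (hΩ : IsOpen Ω) (hg : IsSmoothOn 𝕜 g U) (hm : MapsTo g U Ω) :
    IsSmoothOn 𝕜 (k ∘ g) U :=
  hk.comp hg hm (by rw [hΩ.interior_eq]; exact hm.mono_left interior_subset)

variable [IsTopologicalAddGroup E] [ContinuousSMul ℝ E] [TopologicalSpace Y] [IsOpenAtlas B]

theorem IsSmoothOn.comp_of_chart {k : Y → H} {V : Set Y} (hV : IsOpen V) {e : PartialEquiv Y F}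
    (he : e ∈ B) (hk : IsSmoothOn 𝕜 (fun x => k (e.symm x)) {x | x ∈ e.target ∧ e.symm x ∈ V})
    (hg : IsSmoothOn 𝕜 (fun x => e (g x)) U) (hm : MapsTo g U e.source) (hmV : MapsTo g U V) :
    IsSmoothOn 𝕜 (fun x => k (g x)) U := by
  have hopen : IsOpen {x | x ∈ e.target ∧ e.symm x ∈ V} :=
    (IsOpenAtlas.continuousOn_symm e he).isOpen_inter_preimage (IsOpenAtlas.isOpen_target e he) hV
  refine (hk.comp_isOpen hopen hg fun x hx => ⟨e.map_source (hm hx), ?_⟩).congr fun x hx => ?_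
  · rw [e.left_inv (hm hx)]
    exact hmV hx
  · simp [e.left_inv (hm hx)]

end SmoothInto

section ChangeOfScalars

variable {𝕜 𝕝 : Type*} [CommSemiring 𝕜] [Semiring 𝕝] [Algebra 𝕜 𝕝] {E : Type u} {F : Type v}
  {Y : Type w} {Z : Type x} [TopologicalSpace Y] [TopologicalSpace Z] {H : Type y}
  [AddCommGroup E] [Module ℝ E] [Module 𝕜 E] [TopologicalSpace E]
  [IsTopologicalAddGroup E] [ContinuousSMul ℝ E]
  [AddCommGroup F] [Module ℝ F] [Module 𝕜 F] [Module 𝕝 F] [IsScalarTower 𝕜 𝕝 F]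
  [TopologicalSpace F] [IsTopologicalAddGroup F] [ContinuousSMul ℝ F]
  [AddCommGroup H] [Module ℝ H] [Module 𝕜 H] [Module 𝕝 H] [IsScalarTower 𝕜 𝕝 H]
  [TopologicalSpace H] [IsTopologicalAddGroup H] [ContinuousSMul ℝ H] [LocallyConvexSpace ℝ H]
  {B : Set (PartialEquiv Y F)} [IsOpenAtlas B] {C : Set (PartialEquiv Z H)} {g : E → Y} {U : Set E}

theorem SmoothInto.isSmoothOn_chart_comp [T2Space H] (hg : SmoothInto 𝕜 B g U) (hU : Accessible U)
    {ψ : PartialEquiv Y H} (hψ : IsOpen ψ.source)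
    (hc : ∀ e ∈ B, IsSmoothOn 𝕝 (fun x => ψ (e.symm x))
      {x | x ∈ e.target ∧ e.symm x ∈ ψ.source}) :
    IsSmoothOn 𝕜 (fun x => ψ (g x)) {x | x ∈ U ∧ g x ∈ ψ.source} := by
  obtain ⟨O, hO, hOeq⟩ := exists_isOpen_inter_eq hg.continuousOn hψ
  rw [hOeq]
  refine IsSmoothOn.of_local (hU.inter_isOpen hO) fun x hx => ?_
  obtain ⟨O', hO', hxO', e, he, hgm, hs⟩ := hg.inter_isOpen hO x hx
  exact ⟨O', hO', hxO', (hc e he).restrictScalars.comp_of_chart hψ he hs hgm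
    fun y hy => (hOeq.superset hy.1).2⟩

theorem SmoothInto.comp_isSmoothMap [IsOpenAtlas C] (hg : SmoothInto 𝕜 B g U) {f : Y → Z}
    (hf : IsSmoothMap 𝕝 inferInstance B inferInstance C f) :
    SmoothInto 𝕜 C (fun x => f (g x)) U := by
  intro x hx
  obtain ⟨O, hO, hxO, e, he, hgm, hs⟩ := hg x hx
  obtain ⟨ψ, hψ, hxψ⟩ := IsOpenAtlas.cover (B := C) (f (g x))
  have hsrc : IsOpen (f ⁻¹' ψ.source) := (IsOpenAtlas.isOpen_source ψ hψ).preimage hf.continuous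
  obtain ⟨O', hO', hOO'⟩ := exists_isOpen_inter_eq hg.continuousOn hsrc
  have hmem : MapsTo g (U ∩ (O ∩ O')) (f ⁻¹' ψ.source) := fun y hy =>
    (hOO'.superset ⟨hy.1, hy.2.2⟩).2
  have hs' := hs.inter_isOpen hO'
  rw [inter_assoc] at hs'
  exact ⟨O ∩ O', hO.inter hO', ⟨hxO, (hOO'.subset ⟨hx, hxψ⟩).2⟩, ψ, hψ, hmem,
    (hf.smooth e he ψ hψ).restrictScalars.comp_of_chart (k := fun y => ψ (f y)) hsrc he hs'
      (fun y hy => hgm ⟨hy.1, hy.2.1⟩) hmem⟩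

end ChangeOfScalars

section MapsOfManifolds

variable {𝕜 𝕝 : Type*} [CommSemiring 𝕜] [Semiring 𝕝] [Algebra 𝕜 𝕝]
  {M : Type w} [TopologicalSpace M]
  {E : Type u} [AddCommGroup E] [Module ℝ E] [Module 𝕜 E] [TopologicalSpace E]
  {A : Set (PartialEquiv M E)} [IsAtlas A] {Y : Type x} [TopologicalSpace Y]

theorem continuous_of_charts (A : Set (PartialEquiv M E)) [IsAtlas A] {f : M → Y}
    (h : ∀ φ ∈ A, ContinuousOn (fun x => f (φ.symm x)) φ.target) : Continuous f := by
  refine continuous_iff_continuousAt.2 fun m => ?_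
  obtain ⟨φ, hφ, hm⟩ := IsAtlas.cover (A := A) m
  have hs := (IsAtlas.isOpen_source φ hφ).mem_nhds hm
  have hc := ((h φ hφ).comp (IsAtlas.continuousOn φ hφ) φ.mapsTo).continuousAt hs
  exact hc.congr (mem_of_superset hs fun x hx => by simp [φ.left_inv hx])

variable [IsTopologicalAddGroup E] [ContinuousSMul ℝ E] {F : Type v}
  [AddCommGroup F] [Module ℝ F] [Module 𝕜 F] [Module 𝕝 F] [IsScalarTower 𝕜 𝕝 F]
  [TopologicalSpace F] [IsTopologicalAddGroup F] [ContinuousSMul ℝ F] [LocallyConvexSpace ℝ F]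
  [T2Space F] {B : Set (PartialEquiv Y F)} [IsOpenAtlas B]

theorem isSmoothMap_iff_smoothInto (hB : ∀ e ∈ B, ∀ ψ ∈ B, SmoothChange 𝕝 e ψ) {f : M → Y} :
    IsSmoothMap 𝕜 inferInstance A inferInstance B f ↔
      ∀ φ ∈ A, SmoothInto 𝕜 B (fun x => f (φ.symm x)) φ.target := by
  constructor
  · intro hf φ hφ x hx
    obtain ⟨ψ, hψ, hxψ⟩ := IsOpenAtlas.cover (B := B) (f (φ.symm x))
    have hc : ContinuousOn (fun x => f (φ.symm x)) φ.target :=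
      hf.continuous.comp_continuousOn (IsAtlas.continuousOn_symm φ hφ)
    obtain ⟨O, hO, hOeq⟩ := exists_isOpen_inter_eq hc (IsOpenAtlas.isOpen_source ψ hψ)
    exact ⟨O, hO, (hOeq.subset ⟨hx, hxψ⟩).2, ψ, hψ, fun y hy => (hOeq.superset hy).2,
      hOeq ▸ hf.smooth φ hφ ψ hψ⟩
  · intro h
    refine ⟨continuous_of_charts A fun φ hφ => (h φ hφ).continuousOn, fun φ hφ ψ hψ => ?_⟩
    exact (h φ hφ).isSmoothOn_chart_comp (IsAtlas.accessible φ hφ)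
      (IsOpenAtlas.isOpen_source ψ hψ) fun e he => hB e he ψ hψ

end MapsOfManifolds

section LieGroup

variable {𝕜 𝕝 : Type*} [CommSemiring 𝕜] [Semiring 𝕝] [Algebra 𝕜 𝕝]
  {E : Type u} [AddCommGroup E] [Module ℝ E] [Module 𝕜 E] [TopologicalSpace E]
  [IsTopologicalAddGroup E] [ContinuousSMul ℝ E]
  {K : Type x} [Group K] {F : Type v}
  [AddCommGroup F] [Module ℝ F] [Module 𝕜 F] [Module 𝕝 F] [IsScalarTower 𝕜 𝕝 F]
  [TopologicalSpace F] [IsTopologicalAddGroup F] [ContinuousSMul ℝ F] [LocallyConvexSpace ℝ F]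
  (S : LieGroupStructure 𝕝 K F) {g h : E → K} {U : Set E}

namespace LieGroupStructure

theorem smoothInto_mul (hg : SmoothInto 𝕜 S.atlas g U) (hh : SmoothInto 𝕜 S.atlas h U) :
    SmoothInto 𝕜 S.atlas (fun x => g x * h x) U :=
  letI := S.top
  have := S.isOpenAtlas
  (hg.prodMk hh).comp_isSmoothMap S.smooth_mul

theorem smoothInto_inv (hg : SmoothInto 𝕜 S.atlas g U) :
    SmoothInto 𝕜 S.atlas (fun x => (g x)⁻¹) U :=
  letI := S.top
  have := S.isOpenAtlas
  hg.comp_isSmoothMap S.smooth_inv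

variable [T2Space F] {M : Type w} [tM : TopologicalSpace M] (A : Set (PartialEquiv M E))
  [IsAtlas A]

theorem isSmoothMap_iff {f : M → K} :
    IsSmoothMap 𝕜 tM A S.top S.atlas f ↔
      ∀ φ ∈ A, SmoothInto 𝕜 S.atlas (fun x => f (φ.symm x)) φ.target :=
  letI := S.top
  have := S.isOpenAtlas
  isSmoothMap_iff_smoothInto S.compatible

variable (𝕜) in
/-- The group of smooth maps from `M` to the Lie group `K`. -/
def mapSubgroup : Subgroup (M → K) where
  carrier := {f | IsSmoothMap 𝕜 tM A S.top S.atlas f}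
  mul_mem' hf hg := (S.isSmoothMap_iff A).2 fun φ hφ =>
    S.smoothInto_mul ((S.isSmoothMap_iff A).1 hf φ hφ) ((S.isSmoothMap_iff A).1 hg φ hφ)
  one_mem' := (S.isSmoothMap_iff A).2 fun φ _ =>
    letI := S.top
    have := S.isOpenAtlas
    SmoothInto.const 1 φ.target
  inv_mem' hf := (S.isSmoothMap_iff A).2 fun φ hφ =>
    S.smoothInto_inv ((S.isSmoothMap_iff A).1 hf φ hφ)

theorem mem_mapSubgroup {f : M → K} :
    f ∈ S.mapSubgroup 𝕜 A ↔ IsSmoothMap 𝕜 tM A S.top S.atlas f := Iff.rfl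

end LieGroupStructure

end LieGroup

section SmoothFamilyInto

/-- The analogue of `SmoothFamily` for a family of maps `g m : F → Y` into a manifold with the
charts in `B`. -/
structure SmoothFamilyInto (𝕜 𝕝 : Type*) [Semiring 𝕜] [Semiring 𝕝] {M : Type w}
    [TopologicalSpace M]
    {E : Type u} [AddCommGroup E] [Module ℝ E] [Module 𝕜 E] [TopologicalSpace E]
    (A : Set (PartialEquiv M E)) {F : Type v} {H : Type y} {Y : Type x}
    [AddCommGroup F] [Module ℝ F] [Module 𝕜 F] [Module 𝕝 F] [TopologicalSpace F]
    [AddCommGroup H] [Module ℝ H] [Module 𝕜 H] [Module 𝕝 H] [TopologicalSpace H]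
    (B : Set (PartialEquiv Y H)) (g : M → F → Y) (D : Set (M × F)) : Prop where
  isOpen : IsOpen D
  joint : ∀ φ ∈ A, SmoothInto 𝕜 B (fun p : E × F => g (φ.symm p.1) p.2) (chartDomain φ D)
  slice : ∀ m, SmoothInto 𝕝 B (g m) {y | (m, y) ∈ D}

variable {𝕜 𝕝 : Type*} [CommSemiring 𝕜] [CommSemiring 𝕝] {M : Type w} [TopologicalSpace M]
  {E : Type u} [AddCommGroup E] [Module ℝ E] [Module 𝕜 E] [TopologicalSpace E]
  {A : Set (PartialEquiv M E)}
  {F : Type v} [AddCommGroup F] [Module ℝ F] [Module 𝕜 F] [Module 𝕝 F] [TopologicalSpace F]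
  {H : Type y} [AddCommGroup H] [Module ℝ H] [Module 𝕜 H] [Module 𝕝 H] [TopologicalSpace H]
  {Y : Type x} {B : Set (PartialEquiv Y H)}

namespace SmoothFamilyInto

theorem chart_symm [TopologicalSpace Y] [IsOpenAtlas B] [IsTopologicalAddGroup H]
    [ContinuousSMul ℝ H] {φ : PartialEquiv Y H} (hφ : φ ∈ B) (L : F →L[ℝ] H)
    (hL : IsLinearMap 𝕜 L) (hL' : IsLinearMap 𝕝 L) :
    SmoothFamilyInto 𝕜 𝕝 A B (fun (_ : M) y => φ.symm (L y)) {p | L p.2 ∈ φ.target} := by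
  have htarget := IsOpenAtlas.isOpen_target φ hφ
  refine ⟨htarget.preimage (L.continuous.comp continuous_snd), fun χ _ => ?_, fun m => ?_⟩
  · exact (smoothInto_symm hφ).comp_continuousLinearMap_of_isOpen htarget
      (L.comp (ContinuousLinearMap.snd ℝ E F))
      (isLinearMap_comp hL (LinearMap.snd 𝕜 E F).isLinear :) fun p hp => hp.2
  · exact (smoothInto_symm hφ).comp_continuousLinearMap_of_isOpen htarget L hL' fun p hp => hp

section

variable {g : M → F → Y} {D D' : Set (M × F)}

theorem inter [IsAtlas A] (hg : SmoothFamilyInto 𝕜 𝕝 A B g D) (hD' : IsOpen D') :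
    SmoothFamilyInto 𝕜 𝕝 A B g (D ∩ D') := by
  refine ⟨hg.isOpen.inter hD', fun φ hφ => ?_, fun m => ?_⟩
  · obtain ⟨O, hO, hOeq⟩ := exists_chartDomain_eq (IsAtlas.continuousOn_symm φ hφ) hD'
    have hinter : chartDomain φ (D ∩ D') = chartDomain φ D ∩ O := by
      ext p
      exact ⟨fun hp => ⟨⟨hp.1, hp.2.1⟩, (hOeq.subset ⟨hp.1, hp.2.2⟩).2⟩,
        fun hp => ⟨hp.1.1, hp.1.2, (hOeq.superset ⟨⟨hp.1.1, trivial⟩, hp.2⟩).2⟩⟩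
    rw [hinter]
    exact (hg.joint φ hφ).inter_isOpen hO
  · exact (hg.slice m).inter_isOpen (hD'.preimage (Continuous.prodMk_right m))

variable [IsAtlas A] [TopologicalSpace Y] [IsOpenAtlas B]

protected theorem continuousOn (hg : SmoothFamilyInto 𝕜 𝕝 A B g D) :
    ContinuousOn (fun p : M × F => g p.1 p.2) D := by
  rintro ⟨m, y⟩ hmy
  obtain ⟨φ, hφ, hm⟩ := IsAtlas.cover (A := A) m
  have hchart : ContinuousOn (fun p : M × F => (φ p.1, p.2)) (D ∩ φ.source ×ˢ univ) :=
    ((IsAtlas.continuousOn φ hφ).comp continuousOn_fst fun p hp => hp.2.1).prodMk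
      continuousOn_snd
  have hnhds : D ∩ φ.source ×ˢ univ ∈ 𝓝 (m, y) :=
    (hg.isOpen.inter ((IsAtlas.isOpen_source φ hφ).prod isOpen_univ)).mem_nhds ⟨hmy, hm, trivial⟩
  have hcont := ((hg.joint φ hφ).continuousOn.comp hchart fun p hp =>
    ⟨φ.map_source hp.2.1, by simpa [φ.left_inv hp.2.1] using hp.1⟩).continuousAt hnhds
  refine (hcont.congr ?_).continuousWithinAt
  filter_upwards [hnhds] with p hp
  simp [φ.left_inv hp.2.1]

variable [Algebra 𝕜 𝕝] [IsTopologicalAddGroup E] [ContinuousSMul ℝ E]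
  [IsTopologicalAddGroup F] [ContinuousSMul ℝ F] [IsScalarTower 𝕜 𝕝 H]
  [IsTopologicalAddGroup H] [ContinuousSMul ℝ H]

theorem smoothFamily [LocallyConvexSpace ℝ H] [T2Space H] (hg : SmoothFamilyInto 𝕜 𝕝 A B g D)
    {ψ : PartialEquiv Y H} (hψ : IsOpen ψ.source)
    (hc : ∀ e ∈ B, IsSmoothOn 𝕝 (fun x => ψ (e.symm x)) {x | x ∈ e.target ∧ e.symm x ∈ ψ.source}) :
    SmoothFamily 𝕜 𝕝 A (fun m y => ψ (g m y)) {p | p ∈ D ∧ g p.1 p.2 ∈ ψ.source} where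
  isOpen := hg.continuousOn.isOpen_inter_preimage hg.isOpen hψ
  joint φ hφ := by
    have hdomain : chartDomain φ {p | p ∈ D ∧ g p.1 p.2 ∈ ψ.source} =
        {p | p ∈ chartDomain φ D ∧ g (φ.symm p.1) p.2 ∈ ψ.source} := ext fun _ => and_assoc.symm
    rw [hdomain]
    exact (hg.joint φ hφ).isSmoothOn_chart_comp (accessible_chartDomain hφ hg.isOpen) hψ hc
  slice m := (hg.slice m).isSmoothOn_chart_comp
    (accessible_of_isOpen (hg.isOpen.preimage (Continuous.prodMk_right m))) hψ hc

end

variable [Algebra 𝕜 𝕝] [IsScalarTower 𝕜 𝕝 H] [IsTopologicalAddGroup E] [ContinuousSMul ℝ E]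
  [IsTopologicalAddGroup H] [ContinuousSMul ℝ H] [LocallyConvexSpace ℝ H]
  {K : Type x} [Group K] (S : LieGroupStructure 𝕝 K H) {g h : M → F → K} {D : Set (M × F)}

theorem const [IsAtlas A] [T2Space H] {a : M → K} (ha : a ∈ S.mapSubgroup 𝕜 A) (hD : IsOpen D) :
    SmoothFamilyInto 𝕜 𝕝 A S.atlas (fun m (_ : F) => a m) D := by
  let := S.top
  have := S.isOpenAtlas
  refine ⟨hD, fun φ hφ => ?_, fun m => SmoothInto.const (a m) _⟩
  exact ((S.isSmoothMap_iff A).1 ha φ hφ).comp_continuousLinearMap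
    (ContinuousLinearMap.fst ℝ E F) (LinearMap.fst 𝕜 E F).isLinear (fun p hp => hp.1)
    fun p hp => ((mem_interior_chartDomain (IsAtlas.continuousOn_symm φ hφ) hD).1 hp).1

variable [IsTopologicalAddGroup F] [ContinuousSMul ℝ F]

theorem mul (hg : SmoothFamilyInto 𝕜 𝕝 A S.atlas g D) (hh : SmoothFamilyInto 𝕜 𝕝 A S.atlas h D) :
    SmoothFamilyInto 𝕜 𝕝 A S.atlas (fun m y => g m y * h m y) D :=
  ⟨hg.isOpen, fun φ hφ => S.smoothInto_mul (hg.joint φ hφ) (hh.joint φ hφ),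
    fun m => S.smoothInto_mul (hg.slice m) (hh.slice m)⟩

theorem inv (hg : SmoothFamilyInto 𝕜 𝕝 A S.atlas g D) :
    SmoothFamilyInto 𝕜 𝕝 A S.atlas (fun m y => (g m y)⁻¹) D :=
  ⟨hg.isOpen, fun φ hφ => S.smoothInto_inv (hg.joint φ hφ),
    fun m => S.smoothInto_inv (hg.slice m)⟩

end SmoothFamilyInto

end SmoothFamilyInto

section OfAtlas

variable {𝕝 : Type*} [CommSemiring 𝕝] {Y : Type w} [tY : TopologicalSpace Y] {F : Type v}
  [AddCommGroup F] [Module ℝ F] [Module 𝕝 F] [TopologicalSpace F]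
  {B : Set (PartialEquiv Y F)} [IsOpenAtlas B]

theorem smoothInto_symm_of_smoothChange {ρ : PartialEquiv Y F} (hρ : IsChart tY univ ρ)
    (h : ∀ e ∈ B, SmoothChange 𝕝 ρ e) : SmoothInto 𝕝 B ρ.symm ρ.target := by
  intro x hx
  obtain ⟨e, he, hxe⟩ := IsOpenAtlas.cover (B := B) (ρ.symm x)
  have hO : IsOpen (ρ.target ∩ ρ.symm ⁻¹' e.source) :=
    hρ.continuousOn_symm.isOpen_inter_preimage hρ.isOpen_target (IsOpenAtlas.isOpen_source e he)
  refine ⟨_, hO, ⟨hx, hxe⟩, e, he, fun y hy => hy.2.2, ?_⟩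
  rw [← inter_assoc, inter_self]
  exact h e he

variable [IsTopologicalAddGroup F] [ContinuousSMul ℝ F]

theorem IsSmoothMap.of_smoothInto_symm {Z : Type x} [tZ : TopologicalSpace Z] {H : Type y}
    [AddCommGroup H] [Module ℝ H] [Module 𝕝 H] [TopologicalSpace H] [IsTopologicalAddGroup H]
    [ContinuousSMul ℝ H] [LocallyConvexSpace ℝ H] [T2Space H]
    {C : Set (PartialEquiv Z H)} [IsOpenAtlas C] {f : Y → Z} (hf : IsSmoothMap 𝕝 tY B tZ C f)
    {B' : Set (PartialEquiv Y F)} {C' : Set (PartialEquiv Z H)}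
    (hB' : ∀ ρ ∈ B', IsOpen ρ.target ∧ SmoothInto 𝕝 B ρ.symm ρ.target)
    (hC' : ∀ σ ∈ C', IsOpen σ.source ∧ ∀ e ∈ C, SmoothChange 𝕝 e σ) :
    IsSmoothMap 𝕝 tY B' tZ C' f :=
  ⟨hf.continuous, fun ρ hρ σ hσ => ((hB' ρ hρ).2.comp_isSmoothMap hf).isSmoothOn_chart_comp
    (accessible_of_isOpen (hB' ρ hρ).1) (hC' σ hσ).1 (hC' σ hσ).2⟩

variable [LocallyConvexSpace ℝ F] [T2Space F]

theorem SmoothChange.of_atlas {ρ σ : PartialEquiv Y F} (hρ : IsChart tY univ ρ)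
    (hσ : IsChart tY univ σ) (hρB : ∀ e ∈ B, SmoothChange 𝕝 ρ e)
    (hσB : ∀ e ∈ B, SmoothChange 𝕝 e σ) : SmoothChange 𝕝 ρ σ :=
  (smoothInto_symm_of_smoothChange hρ hρB).isSmoothOn_chart_comp
    (accessible_of_isOpen hρ.isOpen_target) hσ.isOpen_source hσB

/-- The manifold structure whose maximal atlas is generated by the smooth atlas `B`. -/
def ManifoldStructure.ofAtlas [T2Space Y] (B : Set (PartialEquiv Y F)) [IsOpenAtlas B]
    (hB : ∀ e ∈ B, ∀ e' ∈ B, SmoothChange 𝕝 e e') : ManifoldStructure 𝕝 Y F univ where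
  top := tY
  t2 := inferInstance
  atlas := {ρ | IsChart tY univ ρ ∧ ∀ e ∈ B, SmoothChange 𝕝 e ρ ∧ SmoothChange 𝕝 ρ e}
  isChart ρ hρ := hρ.1
  cover m := by
    obtain ⟨e, he, hm⟩ := IsOpenAtlas.cover (B := B) m
    exact ⟨e, ⟨IsOpenAtlas.isChart he, fun e' he' => ⟨hB e' he' e he, hB e he e' he'⟩⟩, hm⟩
  compatible ρ hρ σ hσ :=
    SmoothChange.of_atlas hρ.1 hσ.1 (fun e he => (hρ.2 e he).2) fun e he => (hσ.2 e he).1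
  maximal ρ hρ h := ⟨hρ, fun e he =>
    h e ⟨IsOpenAtlas.isChart he, fun e' he' => ⟨hB e' he' e he, hB e he e' he'⟩⟩⟩

theorem ManifoldStructure.subset_ofAtlas [T2Space Y]
    (hB : ∀ e ∈ B, ∀ e' ∈ B, SmoothChange 𝕝 e e') :
    B ⊆ (ManifoldStructure.ofAtlas B hB).atlas := fun e he =>
  ⟨IsOpenAtlas.isChart he, fun e' he' => ⟨hB e' he' e he, hB e he e' he'⟩⟩

end OfAtlas

section Uniqueness

theorem le_of_common_charts {Y : Type w} {F : Type v} [TopologicalSpace F]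
    {t₁ t₂ : TopologicalSpace Y} {B : Set (PartialEquiv Y F)}
    (h₁ : ∀ e ∈ B, IsChart t₁ univ e) (h₂ : ∀ e ∈ B, IsChart t₂ univ e)
    (hcover : ∀ y : Y, ∃ e ∈ B, y ∈ e.source) : t₂ ≤ t₁ := by
  intro s hs
  refine (@isOpen_iff_mem_nhds Y t₂ s).2 fun y hy => ?_
  obtain ⟨e, he, hye⟩ := hcover y
  have htarget : IsOpen (e.target ∩ e.symm ⁻¹' s) :=
    @ContinuousOn.isOpen_inter_preimage F Y _ t₁ _ _ _ (h₁ e he).continuousOn_symm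
      (h₁ e he).isOpen_target hs
  let := t₂
  have hsource : IsOpen (e.source ∩ e ⁻¹' (e.target ∩ e.symm ⁻¹' s)) :=
    (h₂ e he).continuousOn.isOpen_inter_preimage (h₂ e he).isOpen_source htarget
  refine mem_of_superset (hsource.mem_nhds
    ⟨hye, e.map_source hye, by simpa [e.left_inv hye] using hy⟩) ?_
  rintro z ⟨hz, -, hzs⟩
  simpa [e.left_inv hz] using hzs

variable {𝕝 : Type*} [CommSemiring 𝕝] {Y : Type w} {F : Type v}
  [AddCommGroup F] [Module ℝ F] [Module 𝕝 F]
  [TopologicalSpace F] [IsTopologicalAddGroup F] [ContinuousSMul ℝ F] [LocallyConvexSpace ℝ F]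
  [T2Space F]

namespace ManifoldStructure

variable {S₁ S₂ : ManifoldStructure 𝕝 Y F univ} {B : Set (PartialEquiv Y F)}

theorem atlas_subset_atlas (htop : S₁.top = S₂.top) (h₁ : B ⊆ S₁.atlas) (h₂ : B ⊆ S₂.atlas)
    (hcover : ∀ y : Y, ∃ e ∈ B, y ∈ e.source) : S₁.atlas ⊆ S₂.atlas := by
  let := S₁.top
  have := S₁.isOpenAtlas_of_subset h₁ hcover
  intro ρ hρ
  have hρc := S₁.isChart ρ hρ
  refine S₂.maximal ρ (htop ▸ hρc) fun σ hσ => ?_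
  have hσc : IsChart S₁.top univ σ := htop ▸ S₂.isChart σ hσ
  exact ⟨SmoothChange.of_atlas hσc hρc (fun e he => S₂.compatible σ hσ e (h₂ he))
      fun e he => S₁.compatible e (h₁ he) ρ hρ,
    SmoothChange.of_atlas hρc hσc (fun e he => S₁.compatible ρ hρ e (h₁ he))
      fun e he => S₂.compatible e (h₂ he) σ hσ⟩

theorem eq_of_subset (h₁ : B ⊆ S₁.atlas) (h₂ : B ⊆ S₂.atlas)
    (hcover : ∀ y : Y, ∃ e ∈ B, y ∈ e.source) : S₁ = S₂ := by
  have hS₁ : ∀ e ∈ B, IsChart S₁.top univ e := fun e he => S₁.isChart e (h₁ he)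
  have hS₂ : ∀ e ∈ B, IsChart S₂.top univ e := fun e he => S₂.isChart e (h₂ he)
  have htop : S₁.top = S₂.top :=
    le_antisymm (le_of_common_charts hS₂ hS₁ hcover) (le_of_common_charts hS₁ hS₂ hcover)
  have hatlas : S₁.atlas = S₂.atlas :=
    (atlas_subset_atlas htop h₁ h₂ hcover).antisymm (atlas_subset_atlas htop.symm h₂ h₁ hcover)
  cases S₁
  cases S₂
  simp only at htop hatlas
  subst htop hatlas
  rfl

end ManifoldStructure

theorem LieGroupStructure.eq_of_subset {G : Type w} [Group G] {S₁ S₂ : LieGroupStructure 𝕝 G F}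
    {B : Set (PartialEquiv G F)} (h₁ : B ⊆ S₁.atlas) (h₂ : B ⊆ S₂.atlas)
    (hcover : ∀ g : G, ∃ e ∈ B, g ∈ e.source) : S₁ = S₂ := by
  have h := ManifoldStructure.eq_of_subset h₁ h₂ hcover
  cases S₁
  cases S₂
  simp only at h
  subst h
  rfl

end Uniqueness

/-! ### Lie groups of smooth maps -/

section EqOnSource

variable {X : Type w} {E : Type u} [TopologicalSpace E] {φ φ' ψ ψ' : PartialEquiv X E} {Q : Set E}

theorem IsChart.of_eqOnSource {tX : TopologicalSpace X} (hφ : IsChart tX Q φ) (h : φ ≈ φ') :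
    IsChart tX Q φ' where
  isOpen_source := h.source_eq ▸ hφ.isOpen_source
  target_eq := h.target_eq ▸ hφ.target_eq
  continuousOn := h.source_eq ▸ hφ.continuousOn.congr h.eqOn.symm
  continuousOn_symm := h.target_eq ▸ hφ.continuousOn_symm.congr h.symm_eqOn.symm

variable {𝕝 : Type*} [Semiring 𝕝] [AddCommGroup E] [Module ℝ E] [Module 𝕝 E]
  [IsTopologicalAddGroup E] [ContinuousSMul ℝ E]

theorem SmoothChange.of_eqOnSource (h : SmoothChange 𝕝 φ ψ) (hφ : φ ≈ φ') (hψ : ψ ≈ ψ') :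
    SmoothChange 𝕝 φ' ψ' := by
  have hdomain : {x | x ∈ φ'.target ∧ φ'.symm x ∈ ψ'.source} =
      {x | x ∈ φ.target ∧ φ.symm x ∈ ψ.source} := by
    rw [← hφ.target_eq, ← hψ.source_eq]
    exact ext fun x => and_congr_right fun hx => by rw [hφ.symm_eqOn hx]
  rw [SmoothChange, hdomain]
  exact IsSmoothOn.congr h fun x hx => by rw [← hφ.symm_eqOn hx.1, hψ.eqOn hx.2]

theorem ManifoldStructure.mem_atlas_of_eqOnSource (S : ManifoldStructure 𝕝 X E Q)
    (hφ : φ ∈ S.atlas) (h : φ ≈ φ') : φ' ∈ S.atlas :=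
  S.maximal φ' ((S.isChart φ hφ).of_eqOnSource h) fun ψ hψ =>
    ⟨(S.compatible ψ hψ φ hφ).of_eqOnSource (Setoid.refl ψ) h,
      (S.compatible φ hφ ψ hψ).of_eqOnSource h (Setoid.refl ψ)⟩

end EqOnSource

section LieGroupAtlas

variable {𝕝 : Type*} [CommSemiring 𝕝] {G : Type w} [Group G] {F : Type v}
  [AddCommGroup F] [Module ℝ F] [Module 𝕝 F]
  [TopologicalSpace F] [IsTopologicalAddGroup F] [ContinuousSMul ℝ F] [LocallyConvexSpace ℝ F]
  [T2Space F]

namespace LieGroupStructure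

/-- The Lie group structure generated by a smooth atlas for which the group operations are
smooth. -/
def ofAtlas [tG : TopologicalSpace G] [T2Space G] (B : Set (PartialEquiv G F))
    [IsOpenAtlas B] (hB : ∀ e ∈ B, ∀ e' ∈ B, SmoothChange 𝕝 e e')
    (hmul : IsSmoothMap 𝕝 instTopologicalSpaceProd (Set.image2 (fun φ ψ => φ.prod ψ) B B) tG B
      (fun p : G × G => p.1 * p.2))
    (hinv : IsSmoothMap 𝕝 tG B tG B (fun g : G => g⁻¹)) : LieGroupStructure 𝕝 G F where
  toManifoldStructure := ManifoldStructure.ofAtlas B hB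
  smooth_mul := by
    refine hmul.of_smoothInto_symm ?_ fun σ hσ =>
      ⟨hσ.1.isOpen_source, fun e he => (hσ.2 e he).1⟩
    rintro _ ⟨ρ, hρ, σ, hσ, rfl⟩
    have hρB := smoothInto_symm_of_smoothChange hρ.1 fun e he => (hρ.2 e he).2
    have hσB := smoothInto_symm_of_smoothChange hσ.1 fun e he => (hσ.2 e he).2
    exact ⟨hρ.1.isOpen_target.prod hσ.1.isOpen_target, SmoothInto.prodMk
      (hρB.comp_continuousLinearMap_of_isOpen hρ.1.isOpen_target (ContinuousLinearMap.fst ℝ F F)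
        (LinearMap.fst 𝕝 F F).isLinear fun p hp => hp.1)
      (hσB.comp_continuousLinearMap_of_isOpen hσ.1.isOpen_target (ContinuousLinearMap.snd ℝ F F)
        (LinearMap.snd 𝕝 F F).isLinear fun p hp => hp.2)⟩
  smooth_inv := hinv.of_smoothInto_symm
    (fun ρ hρ => ⟨hρ.1.isOpen_target,
      smoothInto_symm_of_smoothChange hρ.1 fun e he => (hρ.2 e he).2⟩)
    fun σ hσ => ⟨hσ.1.isOpen_source, fun e he => (hσ.2 e he).1⟩

variable (S : LieGroupStructure 𝕝 G F)

theorem isSmoothMap_mul_left (a : G) :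
    IsSmoothMap 𝕝 S.top S.atlas S.top S.atlas fun g => a * g := by
  let := S.top
  have := S.isOpenAtlas
  exact (S.isSmoothMap_iff S.atlas).2 fun e he =>
    S.smoothInto_mul (SmoothInto.const a _) (smoothInto_symm he)

theorem mulLeft_symm_transPartialEquiv_mem_atlas {φ : PartialEquiv G F} (hφ : φ ∈ S.atlas)
    (a : G) : (Equiv.mulLeft a).symm.transPartialEquiv φ ∈ S.atlas := by
  let := S.top
  have hc := S.isChart φ hφ
  have hleft := S.isSmoothMap_mul_left
  refine S.maximal _ ⟨hc.isOpen_source.preimage (hleft a⁻¹).continuous, hc.target_eq,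
    hc.continuousOn.comp (hleft a⁻¹).continuous.continuousOn fun g hg => hg,
    (hleft a).continuous.comp_continuousOn hc.continuousOn_symm⟩ fun ψ hψ =>
    ⟨(hleft a⁻¹).smooth ψ hψ φ hφ, (hleft a).smooth φ hφ ψ hψ⟩

end LieGroupStructure

end LieGroupAtlas

section PushChart

variable {𝕜 𝕝 : Type*} [CommSemiring 𝕜] [CommSemiring 𝕝] [Algebra 𝕜 𝕝]
  {M : Type w} [tM : TopologicalSpace M]
  {E : Type u} [AddCommGroup E] [Module ℝ E] [Module 𝕜 E] [TopologicalSpace E]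
  [IsTopologicalAddGroup E] [ContinuousSMul ℝ E]
  {A : Set (PartialEquiv M E)} [IsAtlas A]
  {H : Type v} [AddCommGroup H] [Module ℝ H] [Module 𝕜 H] [Module 𝕝 H] [IsScalarTower 𝕜 𝕝 H]
  [TopologicalSpace H] [IsTopologicalAddGroup H] [ContinuousSMul ℝ H] [LocallyConvexSpace ℝ H]
  [T2Space H] {K : Type x} [Group K] (S : LieGroupStructure 𝕝 K H)
  {φ : PartialEquiv K H} (hφ : φ ∈ S.atlas)

namespace LieGroupStructure

include hφ

theorem isSmoothOn_chart_comp {γ : M → K} (hγ : γ ∈ S.mapSubgroup 𝕜 A)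
    (h : ∀ m, γ m ∈ φ.source) (χ : PartialEquiv M E) (hχ : χ ∈ A) :
    IsSmoothOn 𝕜 (fun x => φ (γ (χ.symm x))) χ.target := by
  simpa only [h, and_true, ofPred_mem_eq] using hγ.smooth χ hχ φ hφ

theorem symm_comp_mem_mapSubgroup {ξ : SmoothFun 𝕜 A H} (h : ∀ m, ξ.1 m ∈ φ.target) :
    (fun m => φ.symm (ξ.1 m)) ∈ S.mapSubgroup 𝕜 A := by
  let := S.top
  have := S.isOpenAtlas
  refine (S.isSmoothMap_iff A).2 fun χ hχ => ?_
  refine (smoothInto_symm hφ).comp_isSmoothOn (ξ.2 χ hχ) (fun x _ => h _) fun x _ => ?_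
  rw [(S.isChart φ hφ).isOpen_target.interior_eq]
  exact h _

open Classical in
variable (𝕜 A) in
/-- The map `γ ↦ φ ∘ γ`, extended by zero. -/
noncomputable def pushFun (γ : S.mapSubgroup 𝕜 A) : SmoothFun 𝕜 A H :=
  if h : ∀ m, γ.1 m ∈ φ.source then
    ⟨fun m => φ (γ.1 m), S.isSmoothOn_chart_comp hφ γ.2 h⟩ else 0

open Classical in
/-- The map `ξ ↦ φ⁻¹ ∘ ξ`, extended by the neutral element. -/
noncomputable def pullFun (ξ : SmoothFun 𝕜 A H) : S.mapSubgroup 𝕜 A :=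
  if h : ∀ m, ξ.1 m ∈ φ.target then
    ⟨fun m => φ.symm (ξ.1 m), S.symm_comp_mem_mapSubgroup hφ h⟩ else 1

theorem pushFun_apply {γ : S.mapSubgroup 𝕜 A} (h : ∀ m, γ.1 m ∈ φ.source) (m : M) :
    (S.pushFun 𝕜 A hφ γ).1 m = φ (γ.1 m) := by
  have hpush : S.pushFun 𝕜 A hφ γ = ⟨fun m => φ (γ.1 m), S.isSmoothOn_chart_comp hφ γ.2 h⟩ :=
    dif_pos h
  rw [hpush]

theorem pullFun_apply {ξ : SmoothFun 𝕜 A H} (h : ∀ m, ξ.1 m ∈ φ.target) (m : M) :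
    (S.pullFun hφ ξ).1 m = φ.symm (ξ.1 m) := by
  have hpull : S.pullFun hφ ξ = ⟨fun m => φ.symm (ξ.1 m), S.symm_comp_mem_mapSubgroup hφ h⟩ :=
    dif_pos h
  rw [hpull]

theorem pushFun_apply_mem {γ : S.mapSubgroup 𝕜 A} (h : ∀ m, γ.1 m ∈ φ.source) (m : M) :
    (S.pushFun 𝕜 A hφ γ).1 m ∈ φ.target := by
  rw [S.pushFun_apply hφ h]
  exact φ.map_source (h m)

theorem pullFun_apply_mem {ξ : SmoothFun 𝕜 A H} (h : ∀ m, ξ.1 m ∈ φ.target) (m : M) :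
    (S.pullFun hφ ξ).1 m ∈ φ.source := by
  rw [S.pullFun_apply hφ h]
  exact φ.map_target (h m)

variable (𝕜 A) in
/-- The push-forward `φ_* : γ ↦ φ ∘ γ` of a chart `φ` of `K`, a bijection between the smooth maps
into its domain and the smooth functions into its image. -/
noncomputable def pushChart : PartialEquiv (S.mapSubgroup 𝕜 A) (SmoothFun 𝕜 A H) where
  toFun := S.pushFun 𝕜 A hφ
  invFun := S.pullFun hφ
  source := {γ | ∀ m, γ.1 m ∈ φ.source}
  target := {ξ | ∀ m, ξ.1 m ∈ φ.target}
  map_source' _ hγ := S.pushFun_apply_mem hφ hγ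
  map_target' _ hξ := S.pullFun_apply_mem hφ hξ
  left_inv' γ hγ := Subtype.ext <| funext fun m => by
    rw [S.pullFun_apply hφ (S.pushFun_apply_mem hφ hγ), S.pushFun_apply hφ hγ, φ.left_inv (hγ m)]
  right_inv' ξ hξ := SmoothFun.ext fun m => by
    rw [S.pushFun_apply hφ (S.pullFun_apply_mem hφ hξ), S.pullFun_apply hφ hξ, φ.right_inv (hξ m)]

theorem isPushForward_pushChart : IsPushForward 𝕜 φ (S.pushChart 𝕜 A hφ) :=
  ⟨rfl, rfl, fun _ hγ m => S.pushFun_apply hφ hγ m⟩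

theorem eqOnSource_pushChart {Φ : PartialEquiv (S.mapSubgroup 𝕜 A) (SmoothFun 𝕜 A H)}
    (h : IsPushForward 𝕜 φ Φ) : Φ ≈ S.pushChart 𝕜 A hφ :=
  ⟨h.source_eq, fun γ hγ => SmoothFun.ext fun m =>
    (h.apply_eq γ hγ m).trans (S.pushFun_apply hφ (h.source_eq.subset hγ) m).symm⟩

variable (𝕜 A) in
/-- The chart `γ ↦ φ ∘ (a⁻¹ γ)` of the group of smooth maps, obtained from the push-forward
of `φ` by left translation with `a`. -/
noncomputable def leftChart (a : S.mapSubgroup 𝕜 A) :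
    PartialEquiv (S.mapSubgroup 𝕜 A) (SmoothFun 𝕜 A H) :=
  (Equiv.mulLeft a).symm.transPartialEquiv (S.pushChart 𝕜 A hφ)

theorem leftChart_one : S.leftChart 𝕜 A hφ 1 = S.pushChart 𝕜 A hφ := by
  rw [leftChart, Equiv.mulLeft_one]
  rfl

theorem mem_leftChart_source_self (h1 : (1 : K) ∈ φ.source) (a : S.mapSubgroup 𝕜 A) :
    a ∈ (S.leftChart 𝕜 A hφ a).source := fun m => by
  change (a.1 m)⁻¹ * a.1 m ∈ φ.source
  rwa [inv_mul_cancel]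

theorem leftChart_apply {a γ : S.mapSubgroup 𝕜 A}
    (h : γ ∈ (S.leftChart 𝕜 A hφ a).source) (m : M) :
    (S.leftChart 𝕜 A hφ a γ).1 m = φ ((a.1 m)⁻¹ * γ.1 m) :=
  S.pushFun_apply hφ h m

theorem leftChart_symm_apply {a : S.mapSubgroup 𝕜 A} {ξ : SmoothFun 𝕜 A H}
    (h : ∀ m, ξ.1 m ∈ φ.target) (m : M) :
    ((S.leftChart 𝕜 A hφ a).symm ξ).1 m = a.1 m * φ.symm (ξ.1 m) :=
  congrArg (a.1 m * ·) (S.pullFun_apply hφ h m)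

end LieGroupStructure

end PushChart

section MapGroup

variable {𝕜 𝕝 : Type*} [CommSemiring 𝕜] [CommSemiring 𝕝] [Algebra 𝕜 𝕝]
  {M : Type w} [tM : TopologicalSpace M]
  {E : Type u} [AddCommGroup E] [Module ℝ E] [Module 𝕜 E] [TopologicalSpace E]
  [IsTopologicalAddGroup E] [ContinuousSMul ℝ E] {A : Set (PartialEquiv M E)} [IsAtlas A]
  {H : Type v} [AddCommGroup H] [Module ℝ H] [Module 𝕜 H] [Module 𝕝 H] [IsScalarTower 𝕜 𝕝 H]
  [TopologicalSpace H] [IsTopologicalAddGroup H] [ContinuousSMul ℝ H] [LocallyConvexSpace ℝ H]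
  [T2Space H] {K : Type x} [Group K] (S : LieGroupStructure 𝕝 K H)
  {φ : PartialEquiv K H} (hφ : φ ∈ S.atlas)

namespace LieGroupStructure

section Family

variable {F : Type y} [AddCommGroup F] [Module ℝ F] [Module 𝕜 F] [TopologicalSpace F]

theorem forall_mem_and_mem_leftChart_source_iff
    {X : Type*} {j : X → SmoothFun 𝕜 A F} {g : M → F → K} {D : Set (M × F)}
    {T : X → S.mapSubgroup 𝕜 A}
    (hT : ∀ x, (∀ m, (m, (j x).1 m) ∈ D) → ∀ m, (T x).1 m = g m ((j x).1 m))
    {b : S.mapSubgroup 𝕜 A} {x : X} :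
    ((∀ m, (m, (j x).1 m) ∈ D) ∧ T x ∈ (S.leftChart 𝕜 A hφ b).source) ↔
      ∀ m, (m, (j x).1 m) ∈ {p | p ∈ D ∧ (b.1 p.1)⁻¹ * g p.1 p.2 ∈ φ.source} := by
  have hsource (hD : ∀ m, (m, (j x).1 m) ∈ D) : T x ∈ (S.leftChart 𝕜 A hφ b).source ↔
      ∀ m, (b.1 m)⁻¹ * g m ((j x).1 m) ∈ φ.source := by
    simp only [← hT x hD]
    rfl
  exact (and_congr_right hsource).trans forall_and.symm

variable [Module 𝕝 F] [IsTopologicalAddGroup F] [ContinuousSMul ℝ F] {g : M → F → K}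
  {D : Set (M × F)}

include hφ in
theorem smoothFamily_leftChart (hg : SmoothFamilyInto 𝕜 𝕝 A S.atlas g D)
    (b : S.mapSubgroup 𝕜 A) :
    SmoothFamily 𝕜 𝕝 A (fun m y => φ ((b.1 m)⁻¹ * g m y))
      {p | p ∈ D ∧ (b.1 p.1)⁻¹ * g p.1 p.2 ∈ φ.source} := by
  let := S.top
  have := S.isOpenAtlas
  exact ((SmoothFamilyInto.const S (inv_mem b.2) hg.isOpen).mul S hg).smoothFamily
    (S.isChart φ hφ).isOpen_source fun e he => S.compatible e he φ hφ

variable [CompactSpace M] [T2Space M] [T2Space E] [T2Space F]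

theorem isOpen_setOf_mem_leftChart_source {X : Type*} [TopologicalSpace X]
    {j : X → SmoothFun 𝕜 A F} (hj : Continuous j) {T : X → S.mapSubgroup 𝕜 A}
    (hg : SmoothFamilyInto 𝕜 𝕝 A S.atlas g D)
    (hT : ∀ x, (∀ m, (m, (j x).1 m) ∈ D) → ∀ m, (T x).1 m = g m ((j x).1 m))
    (b : S.mapSubgroup 𝕜 A) :
    IsOpen {x | (∀ m, (m, (j x).1 m) ∈ D) ∧ T x ∈ (S.leftChart 𝕜 A hφ b).source} := by
  simp only [S.forall_mem_and_mem_leftChart_source_iff hφ hT]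
  exact (SmoothFun.isOpen_setOf_forall_mem (S.smoothFamily_leftChart hφ hg b).isOpen).preimage hj

variable [SMulCommClass 𝕜 ℝ F] [SMulCommClass 𝕜 𝕝 F] [SMulCommClass ℝ 𝕝 F]
  [ContinuousConstSMul 𝕝 F]
  [SMulCommClass 𝕜 ℝ H] [ContinuousConstSMul 𝕜 H] [SMulCommClass ℝ 𝕜 H]
  [ContinuousConstSMul 𝕝 H] [SMulCommClass ℝ 𝕝 H] [SMulCommClass 𝕜 𝕝 H]
  {X : Type*} [AddCommGroup X] [Module ℝ X] [Module 𝕝 X] [TopologicalSpace X]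
  [IsTopologicalAddGroup X] [ContinuousSMul ℝ X] {j : X →L[ℝ] SmoothFun 𝕜 A F}
  {T : X → S.mapSubgroup 𝕜 A}

theorem isSmoothOn_leftChart (hj : IsLinearMap 𝕝 j) (hg : SmoothFamilyInto 𝕜 𝕝 A S.atlas g D)
    (hT : ∀ x, (∀ m, (m, (j x).1 m) ∈ D) → ∀ m, (T x).1 m = g m ((j x).1 m))
    (b : S.mapSubgroup 𝕜 A) :
    IsSmoothOn 𝕝 (fun x => S.leftChart 𝕜 A hφ b (T x))
      {x | (∀ m, (m, (j x).1 m) ∈ D) ∧ T x ∈ (S.leftChart 𝕜 A hφ b).source} := by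
  have hf := S.smoothFamily_leftChart hφ hg b
  simp only [S.forall_mem_and_mem_leftChart_source_iff hφ hT]
  refine (hf.isSmoothOn_push j hj).congr fun x hx => SmoothFun.ext fun m => ?_
  obtain ⟨hD, hsource⟩ := (S.forall_mem_and_mem_leftChart_source_iff hφ hT).2 hx
  rw [hf.push_val hx, S.leftChart_apply hφ hsource, hT x hD]

theorem smoothInto_leftChart (hj : IsLinearMap 𝕝 j) (hg : SmoothFamilyInto 𝕜 𝕝 A S.atlas g D)
    (hT : ∀ x, (∀ m, (m, (j x).1 m) ∈ D) → ∀ m, (T x).1 m = g m ((j x).1 m))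
    (h1 : (1 : K) ∈ φ.source) :
    SmoothInto 𝕝 (range (S.leftChart 𝕜 A hφ)) T {x | ∀ m, (m, (j x).1 m) ∈ D} := by
  intro x hx
  refine ⟨_, S.isOpen_setOf_mem_leftChart_source hφ j.continuous hg hT (T x),
    ⟨hx, S.mem_leftChart_source_self hφ h1 _⟩, _, mem_range_self (T x), fun y hy => hy.2.2, ?_⟩
  rw [inter_eq_self_of_subset_right fun y hy => hy.1]
  exact S.isSmoothOn_leftChart hφ hj hg hT (T x)

end Family

include hφ in
theorem smoothFamilyInto_leftChart_symm {F : Type y} [AddCommGroup F] [Module ℝ F] [Module 𝕜 F]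
    [Module 𝕝 F] [TopologicalSpace F] [IsTopologicalAddGroup F] [ContinuousSMul ℝ F]
    (L : F →L[ℝ] H) (hL : IsLinearMap 𝕜 L) (hL' : IsLinearMap 𝕝 L) (a : S.mapSubgroup 𝕜 A) :
    SmoothFamilyInto 𝕜 𝕝 A S.atlas (fun m y => a.1 m * φ.symm (L y)) {p | L p.2 ∈ φ.target} := by
  let := S.top
  have := S.isOpenAtlas
  have hsymm := SmoothFamilyInto.chart_symm (𝕜 := 𝕜) (𝕝 := 𝕝) (A := A) hφ L hL hL'
  exact (SmoothFamilyInto.const S a.2 hsymm.isOpen).mul S hsymm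

include hφ in
theorem smoothFamilyInto_leftChart_symm_id (a : S.mapSubgroup 𝕜 A) :
    SmoothFamilyInto 𝕜 𝕝 A S.atlas (fun m y => a.1 m * φ.symm y) {p | p.2 ∈ φ.target} :=
  S.smoothFamilyInto_leftChart_symm hφ (ContinuousLinearMap.id ℝ H)
    (LinearMap.id : H →ₗ[𝕜] H).isLinear (LinearMap.id : H →ₗ[𝕝] H).isLinear a

theorem isOpen_leftChart_target_inter [CompactSpace M] [T2Space M] [T2Space E]
    (a b : S.mapSubgroup 𝕜 A) :
    IsOpen {ξ | ξ ∈ (S.leftChart 𝕜 A hφ a).target ∧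
      (S.leftChart 𝕜 A hφ a).symm ξ ∈ (S.leftChart 𝕜 A hφ b).source} :=
  S.isOpen_setOf_mem_leftChart_source hφ (j := id) continuous_id
    (S.smoothFamilyInto_leftChart_symm_id hφ a) (fun _ h m => S.leftChart_symm_apply hφ h m) b

variable [T2Space E] [SMulCommClass 𝕜 ℝ H] [ContinuousConstSMul 𝕝 H] [SMulCommClass ℝ 𝕝 H]
  [SMulCommClass 𝕜 𝕝 H]

theorem range_leftChart_subset_of_isPushForward
    {S' : LieGroupStructure 𝕝 (S.mapSubgroup 𝕜 A) (SmoothFun 𝕜 A H)}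
    {Φ : PartialEquiv (S.mapSubgroup 𝕜 A) (SmoothFun 𝕜 A H)} (hΦ : Φ ∈ S'.atlas)
    (h : IsPushForward 𝕜 φ Φ) : range (S.leftChart 𝕜 A hφ) ⊆ S'.atlas :=
  range_subset_iff.2 fun a => S'.mulLeft_symm_transPartialEquiv_mem_atlas
    (S'.mem_atlas_of_eqOnSource hΦ (S.eqOnSource_pushChart hφ h)) a

variable [CompactSpace M] [T2Space M] [ContinuousConstSMul 𝕜 H] [SMulCommClass ℝ 𝕜 H]

theorem smoothChange_leftChart (a b : S.mapSubgroup 𝕜 A) :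
    SmoothChange 𝕝 (S.leftChart 𝕜 A hφ a) (S.leftChart 𝕜 A hφ b) :=
  S.isSmoothOn_leftChart hφ (j := ContinuousLinearMap.id ℝ (SmoothFun 𝕜 A H))
    (LinearMap.id : SmoothFun 𝕜 A H →ₗ[𝕝] SmoothFun 𝕜 A H).isLinear
    (S.smoothFamilyInto_leftChart_symm_id hφ a) (fun _ h m => S.leftChart_symm_apply hφ h m) b

theorem smoothChange_of_mem_range_leftChart :
    ∀ e ∈ range (S.leftChart 𝕜 A hφ), ∀ e' ∈ range (S.leftChart 𝕜 A hφ), SmoothChange 𝕝 e e' :=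
  forall_mem_range.2 fun a => forall_mem_range.2 (S.smoothChange_leftChart hφ a)

variable (h1 : (1 : K) ∈ φ.source)

variable (𝕜 A) in
/-- The left translates of the push-forward of the chart `φ`, as an atlas of the group of smooth
maps which does not presuppose a topology on this group. -/
noncomputable def mapCore : ChartedSpaceCore (SmoothFun 𝕜 A H) (S.mapSubgroup 𝕜 A) where
  atlas := range (S.leftChart 𝕜 A hφ)
  chartAt := S.leftChart 𝕜 A hφ
  mem_chart_source := S.mem_leftChart_source_self hφ h1
  chart_mem_atlas := mem_range_self
  open_source := by
    rintro _ _ ⟨a, rfl⟩ ⟨b, rfl⟩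
    exact S.isOpen_leftChart_target_inter hφ a b
  continuousOn_toFun := by
    rintro _ _ ⟨a, rfl⟩ ⟨b, rfl⟩
    exact (S.smoothChange_leftChart hφ a b).continuousOn

variable (𝕜 A) in
/-- The topology on the group of smooth maps for which the left translates of the push-forward of
the chart `φ` are homeomorphisms. -/
@[reducible] noncomputable def mapTop : TopologicalSpace (S.mapSubgroup 𝕜 A) :=
  (S.mapCore 𝕜 A hφ h1).toTopologicalSpace

theorem isOpenAtlas_leftChart :
    @IsOpenAtlas _ _ _ (S.mapTop 𝕜 A hφ h1) (range (S.leftChart 𝕜 A hφ)) :=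
  letI := S.mapTop 𝕜 A hφ h1
  { isOpen_source := fun _ he => (S.mapCore 𝕜 A hφ h1).open_source' he
    isOpen_target := fun _ he => (S.mapCore 𝕜 A hφ h1).open_target he
    continuousOn := fun e he =>
      ((S.mapCore 𝕜 A hφ h1).openPartialHomeomorph e he).continuousOn_toFun
    continuousOn_symm := fun e he =>
      ((S.mapCore 𝕜 A hφ h1).openPartialHomeomorph e he).continuousOn_invFun
    cover := fun a => ⟨_, mem_range_self a, S.mem_leftChart_source_self hφ h1 a⟩ }

theorem continuous_eval_mapTop (m : M) :
    Continuous[S.mapTop 𝕜 A hφ h1, S.top] fun γ : S.mapSubgroup 𝕜 A => γ.1 m := by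
  let := S.mapTop 𝕜 A hφ h1
  have := S.isOpenAtlas_leftChart (𝕜 := 𝕜) (A := A) hφ h1
  let := S.top
  have := S.isOpenAtlas
  refine continuous_of_charts (range (S.leftChart 𝕜 A hφ)) (forall_mem_range.2 fun a => ?_)
  have hslice := ((S.smoothFamilyInto_leftChart_symm_id hφ a).slice m).continuousOn
  have heval : Continuous fun ξ : SmoothFun 𝕜 A H => ξ.1 m :=
    SmoothFun.continuous_eval.comp (Continuous.prodMk_left m)
  exact (hslice.comp heval.continuousOn fun ξ (hξ : ∀ m, ξ.1 m ∈ φ.target) => hξ m).congr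
    fun ξ hξ => S.leftChart_symm_apply hφ hξ m

theorem t2Space_mapTop : @T2Space _ (S.mapTop 𝕜 A hφ h1) := by
  let := S.mapTop 𝕜 A hφ h1
  let := S.top
  have := S.t2
  exact T2Space.of_injective_continuous Subtype.val_injective
    (continuous_pi fun m => S.continuous_eval_mapTop hφ h1 m)

theorem isSmoothMap_mul_leftChart :
    IsSmoothMap 𝕝
      (@instTopologicalSpaceProd _ _ (S.mapTop 𝕜 A hφ h1) (S.mapTop 𝕜 A hφ h1))
      (Set.image2 (fun e e' => e.prod e') (range (S.leftChart 𝕜 A hφ))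
        (range (S.leftChart 𝕜 A hφ)))
      (S.mapTop 𝕜 A hφ h1) (range (S.leftChart 𝕜 A hφ)) fun p => p.1 * p.2 := by
  let := S.mapTop 𝕜 A hφ h1
  have := S.isOpenAtlas_leftChart (𝕜 := 𝕜) (A := A) hφ h1
  refine (isSmoothMap_iff_smoothInto (S.smoothChange_of_mem_range_leftChart hφ)).2 ?_
  rintro _ ⟨_, ⟨a, rfl⟩, _, ⟨b, rfl⟩, rfl⟩
  have ha := S.smoothFamilyInto_leftChart_symm hφ (ContinuousLinearMap.fst ℝ H H)
    (LinearMap.fst 𝕜 H H).isLinear (LinearMap.fst 𝕝 H H).isLinear a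
  have hb := S.smoothFamilyInto_leftChart_symm hφ (ContinuousLinearMap.snd ℝ H H)
    (LinearMap.snd 𝕜 H H).isLinear (LinearMap.snd 𝕝 H H).isLinear b
  have hab := (ha.inter hb.isOpen).mul S (inter_comm _ _ ▸ hb.inter ha.isOpen)
  let pair := SmoothFun.pairCLM (ContinuousLinearMap.id ℝ (SmoothFun 𝕜 A H))
    (ContinuousLinearMap.id ℝ (SmoothFun 𝕜 A H))
  have hpair : IsLinearMap 𝕝 pair := ⟨fun _ _ => rfl, fun _ _ => rfl⟩
  have hsmooth := S.smoothInto_leftChart hφ hpair hab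
    (T := fun p => (S.leftChart 𝕜 A hφ a).symm p.1 * (S.leftChart 𝕜 A hφ b).symm p.2)
    (fun p hp m => congrArg₂ (· * ·) (S.leftChart_symm_apply hφ (fun m => (hp m).1) m)
      (S.leftChart_symm_apply hφ (fun m => (hp m).2) m)) h1
  have htarget : ((S.leftChart 𝕜 A hφ a).prod (S.leftChart 𝕜 A hφ b)).target =
      {p | ∀ m, p.1.1 m ∈ φ.target ∧ p.2.1 m ∈ φ.target} := ext fun p => forall_and.symm
  exact htarget ▸ hsmooth

theorem isSmoothMap_inv_leftChart :
    IsSmoothMap 𝕝 (S.mapTop 𝕜 A hφ h1) (range (S.leftChart 𝕜 A hφ))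
      (S.mapTop 𝕜 A hφ h1) (range (S.leftChart 𝕜 A hφ)) fun γ => γ⁻¹ := by
  let := S.mapTop 𝕜 A hφ h1
  have := S.isOpenAtlas_leftChart (𝕜 := 𝕜) (A := A) hφ h1
  refine (isSmoothMap_iff_smoothInto (S.smoothChange_of_mem_range_leftChart hφ)).2
    (forall_mem_range.2 fun a => ?_)
  exact S.smoothInto_leftChart hφ (j := ContinuousLinearMap.id ℝ (SmoothFun 𝕜 A H))
    (LinearMap.id : SmoothFun 𝕜 A H →ₗ[𝕝] SmoothFun 𝕜 A H).isLinear
    ((S.smoothFamilyInto_leftChart_symm_id hφ a).inv S)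
    (fun ξ hξ m => congrArg (·⁻¹) (S.leftChart_symm_apply hφ hξ m)) h1

variable (𝕜 A) in
/-- The Lie group structure on the group of smooth maps whose maximal atlas is generated by the
left translates of the push-forward of the chart `φ`. -/
noncomputable def mapGroup : LieGroupStructure 𝕝 (S.mapSubgroup 𝕜 A) (SmoothFun 𝕜 A H) :=
  letI := S.mapTop 𝕜 A hφ h1
  have := S.t2Space_mapTop (𝕜 := 𝕜) (A := A) hφ h1
  have := S.isOpenAtlas_leftChart (𝕜 := 𝕜) (A := A) hφ h1
  ofAtlas (range (S.leftChart 𝕜 A hφ)) (S.smoothChange_of_mem_range_leftChart hφ)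
    (S.isSmoothMap_mul_leftChart hφ h1) (S.isSmoothMap_inv_leftChart hφ h1)

theorem range_leftChart_subset_mapGroup :
    range (S.leftChart 𝕜 A hφ) ⊆ (S.mapGroup 𝕜 A hφ h1).atlas :=
  letI := S.mapTop 𝕜 A hφ h1
  have := S.t2Space_mapTop (𝕜 := 𝕜) (A := A) hφ h1
  have := S.isOpenAtlas_leftChart (𝕜 := 𝕜) (A := A) hφ h1
  ManifoldStructure.subset_ofAtlas (S.smoothChange_of_mem_range_leftChart hφ)

include hφ h1 in
theorem existsUnique_mapGroup :
    ∃! S' : LieGroupStructure 𝕝 (S.mapSubgroup 𝕜 A) (SmoothFun 𝕜 A H),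
      ∃ Φ ∈ S'.atlas, IsPushForward 𝕜 φ Φ := by
  refine ⟨S.mapGroup 𝕜 A hφ h1, ⟨S.pushChart 𝕜 A hφ, ?_, S.isPushForward_pushChart hφ⟩, ?_⟩
  · rw [← S.leftChart_one hφ]
    exact S.range_leftChart_subset_mapGroup hφ h1 (mem_range_self 1)
  · rintro S' ⟨Φ, hΦ, h⟩
    exact LieGroupStructure.eq_of_subset (S.range_leftChart_subset_of_isPushForward hφ hΦ h)
      (S.range_leftChart_subset_mapGroup hφ h1)
      fun γ => ⟨_, mem_range_self γ, S.mem_leftChart_source_self hφ h1 γ⟩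

end LieGroupStructure

end MapGroup

section Corners

variable {E : Type u} [AddCommGroup E] [Module ℝ E] [TopologicalSpace E]

theorem convex_posCone {n : ℕ} {lam : Fin n → (E →L[ℝ] ℝ)} : Convex ℝ (posCone lam) := by
  intro x hx y hy a b ha hb _ i
  rw [map_add, map_smul, map_smul]
  exact add_nonneg (mul_nonneg ha (hx i)) (mul_nonneg hb (hy i))

theorem ManifoldStructure.isAtlas {𝕜 : Type*} [Semiring 𝕜] [Module 𝕜 E]
    [IsTopologicalAddGroup E] [ContinuousSMul ℝ E] {M : Type w} {Q : Set E}
    (S : ManifoldStructure 𝕜 M E Q) (hQ : Accessible Q) :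
    @IsAtlas _ _ S.top _ _ _ S.atlas :=
  letI := S.top
  { accessible := fun φ hφ => by
      obtain ⟨O, hO, hφO⟩ := (S.isChart φ hφ).target_eq
      rw [hφO, inter_comm]
      exact hQ.inter_isOpen hO
    isOpen_source := fun φ hφ => (S.isChart φ hφ).isOpen_source
    continuousOn := fun φ hφ => (S.isChart φ hφ).continuousOn
    continuousOn_symm := fun φ hφ => (S.isChart φ hφ).continuousOn_symm
    cover := S.cover }

end Corners

end MappingGroup

open MappingGroup in
theorem mainTheorem1_general {𝕜 𝕝 : Type*} [CommSemiring 𝕜] [CommSemiring 𝕝] [Algebra 𝕜 𝕝]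
    [TopologicalSpace 𝕝]
    {E : Type u} [AddCommGroup E] [Module ℝ E] [Module 𝕜 E] [TopologicalSpace E]
    [IsTopologicalAddGroup E] [ContinuousSMul ℝ E] [T2Space E] {Q : Set E} (hQ : Accessible Q)
    {M : Type w} (SM : ManifoldStructure 𝕜 M E Q) (hM : @CompactSpace M SM.top)
    {𝔨 : Type v} [AddCommGroup 𝔨] [Module ℝ 𝔨] [Module 𝕜 𝔨] [Module 𝕝 𝔨] [IsScalarTower 𝕜 𝕝 𝔨]
    [SMulCommClass 𝕜 ℝ 𝔨] [SMulCommClass ℝ 𝕝 𝔨]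
    [TopologicalSpace 𝔨] [IsTopologicalAddGroup 𝔨] [ContinuousSMul ℝ 𝔨] [ContinuousSMul 𝕝 𝔨]
    [LocallyConvexSpace ℝ 𝔨] [T2Space 𝔨]
    {K : Type x} [Group K] (SK : LieGroupStructure 𝕝 K 𝔨) {φ : PartialEquiv K 𝔨}
    (hφ : φ ∈ SK.atlas) (h1 : (1 : K) ∈ φ.source) :
    IsLocallyConvexTVS 𝕝 (SmoothFun 𝕜 SM.atlas 𝔨) ∧
    ∃ G : Subgroup (M → K),
      (∀ f : M → K, f ∈ G ↔ IsSmoothMap 𝕜 SM.top SM.atlas SK.top SK.atlas f) ∧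
      ∃! S : LieGroupStructure 𝕝 G (SmoothFun 𝕜 SM.atlas 𝔨),
        ∃ Φ ∈ S.atlas, IsPushForward 𝕜 φ Φ := by
  let := SM.top
  have := SM.t2
  have := SM.isAtlas hQ
  have : ContinuousConstSMul 𝕜 𝔨 :=
    ⟨fun c => by simpa only [algebraMap_smul] using
      continuous_const_smul (T := 𝔨) (algebraMap 𝕜 𝕝 c)⟩
  have : SMulCommClass ℝ 𝕜 𝔨 := SMulCommClass.symm 𝕜 ℝ 𝔨
  exact ⟨⟨inferInstance, inferInstance, inferInstance, inferInstance⟩, SK.mapSubgroup 𝕜 SM.atlas,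
    fun _ => SK.mem_mapSubgroup SM.atlas, SK.existsUnique_mapGroup hφ h1⟩

theorem mainTheorem1 :
    -- a) `M` smooth, `K` a smooth Lie group
    (∀ (E : Type u) [AddCommGroup E] [Module ℝ E] [TopologicalSpace E]
      [IsTopologicalAddGroup E] [ContinuousSMul ℝ E] [LocallyConvexSpace ℝ E] [T2Space E]
      (n : ℕ) (lam : Fin n → (E →L[ℝ] ℝ)) (_ : (interior (MappingGroup.posCone lam)).Nonempty)
      (M : Type w) (SM : MappingGroup.ManifoldStructure ℝ M E (MappingGroup.posCone lam))
      (_ : @CompactSpace M SM.top)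
      (𝔨 : Type v) [AddCommGroup 𝔨] [Module ℝ 𝔨] [TopologicalSpace 𝔨]
      [IsTopologicalAddGroup 𝔨] [ContinuousSMul ℝ 𝔨] [LocallyConvexSpace ℝ 𝔨] [T2Space 𝔨]
      (K : Type x) [Group K] (SK : MappingGroup.LieGroupStructure ℝ K 𝔨)
      (φ : PartialEquiv K 𝔨) (_ : φ ∈ SK.atlas) (_ : (1 : K) ∈ φ.source) (_ : φ 1 = 0),
      MappingGroup.IsLocallyConvexTVS ℝ (MappingGroup.SmoothFun ℝ SM.atlas 𝔨) ∧
      ∃ G : Subgroup (M → K),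
        (∀ f : M → K, f ∈ G ↔
          MappingGroup.IsSmoothMap ℝ SM.top SM.atlas SK.top SK.atlas f) ∧
        ∃! S : MappingGroup.LieGroupStructure ℝ G (MappingGroup.SmoothFun ℝ SM.atlas 𝔨),
          ∃ Φ ∈ S.atlas, MappingGroup.IsPushForward ℝ φ Φ) ∧
    -- b) `M` smooth, `K` a complex Lie group
    (∀ (E : Type u) [AddCommGroup E] [Module ℝ E] [TopologicalSpace E]
      [IsTopologicalAddGroup E] [ContinuousSMul ℝ E] [LocallyConvexSpace ℝ E] [T2Space E]
      (n : ℕ) (lam : Fin n → (E →L[ℝ] ℝ)) (_ : (interior (MappingGroup.posCone lam)).Nonempty)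
      (M : Type w) (SM : MappingGroup.ManifoldStructure ℝ M E (MappingGroup.posCone lam))
      (_ : @CompactSpace M SM.top)
      (𝔨 : Type v) [AddCommGroup 𝔨] [Module ℝ 𝔨] [Module ℂ 𝔨] [IsScalarTower ℝ ℂ 𝔨]
      [TopologicalSpace 𝔨] [IsTopologicalAddGroup 𝔨] [ContinuousSMul ℝ 𝔨] [ContinuousSMul ℂ 𝔨]
      [LocallyConvexSpace ℝ 𝔨] [T2Space 𝔨]
      (K : Type x) [Group K] (SK : MappingGroup.LieGroupStructure ℂ K 𝔨)
      (φ : PartialEquiv K 𝔨) (_ : φ ∈ SK.atlas) (_ : (1 : K) ∈ φ.source) (_ : φ 1 = 0),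
      MappingGroup.IsLocallyConvexTVS ℂ (MappingGroup.SmoothFun ℝ SM.atlas 𝔨) ∧
      ∃ G : Subgroup (M → K),
        (∀ f : M → K, f ∈ G ↔
          MappingGroup.IsSmoothMap ℝ SM.top SM.atlas SK.top SK.atlas f) ∧
        ∃! S : MappingGroup.LieGroupStructure ℂ G (MappingGroup.SmoothFun ℝ SM.atlas 𝔨),
          ∃ Φ ∈ S.atlas, MappingGroup.IsPushForward ℝ φ Φ) ∧
    -- c) `M` complex, `K` a complex Lie group
    (∀ (E : Type u) [AddCommGroup E] [Module ℝ E] [Module ℂ E] [IsScalarTower ℝ ℂ E]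
      [TopologicalSpace E] [IsTopologicalAddGroup E] [ContinuousSMul ℝ E] [ContinuousSMul ℂ E]
      [LocallyConvexSpace ℝ E] [T2Space E]
      (n : ℕ) (lam : Fin n → (E →L[ℝ] ℝ)) (_ : (interior (MappingGroup.posCone lam)).Nonempty)
      (M : Type w) (SM : MappingGroup.ManifoldStructure ℂ M E (MappingGroup.posCone lam))
      (_ : @CompactSpace M SM.top)
      (𝔨 : Type v) [AddCommGroup 𝔨] [Module ℝ 𝔨] [Module ℂ 𝔨] [IsScalarTower ℝ ℂ 𝔨]
      [TopologicalSpace 𝔨] [IsTopologicalAddGroup 𝔨] [ContinuousSMul ℝ 𝔨] [ContinuousSMul ℂ 𝔨]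
      [LocallyConvexSpace ℝ 𝔨] [T2Space 𝔨]
      (K : Type x) [Group K] (SK : MappingGroup.LieGroupStructure ℂ K 𝔨)
      (φ : PartialEquiv K 𝔨) (_ : φ ∈ SK.atlas) (_ : (1 : K) ∈ φ.source) (_ : φ 1 = 0),
      MappingGroup.IsLocallyConvexTVS ℂ (MappingGroup.SmoothFun ℂ SM.atlas 𝔨) ∧
      ∃ G : Subgroup (M → K),
        (∀ f : M → K, f ∈ G ↔
          MappingGroup.IsSmoothMap ℂ SM.top SM.atlas SK.top SK.atlas f) ∧
        ∃! S : MappingGroup.LieGroupStructure ℂ G (MappingGroup.SmoothFun ℂ SM.atlas 𝔨),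
          ∃ Φ ∈ S.atlas, MappingGroup.IsPushForward ℂ φ Φ) := by
  refine ⟨?_, ?_, ?_⟩
  · intro E _ _ _ _ _ _ _ n lam hlam M SM hM 𝔨 _ _ _ _ _ _ _ K _ SK φ hφ h1 _
    exact mainTheorem1_general (MappingGroup.accessible_of_convex
      MappingGroup.convex_posCone hlam) SM hM SK hφ h1
  · intro E _ _ _ _ _ _ _ n lam hlam M SM hM 𝔨 _ _ _ _ _ _ _ _ _ _ K _ SK φ hφ h1 _
    exact mainTheorem1_general (MappingGroup.accessible_of_convex
      MappingGroup.convex_posCone hlam) SM hM SK hφ h1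
  · intro E _ _ _ _ _ _ _ _ _ _ n lam hlam M SM hM 𝔨 _ _ _ _ _ _ _ _ _ _ K _ SK φ hφ h1 _
    exact mainTheorem1_general (MappingGroup.accessible_of_convex
      MappingGroup.convex_posCone hlam) SM hM SK hφ h1
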